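/- Let $k$ be a field, $A$ an abelian group, and let $S = k[x_0,\dots,x_n]$ be $A$-graded by homogeneous variables; assume the grading is positive, i.e. $S_0 = k$ and there is a homomorphism $\theta : A \to \mathbb{Z}$ with $\theta(\deg x_i) > 0$ for all $i$. Let $E = \Lambda_k(e_0,\dots,e_n)$ be the exterior algebra, $A\oplus\mathbb{Z}$-graded by $\deg e_i = (-\deg x_i; -1)$, and let $\omega_E = \operatorname{Hom}_k(E,k)$ with its dual grading and its right $E$-module structure $(f\cdot y)(z) = f(yz)$. A right graded $E$-module $D$ is also regarded as a left module via $e_i x = (-1)^j x e_i$ for $x \in D_{(a;j)}$. For an $A$-graded $S$-module $M$, let $\mathbf{R}(M) = \bigoplus_{a\in A} M_a \otimes_k \omega_E(-a;0)$ with differential $m\otimes f \mapsto \sum_i x_i m \otimes e_i f$, and for $a \in A$ let $K_a(M) = \ker\bigl(M_a\otimes_k \omega_E(-a;0) \to \mathbf{R}(M)\bigr)$ be the kernel of this differential on the summand indexed by $a$. For a graded $E$-module $N$ (with zero differential) let $\mathbf{L}(N)$ be the complex of graded $S$-modules with $\mathbf{L}(N)_j = \bigoplus_{a\in A} S(-a)\otimes_k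 N_{(a;j)}$ and differential $s\otimes x \mapsto \sum_i x_i s\otimes e_i x$. A complex of free graded $S$-modules is *strongly linear* if its terms have homogeneous bases with respect to which all entries of the matrices of the differentials are $k$-linear combinations of the variables $x_0,\dots,x_n$. A subcomplex $C'$ of a complex $C$ of graded $S$-modules is *quasi-split* if each $C'_j$ is a direct summand of $C_j$ as a graded $S$-module. A *minimal free resolution* of $M$ is a quasi-isomorphism $F \to M$, where $F$ is a complex of free graded $S$-modules with differentials zero modulo $(x_0,\dots,x_n)$, with $F_j = 0$ for $j \ll 0$, and such that for each $j$ there is a homomorphism $\theta: A\to\mathbb{Z}$, positive on all $\deg x_i$, for which the degrees $\theta(a)$ with $(F_j)_a \neq 0$ are bounded below. **Theorem.** Let $M$ be an $A$-graded $S$-module that is generated in a single degree $d \in A$, and let $F$ be a minimal free resolution of $M$. 1. $\mathbf{L}(K_d(M))$ is strongly linear and is isomorphic to a quasi-split subcomplex of $F$. 2. Every strongly linear, quasi-split subcomplex of $F$ is isomorphic to a quasi-split subcomplex of $\mathbf{L}(K_d(M))$. 3. $\mathbf{L}(K_d(M))$ is, up to isomorphism, the unique maximal strongly linear, quasi-split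 subcomplex of $F$: there is a subcomplex of $F$ that is maximal with respect to inclusion among the strongly linear, quasi-split subcomplexes and is isomorphic to $\mathbf{L}(K_d(M))$, and every subcomplex that is maximal in this sense is isomorphic to $\mathbf{L}(K_d(M))$. 4. If $F$ is strongly linear, then $F \cong \mathbf{L}(K_d(M))$. -/

import Mathlib

open scoped TensorProduct

namespace MultigradedBGG

/-! ## Internal gradings of vector spaces -/

section Grading

variable {k : Type*} [Field k] {ι κ l V W : Type*} [AddCommGroup V] [Module k V]
  [AddCommGroup W] [Module k W]

/-- `V` is the internal direct sum of the subspaces `gr i`. -/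
structure IsGrading (gr : ι → Submodule k V) : Prop where
  indep : iSupIndep gr
  iSup_eq_top : ⨆ i, gr i = ⊤

theorem iSupIndep_of_proj (gr : ι → Submodule k V) (p : ι → V →ₗ[k] V)
    (h1 : ∀ i, ∀ x ∈ gr i, p i x = x) (h2 : ∀ i j, j ≠ i → ∀ x ∈ gr j, p i x = 0) :
    iSupIndep gr := by
  intro i
  rw [Submodule.disjoint_def]
  intro x hx hx'
  have : (⨆ j, ⨆ (_ : j ≠ i), gr j) ≤ LinearMap.ker (p i) := by
    refine iSup₂_le fun j hj y hy => ?_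
    exact h2 i j hj y hy
  rw [← h1 i x hx]
  exact this hx'

theorem isGrading_comap {gr : ι → Submodule k V} (hi : iSupIndep gr) {U : Submodule k V}
    (hU : ⨆ i, gr i = U) : IsGrading fun i => (gr i).comap U.subtype := by
  have hle : ∀ i, gr i ≤ LinearMap.range U.subtype := by
    intro i
    rw [Submodule.range_subtype, ← hU]
    exact le_iSup gr i
  refine ⟨?_, ?_⟩
  · intro i
    have h := hi i
    rw [Submodule.disjoint_def] at h ⊢
    intro x hx hx'
    have : (x : V) = 0 := by
      refine h _ hx ?_
      have h3 : (⨆ j, ⨆ (_ : j ≠ i), (gr j).comap U.subtype).map U.subtype ≤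
          ⨆ j, ⨆ (_ : j ≠ i), gr j := by
        simp only [Submodule.map_iSup]
        exact iSup₂_mono fun j _ => Submodule.map_comap_le _ _
      exact h3 ⟨x, hx', rfl⟩
    exact Subtype.ext this
  · apply Submodule.map_injective_of_injective U.injective_subtype
    rw [Submodule.map_iSup, Submodule.map_top, Submodule.range_subtype]
    simp only [Submodule.map_comap_eq_of_le (hle _)]
    exact hU

namespace IsGrading

variable {gr : ι → Submodule k V}

/-- The map sending a vector to the finitely supported family of its homogeneous components. -/
noncomputable def components (h : IsGrading gr) : V →ₗ[k] (ι →₀ V) := by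
  classical
  exact (DirectSum.toModule k ι (ι →₀ V) fun i => (Finsupp.lsingle i) ∘ₗ (gr i).subtype) ∘ₗ
    (LinearEquiv.ofBijective (DirectSum.coeLinearMap gr)
      (DirectSum.isInternal_submodule_of_iSupIndep_of_iSup_eq_top
        h.indep h.iSup_eq_top)).symm.toLinearMap

theorem components_of_mem (h : IsGrading gr) {i : ι} {x : V} (hx : x ∈ gr i) :
    h.components x = Finsupp.single i x := by
  classical
  have : (LinearEquiv.ofBijective (DirectSum.coeLinearMap gr)
      (DirectSum.isInternal_submodule_of_iSupIndep_of_iSup_eq_top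
        h.indep h.iSup_eq_top)).symm x = DirectSum.lof k ι (fun i => gr i) i ⟨x, hx⟩ := by
    rw [LinearEquiv.symm_apply_eq]
    exact (DirectSum.coeLinearMap_lof gr i ⟨x, hx⟩).symm
  simp only [components, LinearMap.comp_apply, LinearEquiv.coe_coe]
  rw [this, DirectSum.toModule_lof]
  simp

/-- The projection onto the homogeneous component of index `i`. -/
noncomputable def proj (h : IsGrading gr) (i : ι) : V →ₗ[k] V := Finsupp.lapply i ∘ₗ h.components

theorem proj_of_mem (h : IsGrading gr) {i : ι} {x : V} (hx : x ∈ gr i) : h.proj i x = x := by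
  simp [proj, h.components_of_mem hx]

theorem proj_of_mem_of_ne (h : IsGrading gr) {i j : ι} (hij : i ≠ j) {x : V} (hx : x ∈ gr i) : h.proj j x = 0 := by
  simp [proj, h.components_of_mem hx, hij]


/-- Induction on homogeneous elements. -/
theorem induction_on (h : IsGrading gr) {P : V → Prop} (x : V) (hom : ∀ i, ∀ x ∈ gr i, P x)
    (zero : P 0) (add : ∀ x y, P x → P y → P (x + y)) : P x := by
  have hx : x ∈ ⨆ i, gr i := h.iSup_eq_top ▸ Submodule.mem_top
  exact Submodule.iSup_induction gr (motive := P) hx hom zero add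

theorem linearMap_ext (h : IsGrading gr) {f g : V →ₗ[k] W} (hfg : ∀ i, ∀ x ∈ gr i, f x = g x) : f = g := by
  ext x
  refine h.induction_on x hfg (by simp) ?_
  intro x y hx hy
  simp [hx, hy]

theorem proj_mem (h : IsGrading gr) (i : ι) (x : V) : h.proj i x ∈ gr i := by
  refine h.induction_on (P := fun x => h.proj i x ∈ gr i) x ?_ (by simp) ?_
  · intro j y hy
    by_cases hij : j = i
    · subst hij
      rwa [h.proj_of_mem hy]
    · rw [h.proj_of_mem_of_ne hij hy]
      exact zero_mem _
  · intro x y hx hy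
    rw [map_add]
    exact add_mem hx hy

theorem mem_iSup_of_proj_mem (h : IsGrading gr) {P : Submodule k V} {x : V} (hx : ∀ i, h.proj i x ∈ P) :
    x ∈ ⨆ i, P ⊓ gr i := by
  have hsum : ∀ x : V, (h.components x).sum (fun _ v => v) = x := by
    intro x
    refine h.induction_on (P := fun x => (h.components x).sum (fun _ v => v) = x) x ?_ (by simp) ?_
    · intro i y hy
      rw [h.components_of_mem hy]
      simp
    · intro x y hx hy
      rw [map_add, Finsupp.sum_add_index' (by simp) (by simp), hx, hy]
  rw [← hsum x]
  refine Submodule.sum_mem _ fun i _ => ?_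
  exact Submodule.mem_iSup_of_mem i ⟨hx i, h.proj_mem i x⟩

end IsGrading

/-- A subspace is homogeneous if it is spanned by its homogeneous elements. -/
def IsHomogeneous (gr : ι → Submodule k V) (P : Submodule k V) : Prop :=
  P ≤ ⨆ i, P ⊓ gr i

theorem IsHomogeneous.iSup_eq {gr : ι → Submodule k V} {P : Submodule k V}
    (hP : IsHomogeneous gr P) : ⨆ i, P ⊓ gr i = P :=
  le_antisymm (iSup_le fun _ => inf_le_left) hP

theorem IsGrading.restrict {gr : ι → Submodule k V} (h : IsGrading gr) {P : Submodule k V}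
    (hP : IsHomogeneous gr P) : IsGrading fun i => (gr i).comap P.subtype := by
  have := isGrading_comap (h.indep.mono fun i => (inf_le_right : P ⊓ gr i ≤ gr i)) hP.iSup_eq
  simpa using this

theorem IsHomogeneous.proj_mem {gr : ι → Submodule k V} (h : IsGrading gr) {P : Submodule k V}
    (hP : IsHomogeneous gr P) (i : ι) {x : V} (hx : x ∈ P) : h.proj i x ∈ P := by
  have hx' := hP hx
  refine Submodule.iSup_induction (fun i => P ⊓ gr i) (motive := fun x => h.proj i x ∈ P) hx'
    ?_ (by simp) ?_
  · intro j y hy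
    by_cases hij : j = i
    · subst hij
      rw [h.proj_of_mem hy.2]
      exact hy.1
    · rw [h.proj_of_mem_of_ne hij hy.2]
      exact zero_mem _
  · intro x y hx hy
    rw [map_add]
    exact add_mem hx hy

/-- The grading on `V ⊗ W` in which the tensor product of elements of degrees `i` and `j` has
degree `g i j`. -/
def tensorGr (grV : ι → Submodule k V) (grW : κ → Submodule k W) (g : ι → κ → l) (c : l) :
    Submodule k (V ⊗[k] W) :=
  Submodule.span k {t | ∃ i j, ∃ v ∈ grV i, ∃ w ∈ grW j, g i j = c ∧ v ⊗ₜ[k] w = t}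

theorem tmul_mem_tensorGr {grV : ι → Submodule k V} {grW : κ → Submodule k W} (g : ι → κ → l)
    {i : ι} {j : κ} {v : V} {w : W} (hv : v ∈ grV i) (hw : w ∈ grW j) :
    v ⊗ₜ[k] w ∈ tensorGr grV grW g (g i j) :=
  Submodule.subset_span ⟨i, j, v, hv, w, hw, rfl, rfl⟩

theorem IsGrading.tensor {grV : ι → Submodule k V} {grW : κ → Submodule k W}
    (hV : IsGrading grV) (hW : IsGrading grW) (g : ι → κ → l) :
    IsGrading (tensorGr grV grW g) := by
  classical
  let c : V ⊗[k] W →ₗ[k] (l →₀ V ⊗[k] W) :=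
    (Finsupp.lmapDomain (V ⊗[k] W) k fun p : ι × κ => g p.1 p.2) ∘ₗ
      (finsuppTensorFinsupp k k V W ι κ).toLinearMap ∘ₗ
        TensorProduct.map hV.components hW.components
  have hc : ∀ a, ∀ t ∈ tensorGr grV grW g a, c t = Finsupp.single a t := by
    intro a t ht
    have : tensorGr grV grW g a ≤ LinearMap.eqLocus c (Finsupp.lsingle a) := by
      refine Submodule.span_le.mpr ?_
      rintro _ ⟨i, j, v, hv, w, hw, rfl, rfl⟩
      simp only [SetLike.mem_coe, LinearMap.mem_eqLocus]
      simp [c, hV.components_of_mem hv, hW.components_of_mem hw, finsuppTensorFinsupp_single,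
        Finsupp.mapDomain_single]
    exact this ht
  refine ⟨iSupIndep_of_proj _ (fun a => Finsupp.lapply a ∘ₗ c) ?_ ?_, ?_⟩
  · intro a t ht
    simp [hc a t ht]
  · intro a b hba t ht
    simp [hc b t ht, hba]
  · rw [eq_top_iff]
    rintro t -
    induction t using TensorProduct.induction_on with
    | zero => exact zero_mem _
    | add x y hx hy => exact add_mem hx hy
    | tmul v w =>
      refine hV.induction_on (P := fun v => v ⊗ₜ[k] w ∈ ⨆ i, tensorGr grV grW g i) v ?_ (by simp) (fun x y hx hy => by
        rw [TensorProduct.add_tmul]; exact add_mem hx hy)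
      intro i v hv
      refine hW.induction_on (P := fun w => v ⊗ₜ[k] w ∈ ⨆ i, tensorGr grV grW g i) w ?_ (by simp) (fun x y hx hy => by
        rw [TensorProduct.tmul_add]; exact add_mem hx hy)
      intro j w hw
      exact Submodule.mem_iSup_of_mem _ (tmul_mem_tensorGr g hv hw)

end Grading

/-! ## The exterior algebra and its dual -/

section Exterior

variable (k : Type*) [Field k] (n : ℕ)

/-- The exterior algebra `E = Λ(e₀, …, eₙ)`. -/
abbrev Ext : Type _ := ExteriorAlgebra k (Fin (n + 1) → k)

variable {n}

/-- The exterior variable `eᵢ`. -/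
noncomputable def e (i : Fin (n + 1)) : Ext k n := ExteriorAlgebra.ι k (Pi.single i 1)

theorem e_mul_self (i : Fin (n + 1)) : e k i * e k i = 0 := ExteriorAlgebra.ι_sq_zero _

theorem e_mul_add (i j : Fin (n + 1)) : e k i * e k j + e k j * e k i = 0 :=
  ExteriorAlgebra.ι_add_mul_swap _ _

theorem ι_eq_sum (v : Fin (n + 1) → k) : ExteriorAlgebra.ι k v = ∑ i, v i • e k i := by
  conv_lhs => rw [pi_eq_sum_univ' v]
  simp only [map_sum, map_smul, e]

variable {A : Type*} [AddCommGroup A] (w : Fin (n + 1) → A)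

/-- The `A ⊕ ℤ`-grading on `E` with `deg eᵢ = (-deg xᵢ; -1)`, where `deg xᵢ = w i`. -/
def extGr (p : A × ℤ) : Submodule k (Ext k n) :=
  Submodule.span k {y | ∃ l : List (Fin (n + 1)),
    (l.map fun i => ((-w i, -1) : A × ℤ)).sum = p ∧ (l.map (e k)).prod = y}

theorem e_mem_extGr (i : Fin (n + 1)) : e k i ∈ extGr k w (-w i, -1) :=
  Submodule.subset_span ⟨[i], by simp, by simp⟩

theorem extGr_mul_mem {p q : A × ℤ} {x y : Ext k n} (hx : x ∈ extGr k w p)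
    (hy : y ∈ extGr k w q) : x * y ∈ extGr k w (p + q) := by
  induction hx using Submodule.span_induction with
  | zero => simp
  | add a b _ _ ha hb => rw [add_mul]; exact add_mem ha hb
  | smul r a _ ha => rw [smul_mul_assoc]; exact Submodule.smul_mem _ _ ha
  | mem x hx =>
    obtain ⟨l, rfl, rfl⟩ := hx
    induction hy using Submodule.span_induction with
    | zero => simp
    | add a b _ _ ha hb => rw [mul_add]; exact add_mem ha hb
    | smul r a _ ha => rw [mul_smul_comm]; exact Submodule.smul_mem _ _ ha
    | mem y hy =>
      obtain ⟨l', rfl, rfl⟩ := hy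
      exact Submodule.subset_span ⟨l ++ l', by simp, by simp⟩

theorem sq_sum_eq_zero {R ι : Type*} [Ring R] [Algebra k R] (T : ι → R)
    (h1 : ∀ i, T i * T i = 0) (h2 : ∀ i j, T i * T j + T j * T i = 0) (v : ι → k)
    (s : Finset ι) : (∑ i ∈ s, v i • T i) * (∑ i ∈ s, v i • T i) = 0 := by
  classical
  induction s using Finset.induction_on with
  | empty => simp
  | insert a s ha ih =>
    rw [Finset.sum_insert ha, add_mul, mul_add, mul_add, ih]
    have h3 : v a • T a * ∑ i ∈ s, v i • T i + (∑ i ∈ s, v i • T i) * v a • T a = 0 := by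
      rw [Finset.mul_sum, Finset.sum_mul, ← Finset.sum_add_distrib]
      refine Finset.sum_eq_zero fun i _ => ?_
      rw [smul_mul_smul_comm, smul_mul_smul_comm, mul_comm (v i), ← smul_add, h2, smul_zero]
    rw [smul_mul_smul_comm, h1, smul_zero, zero_add, add_zero, h3]

theorem extGr_isGrading : IsGrading (extGr k w) := by
  classical
  let T : Fin (n + 1) → AddMonoidAlgebra (Ext k n) (A × ℤ) := fun i =>
    AddMonoidAlgebra.single (-w i, -1) (e k i)
  let f : (Fin (n + 1) → k) →ₗ[k] AddMonoidAlgebra (Ext k n) (A × ℤ) :=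
    ∑ i, (LinearMap.proj i : (Fin (n + 1) → k) →ₗ[k] k).smulRight (T i)
  have hf : ∀ v, f v = ∑ i, v i • T i := by
    intro v
    simp [f]
  have hf0 : ∀ v, f v * f v = 0 := by
    intro v
    rw [hf]
    refine sq_sum_eq_zero k T ?_ ?_ v _
    · intro i
      simp [T, AddMonoidAlgebra.single_mul_single, e_mul_self]
    · intro i j
      simp only [T, AddMonoidAlgebra.single_mul_single]
      rw [add_comm ((-w j, -1) : A × ℤ), ← AddMonoidAlgebra.single_add, e_mul_add]
      simp
  let c : Ext k n →ₐ[k] AddMonoidAlgebra (Ext k n) (A × ℤ) := ExteriorAlgebra.lift k ⟨f, hf0⟩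
  have hce : ∀ i, c (e k i) = T i := by
    intro i
    simp only [c, e, ExteriorAlgebra.lift_ι_apply, hf]
    rw [Finset.sum_eq_single i]
    · simp
    · intro j _ hj
      simp [hj]
    · simp
  have hcl : ∀ l : List (Fin (n + 1)), c ((l.map (e k)).prod) =
      AddMonoidAlgebra.single ((l.map fun i => ((-w i, -1) : A × ℤ)).sum)
        ((l.map (e k)).prod) := by
    intro l
    induction l with
    | nil =>
      simp [AddMonoidAlgebra.one_def]
    | cons i l ih =>
      simp only [List.map_cons, List.prod_cons, List.sum_cons, map_mul, ih, hce, T,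
        AddMonoidAlgebra.single_mul_single]
  have hc : ∀ p, ∀ y ∈ extGr k w p, c y = AddMonoidAlgebra.single p y := by
    intro p y hy
    induction hy using Submodule.span_induction with
    | mem y hy =>
      obtain ⟨l, rfl, rfl⟩ := hy
      exact hcl l
    | zero => simp
    | add x y _ _ hx hy => rw [map_add, hx, hy, AddMonoidAlgebra.single_add]
    | smul r x _ hx => rw [map_smul, hx, AddMonoidAlgebra.smul_single]
  let pr : A × ℤ → Ext k n →ₗ[k] Ext k n := fun p =>
    { toFun := fun y => (c y).coeff p
      map_add' := by intro x y; simp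
      map_smul' := by intro r x; simp }
  refine ⟨iSupIndep_of_proj _ pr ?_ ?_, ?_⟩
  · intro p y hy
    simp [pr, hc p y hy]
  · intro p q hqp y hy
    simp [pr, hc q y hy, hqp]
  · rw [eq_top_iff]
    rintro y -
    have hmul : ∀ x ∈ ⨆ p, extGr k w p, ∀ y ∈ ⨆ p, extGr k w p, x * y ∈ ⨆ p, extGr k w p := by
      intro x hx y hy
      refine Submodule.iSup_induction _ (motive := fun x => x * y ∈ ⨆ p, extGr k w p) hx ?_
        (by simp) (fun a b ha hb => by rw [add_mul]; exact add_mem ha hb)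
      intro p x hx
      refine Submodule.iSup_induction _ (motive := fun y => x * y ∈ ⨆ p, extGr k w p) hy ?_
        (by simp) (fun a b ha hb => by rw [mul_add]; exact add_mem ha hb)
      intro q y hy
      exact Submodule.mem_iSup_of_mem _ (extGr_mul_mem k w hx hy)
    induction y using ExteriorAlgebra.induction with
    | algebraMap r =>
      rw [Algebra.algebraMap_eq_smul_one]
      refine Submodule.smul_mem _ _ (Submodule.mem_iSup_of_mem 0 (Submodule.subset_span ⟨[], ?_⟩))
      simp
    | ι v =>
      rw [ι_eq_sum]
      exact Submodule.sum_mem _ fun i _ => Submodule.smul_mem _ _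
        (Submodule.mem_iSup_of_mem _ (e_mem_extGr k w i))
    | mul a b ha hb => exact hmul a ha b hb
    | add a b ha hb => exact add_mem ha hb

instance : Module.Finite k (Ext k n) :=
  Module.Finite.of_basis (Module.Basis.ExteriorAlgebra (Pi.basisFun k (Fin (n + 1))))

variable (n) in
/-- The vector space `ω_E = Hom_k(E, k)`. -/
def Omega : Type _ := Module.Dual k (Ext k n)

noncomputable instance : AddCommGroup (Omega k n) :=
  inferInstanceAs (AddCommGroup (Module.Dual k (Ext k n)))
noncomputable instance : Module k (Omega k n) :=
  inferInstanceAs (Module k (Module.Dual k (Ext k n)))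

/-- A functional, seen as an element of `ω_E`. -/
noncomputable def Omega.toDual : Omega k n ≃ₗ[k] Module.Dual k (Ext k n) := LinearEquiv.refl k _

/-- The right `E`-module structure `(f · y)(z) = f (y z)` on `ω_E`. -/
noncomputable instance : Module (Ext k n)ᵐᵒᵖ (Omega k n) where
  smul y f := (Omega.toDual k).symm (Omega.toDual k f ∘ₗ LinearMap.mulLeft k y.unop)
  one_smul f := (Omega.toDual k).injective <| LinearMap.ext fun z => by
    change Omega.toDual k f (1 * z) = _
    rw [one_mul]
  mul_smul x y f := (Omega.toDual k).injective <| LinearMap.ext fun z => by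
    change Omega.toDual k f (y.unop * x.unop * z) = Omega.toDual k f (y.unop * (x.unop * z))
    rw [mul_assoc]
  smul_zero y := rfl
  smul_add y f g := rfl
  add_smul x y f := (Omega.toDual k).injective <| LinearMap.ext fun z => by
    change Omega.toDual k f ((x.unop + y.unop) * z) =
      Omega.toDual k f (x.unop * z) + Omega.toDual k f (y.unop * z)
    rw [add_mul, map_add]
  zero_smul f := (Omega.toDual k).injective <| LinearMap.ext fun z => by
    change Omega.toDual k f (0 * z) = 0
    rw [zero_mul, map_zero]

theorem Omega.toDual_smul (y : (Ext k n)ᵐᵒᵖ) (f : Omega k n) (z : Ext k n) :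
    Omega.toDual k (y • f) z = Omega.toDual k f (y.unop * z) := rfl

instance : IsScalarTower k (Ext k n)ᵐᵒᵖ (Omega k n) where
  smul_assoc r y f := (Omega.toDual k).injective <| LinearMap.ext fun z => by
    rw [Omega.toDual_smul, MulOpposite.unop_smul, smul_mul_assoc, map_smul, map_smul,
      LinearMap.smul_apply, Omega.toDual_smul]

/-- The dual grading: `(ω_E)_p` consists of the functionals supported on `E_{-p}`. -/
def omegaGr (p : A × ℤ) : Submodule k (Omega k n) where
  carrier := {f | ∀ q, q ≠ -p → ∀ y ∈ extGr k w q, Omega.toDual k f y = 0}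
  add_mem' {f g} hf hg q hq y hy := by
    rw [map_add, LinearMap.add_apply, hf q hq y hy, hg q hq y hy, add_zero]
  zero_mem' q hq y hy := by simp
  smul_mem' r f hf q hq y hy := by
    rw [map_smul, LinearMap.smul_apply, hf q hq y hy, smul_zero]

theorem omegaGr_isGrading : IsGrading (omegaGr k w) := by
  classical
  have hE := extGr_isGrading k w
  let pr : A × ℤ → Omega k n →ₗ[k] Omega k n := fun p =>
    (Omega.toDual k).symm.toLinearMap ∘ₗ (LinearMap.lcomp k k (hE.proj (-p))) ∘ₗ
      (Omega.toDual k).toLinearMap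
  have hpr : ∀ p f y, Omega.toDual k (pr p f) y = Omega.toDual k f (hE.proj (-p) y) :=
    fun p f y => rfl
  have hmem : ∀ p f, pr p f ∈ omegaGr k w p := by
    intro p f q hq y hy
    rw [hpr, hE.proj_of_mem_of_ne hq hy, map_zero]
  refine ⟨iSupIndep_of_proj _ pr ?_ ?_, ?_⟩
  · intro p f hf
    refine (Omega.toDual k).injective (hE.linearMap_ext fun q y hy => ?_)
    rw [hpr]
    by_cases hq : q = -p
    · subst hq
      rw [hE.proj_of_mem hy]
    · rw [hE.proj_of_mem_of_ne hq hy, map_zero, hf q hq y hy]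
  · intro p p' hp f hf
    refine (Omega.toDual k).injective (hE.linearMap_ext fun q y hy => ?_)
    rw [hpr, map_zero, LinearMap.zero_apply]
    by_cases hq : q = -p
    · subst hq
      rw [hE.proj_of_mem hy]
      exact hf _ (fun h => hp (neg_injective h).symm) y hy
    · rw [hE.proj_of_mem_of_ne hq hy, map_zero]
  · rw [eq_top_iff]
    rintro f -
    have hfin : {p | extGr k w p ≠ ⊥}.Finite := Submodule.finite_ne_bot_of_iSupIndep hE.indep
    have : f = ∑ p ∈ hfin.toFinset, pr (-p) f := by
      refine (Omega.toDual k).injective (hE.linearMap_ext fun q y hy => ?_)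
      rw [map_sum, LinearMap.sum_apply]
      simp only [hpr, neg_neg]
      by_cases hq : q ∈ hfin.toFinset
      · rw [Finset.sum_eq_single q, hE.proj_of_mem hy]
        · intro p _ hp
          rw [hE.proj_of_mem_of_ne hp.symm hy, map_zero]
        · exact fun h => absurd hq h
      · have hy0 : y = 0 := by
          simp only [Set.Finite.mem_toFinset, Set.mem_ofPred_eq, not_not] at hq
          rw [hq] at hy
          exact hy
        simp [hy0]
    rw [this]
    exact Submodule.sum_mem _ fun p _ => Submodule.mem_iSup_of_mem _ (hmem _ _)

end Exterior

/-! ## Graded `S`-modules and graded (differential) `E`-modules -/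

section Objects

universe v

variable (k : Type*) [Field k] {n : ℕ} {A : Type*} [AddCommGroup A] (w : Fin (n + 1) → A)

/-- The polynomial ring `S = k[x₀, …, xₙ]`. It is graded by `A` through `deg xᵢ = w i`; its
component of degree `a` is `MvPolynomial.weightedHomogeneousSubmodule k w a`. -/
abbrev PolyS (n : ℕ) : Type _ := MvPolynomial (Fin (n + 1)) k

/-- The `A`-grading of `S` given by `deg xᵢ = w i` is positive. -/
def IsPositive : Prop :=
  (∀ s ∈ MvPolynomial.weightedHomogeneousSubmodule k w 0, ∃ c : k, s = MvPolynomial.C c) ∧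
    ∃ θ : A →+ ℤ, ∀ i, 0 < θ (w i)

/-- An `A`-graded `S`-module. -/
structure GrMod where
  carrier : Type v
  [addCommGroup : AddCommGroup carrier]
  [moduleK : Module k carrier]
  [moduleS : Module (PolyS k n) carrier]
  [tower : IsScalarTower k (PolyS k n) carrier]
  gr : A → Submodule k carrier
  isGrading : IsGrading gr
  smul_mem : ∀ {a b : A} {s : PolyS k n} {m : carrier},
    s ∈ MvPolynomial.weightedHomogeneousSubmodule k w a → m ∈ gr b → s • m ∈ gr (a + b)

instance : CoeSort (GrMod.{v} k w) (Type v) := ⟨GrMod.carrier⟩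

attribute [instance] GrMod.addCommGroup GrMod.moduleK GrMod.moduleS GrMod.tower

/-- An `A ⊕ ℤ`-graded right `E`-module. -/
structure EMod where
  carrier : Type v
  [addCommGroup : AddCommGroup carrier]
  [moduleK : Module k carrier]
  [moduleE : Module (Ext k n)ᵐᵒᵖ carrier]
  [tower : IsScalarTower k (Ext k n)ᵐᵒᵖ carrier]
  gr : A × ℤ → Submodule k carrier
  isGrading : IsGrading gr
  smul_mem : ∀ {p q : A × ℤ} {y : Ext k n} {m : carrier},
    m ∈ gr p → y ∈ extGr k w q → MulOpposite.op y • m ∈ gr (p + q)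

instance : CoeSort (EMod.{v} k w) (Type v) := ⟨EMod.carrier⟩

attribute [instance] EMod.addCommGroup EMod.moduleK EMod.moduleE EMod.tower

variable {k w}

namespace EMod

variable (D : EMod.{v} k w)

/-- The operator acting on elements of auxiliary degree `j` by `(-1)^j`. -/
noncomputable def auxSign : D →ₗ[k] D :=
  (Finsupp.lsum k fun p : A × ℤ => (p.2.negOnePow : ℤ) • (LinearMap.id : D →ₗ[k] D)) ∘ₗ
    D.isGrading.components

theorem auxSign_of_mem {p : A × ℤ} {x : D} (hx : x ∈ D.gr p) :
    D.auxSign x = (p.2.negOnePow : ℤ) • x := by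
  rw [auxSign, LinearMap.comp_apply, D.isGrading.components_of_mem hx, Finsupp.lsum_single]
  rfl

/-- Left multiplication by `eᵢ`: on elements of auxiliary degree `j`, `eᵢ x = (-1)^j x eᵢ`. -/
noncomputable def lmul (i : Fin (n + 1)) : D →ₗ[k] D :=
  (Algebra.lsmul k k D (MulOpposite.op (e k i))) ∘ₗ D.auxSign

theorem lmul_apply_of_mem (i : Fin (n + 1)) {p : A × ℤ} {x : D} (hx : x ∈ D.gr p) :
    D.lmul i x = (p.2.negOnePow : ℤ) • (MulOpposite.op (e k i) • x) := by
  simp only [lmul, LinearMap.comp_apply, D.auxSign_of_mem hx, map_zsmul]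
  rfl

theorem rmul_mem (i : Fin (n + 1)) {p : A × ℤ} {x : D} (hx : x ∈ D.gr p) :
    MulOpposite.op (e k i) • x ∈ D.gr (p.1 - w i, p.2 - 1) := by
  have := D.smul_mem hx (e_mem_extGr k w i)
  have hp : p + (-w i, -1) = (p.1 - w i, p.2 - 1) := by
    ext <;> simp [sub_eq_add_neg]
  rwa [hp] at this

theorem lmul_mem (i : Fin (n + 1)) {p : A × ℤ} {x : D} (hx : x ∈ D.gr p) :
    D.lmul i x ∈ D.gr (p.1 - w i, p.2 - 1) := by
  rw [D.lmul_apply_of_mem i hx]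
  exact zsmul_mem (D.rmul_mem i hx) _

theorem lmul_rmul (i j : Fin (n + 1)) (x : D) :
    D.lmul i (MulOpposite.op (e k j) • x) = MulOpposite.op (e k j) • D.lmul i x := by
  refine D.isGrading.induction_on (P := fun x => D.lmul i (MulOpposite.op (e k j) • x) =
    MulOpposite.op (e k j) • D.lmul i x) x ?_ (by simp) ?_
  · intro p x hx
    rw [D.lmul_apply_of_mem i hx, D.lmul_apply_of_mem i (D.rmul_mem j hx), smul_smul,
      smul_comm (MulOpposite.op (e k j)) ((p.2.negOnePow : ℤ)), smul_smul,
      ← MulOpposite.op_mul, ← MulOpposite.op_mul, eq_neg_of_add_eq_zero_left (e_mul_add k j i),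
      Int.negOnePow_sub, Int.negOnePow_one, MulOpposite.op_neg, neg_smul]
    simp
  · intro x y hx hy
    simp only [smul_add, map_add, hx, hy]

theorem lmul_smul (i : Fin (n + 1)) (y : (Ext k n)ᵐᵒᵖ) (x : D) :
    D.lmul i (y • x) = y • D.lmul i x := by
  induction y using MulOpposite.rec' with
  | h y =>
  induction y using ExteriorAlgebra.induction generalizing x with
  | algebraMap r =>
    rw [← MulOpposite.algebraMap_apply, algebraMap_smul, algebraMap_smul, map_smul]
  | ι v =>
    rw [ι_eq_sum, ← MulOpposite.opAddEquiv_apply, map_sum, Finset.sum_smul, Finset.sum_smul, map_sum]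
    refine Finset.sum_congr rfl fun j _ => ?_
    rw [MulOpposite.opAddEquiv_apply, MulOpposite.op_smul, smul_assoc, smul_assoc, map_smul, lmul_rmul]
  | mul a b ha hb => rw [MulOpposite.op_mul, mul_smul, mul_smul, hb, ha]
  | add a b ha hb => rw [MulOpposite.op_add, add_smul, add_smul, map_add, ha, hb]

theorem lmul_lmul_self (i : Fin (n + 1)) (x : D) : D.lmul i (D.lmul i x) = 0 := by
  refine D.isGrading.induction_on (P := fun x => D.lmul i (D.lmul i x) = 0) x ?_ (by simp) ?_
  · intro p x hx
    rw [D.lmul_apply_of_mem i hx, map_zsmul, D.lmul_apply_of_mem i (D.rmul_mem i hx),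
      smul_smul (MulOpposite.op (e k i)), ← MulOpposite.op_mul, e_mul_self]
    simp
  · intro x y hx hy
    simp only [map_add, hx, hy, add_zero]

theorem lmul_lmul_add (i j : Fin (n + 1)) (x : D) :
    D.lmul i (D.lmul j x) + D.lmul j (D.lmul i x) = 0 := by
  refine D.isGrading.induction_on (P := fun x => D.lmul i (D.lmul j x) + D.lmul j (D.lmul i x) = 0)
    x ?_ (by simp) ?_
  · intro p x hx
    rw [D.lmul_apply_of_mem i hx, D.lmul_apply_of_mem j hx, map_zsmul, map_zsmul,
      D.lmul_apply_of_mem i (D.rmul_mem j hx), D.lmul_apply_of_mem j (D.rmul_mem i hx),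
      smul_smul (MulOpposite.op (e k i)), smul_smul (MulOpposite.op (e k j)),
      ← MulOpposite.op_mul, ← MulOpposite.op_mul, ← smul_add, ← smul_add, ← add_smul,
      ← MulOpposite.op_add, e_mul_add]
    simp
  · intro x y hx hy
    simp only [map_add]
    rw [add_add_add_comm, hx, hy, add_zero]

end EMod

variable (k w)

/-- A differential `E`-module: an `A ⊕ ℤ`-graded right `E`-module with a square-zero
endomorphism of degree `(0; -1)`. -/
structure DM extends EMod.{v} k w where
  del : carrier →ₗ[(Ext k n)ᵐᵒᵖ] carrier
  del_mem : ∀ {a : A} {j : ℤ} {x : carrier}, x ∈ gr (a, j) → del x ∈ gr (a, j - 1)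
  del_del : ∀ x, del (del x) = 0

/-- The graded right `E`-module `ω_E`. -/
@[reducible] noncomputable def omegaE : EMod k w where
  carrier := Omega k n
  gr := omegaGr k w
  isGrading := omegaGr_isGrading k w
  smul_mem {p q y f} hf hy := by
    intro r hr z hz
    rw [Omega.toDual_smul]
    refine hf (q + r) (fun h => hr ?_) _ (extGr_mul_mem k w hy hz)
    rw [neg_add, ← h]
    abel

variable {k w}

end Objects

/-! ## Complexes of graded `S`-modules -/

section Complexes

universe v v'

variable {k : Type*} [Field k] {n : ℕ} {A : Type*} [AddCommGroup A] {w : Fin (n + 1) → A}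

/-- A homogeneous submodule of a graded `S`-module, with the induced grading. -/
@[reducible] noncomputable def GrMod.sub (M : GrMod.{v} k w) (P : Submodule (PolyS k n) M)
    (hP : IsHomogeneous M.gr (P.restrictScalars k)) : GrMod.{v} k w where
  carrier := P
  tower := ⟨fun r s x => Subtype.ext (smul_assoc r s x.1)⟩
  gr a := (M.gr a).comap (P.restrictScalars k).subtype
  isGrading := M.isGrading.restrict hP
  smul_mem hs hm := M.smul_mem hs hm

/-- A graded module is free if it has a basis of homogeneous elements, that is, if it is a direct
sum of modules of the form `S(-a)`. -/
def GrMod.IsFree (M : GrMod.{v} k w) : Prop :=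
  ∃ (ι : Type v) (b : Module.Basis ι (PolyS k n) M), ∀ i, ∃ a, b i ∈ M.gr a

/-- `M` is bounded below in `A`-degrees. -/
def GrMod.IsBoundedBelow (M : GrMod.{v} k w) : Prop :=
  ∃ θ : A →+ ℤ, (∀ i, 0 < θ (w i)) ∧ ∃ B : ℤ, ∀ a, θ a < B → M.gr a = ⊥

/-- `M` is generated, as an `S`-module, by its homogeneous elements of degree `d`. -/
def GrMod.IsGeneratedInDegree (M : GrMod.{v} k w) (d : A) : Prop :=
  Submodule.span (PolyS k n) (M.gr d : Set M) = ⊤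

variable (k w) in
/-- A complex of `A`-graded `S`-modules, with differentials of homological degree `-1`. -/
structure GrComplex where
  X : ℤ → GrMod.{v} k w
  d : ∀ i j : ℤ, j + 1 = i → (X i →ₗ[PolyS k n] X j)
  d_mem : ∀ i j h (a : A) (x : X i), x ∈ (X i).gr a → d i j h x ∈ (X j).gr a
  d_d : ∀ i j l h h' (x : X i), d j l h' (d i j h x) = 0

namespace GrComplex

/-- Isomorphism of complexes of graded modules. -/
def IsIso (C : GrComplex.{v} k w) (C' : GrComplex.{v'} k w) : Prop :=
  ∃ f : ∀ j, C.X j ≃ₗ[PolyS k n] C'.X j,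
    (∀ j a (x : C.X j), x ∈ (C.X j).gr a ↔ f j x ∈ (C'.X j).gr a) ∧
    ∀ i j h (x : C.X i), f j (C.d i j h x) = C'.d i j h (f i x)

/-- A complex is strongly linear if its terms have bases of homogeneous elements with respect to
which all the entries of the matrices of the differentials are `k`-linear combinations of the
variables. -/
def IsStronglyLinear (C : GrComplex.{v} k w) : Prop :=
  ∃ (ι : ℤ → Type v) (b : ∀ j, Module.Basis (ι j) (PolyS k n) (C.X j)),
    (∀ j s, ∃ a, b j s ∈ (C.X j).gr a) ∧
    ∀ i j h (s : ι i) (t : ι j), (b j).repr (C.d i j h (b i s)) t ∈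
      Submodule.span k (Set.range (MvPolynomial.X : Fin (n + 1) → PolyS k n))

/-- A complex is minimal if its differentials are zero modulo the ideal `(x₀, …, xₙ)`. -/
def IsMinimal (C : GrComplex.{v} k w) : Prop :=
  ∀ i j h (x : C.X i), C.d i j h x ∈
    Ideal.span (Set.range (MvPolynomial.X : Fin (n + 1) → PolyS k n)) •
      (⊤ : Submodule (PolyS k n) (C.X j))

/-- `ε : F₀ → M` makes `F` a minimal free resolution of `M`: the complex `F` is a minimal complex
of free modules, it is bounded below in homological degrees and its terms are bounded below in
`A`-degrees, and `ε` defines a quasi-isomorphism from `F` to `M`, seen as a complex concentrated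
in homological degree `0`. -/
structure IsMinimalFreeResolution (F : GrComplex.{v} k w) (M : GrMod.{v'} k w)
    (ε : F.X 0 →ₗ[PolyS k n] M) : Prop where
  free : ∀ j, (F.X j).IsFree
  minimal : F.IsMinimal
  bounded : ∃ N : ℤ, ∀ j < N, Subsingleton (F.X j)
  boundedBelow : ∀ j, (F.X j).IsBoundedBelow
  map_mem : ∀ a (x : F.X 0), x ∈ (F.X 0).gr a → ε x ∈ M.gr a
  map_d : ∀ x : F.X 1, ε (F.d 1 0 (by norm_num) x) = 0
  surjective_homology : ∀ m : M, ∃ z : F.X 0, F.d 0 (-1) (by norm_num) z = 0 ∧ ε z = m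
  injective_homology : ∀ z : F.X 0, F.d 0 (-1) (by norm_num) z = 0 → ε z = 0 →
    ∃ y : F.X 1, F.d 1 0 (by norm_num) y = z
  acyclic : ∀ i ≠ 0, ∀ z : F.X i, F.d i (i - 1) (by ring) z = 0 →
    ∃ y : F.X (i + 1), F.d (i + 1) i rfl y = z

/-- A subcomplex of a complex of graded modules. -/
structure Subcomplex (C : GrComplex.{v} k w) where
  P : ∀ j, Submodule (PolyS k n) (C.X j)
  homogeneous : ∀ j, IsHomogeneous (C.X j).gr ((P j).restrictScalars k)
  d_mem : ∀ i j h, ∀ x ∈ P i, C.d i j h x ∈ P j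

namespace Subcomplex

variable {C : GrComplex.{v} k w}

/-- A subcomplex, seen as a complex. -/
@[reducible] noncomputable def toComplex (L : C.Subcomplex) : GrComplex.{v} k w where
  X j := (C.X j).sub (L.P j) (L.homogeneous j)
  d i j h := (C.d i j h).restrict (L.d_mem i j h)
  d_mem i j h a x hx := C.d_mem i j h a x.1 hx
  d_d i j l h h' x := Subtype.ext (C.d_d i j l h h' x.1)

/-- A subcomplex is quasi-split if its terms are direct summands of the terms of the ambient
complex as graded modules. -/
def IsQuasiSplit (L : C.Subcomplex) : Prop :=
  ∀ j, ∃ Q : Submodule (PolyS k n) (C.X j),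
    IsHomogeneous (C.X j).gr (Q.restrictScalars k) ∧ IsCompl (L.P j) Q

/-- `L` is maximal, with respect to inclusion, among the strongly linear quasi-split
subcomplexes. -/
def IsMaximalStronglyLinear (L : C.Subcomplex) : Prop :=
  L.toComplex.IsStronglyLinear ∧ L.IsQuasiSplit ∧
    ∀ L' : C.Subcomplex, L'.toComplex.IsStronglyLinear → L'.IsQuasiSplit →
      (∀ j, L.P j ≤ L'.P j) → ∀ j, L'.P j = L.P j

end Subcomplex

end GrComplex

end Complexes

/-! ## The BGG functors and the module `K_a(M)` -/

section BGG

universe v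

variable {k : Type*} [Field k] {n : ℕ} {A : Type*} [AddCommGroup A] {w : Fin (n + 1) → A}

theorem sum_antisymm {ι V : Type*} [Fintype ι] [AddCommGroup V] (B : ι → ι → V)
    (h1 : ∀ i, B i i = 0) (h2 : ∀ i j, B i j + B j i = 0) : ∑ i, ∑ j, B i j = 0 := by
  classical
  rw [← Fintype.sum_prod_type']
  refine Finset.sum_involution (fun p _ => (p.2, p.1)) (fun p _ => h2 _ _) ?_ (by simp) (by simp)
  rintro ⟨i, j⟩ _ hp h
  simp only [Prod.mk.injEq] at h
  obtain ⟨rfl, -⟩ := h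
  exact hp (h1 _)

/-- Left multiplication by `eᵢ`, as a map of right `E`-modules. -/
noncomputable def EMod.lmulE (D : EMod.{v} k w) (i : Fin (n + 1)) : D →ₗ[(Ext k n)ᵐᵒᵖ] D where
  toFun := D.lmul i
  map_add' := map_add _
  map_smul' := D.lmul_smul i

/-- Multiplication by `xᵢ` on a graded module. -/
noncomputable def GrMod.xmul (M : GrMod.{v} k w) (i : Fin (n + 1)) : M →ₗ[k] M :=
  Algebra.lsmul k k M (MvPolynomial.X i : PolyS k n)

theorem GrMod.xmul_apply (M : GrMod.{v} k w) (i : Fin (n + 1)) (m : M) :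
    M.xmul i m = (MvPolynomial.X i : PolyS k n) • m := rfl

/-- The differential `f ⊗ m ↦ ∑ᵢ eᵢ f ⊗ xᵢ m` of `R(M)`. -/
noncomputable def RRdel (M : GrMod.{v} k w) :
    omegaE k w ⊗[k] M →ₗ[(Ext k n)ᵐᵒᵖ] omegaE k w ⊗[k] M :=
  ∑ i, TensorProduct.AlgebraTensorModule.map ((omegaE k w).lmulE i) (M.xmul i)

theorem RRdel_tmul (M : GrMod.{v} k w) (f : omegaE k w) (m : M) :
    RRdel M (f ⊗ₜ m) = ∑ i, (omegaE k w).lmul i f ⊗ₜ[k] ((MvPolynomial.X i : PolyS k n) • m) := by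
  simp only [RRdel, LinearMap.sum_apply, TensorProduct.AlgebraTensorModule.map_tmul]
  rfl

theorem X_mem (i : Fin (n + 1)) :
    (MvPolynomial.X i : PolyS k n) ∈ MvPolynomial.weightedHomogeneousSubmodule k w (w i) :=
  MvPolynomial.isWeightedHomogeneous_X k w i

/-- The differential `E`-module `R(M) = ⨁ₐ Mₐ ⊗ ω_E(-a; 0)` of a graded `S`-module `M`, with
differential `m ⊗ f ↦ ∑ᵢ xᵢ m ⊗ eᵢ f`. The factors are written in the opposite order, and the
direct sum over `a` is written as `ω_E ⊗ M` with the corresponding grading. -/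
@[reducible] noncomputable def RR (M : GrMod.{v} k w) : DM k w where
  carrier := omegaE k w ⊗[k] M
  gr := tensorGr (omegaE k w).gr M.gr fun p a => (p.1 + a, p.2)
  isGrading := (omegaE k w).isGrading.tensor M.isGrading _
  smul_mem {p q y m} hm hy := by
    induction hm using Submodule.span_induction with
    | zero => simp
    | add a b _ _ ha hb => rw [smul_add]; exact add_mem ha hb
    | smul r a _ ha => rw [smul_comm]; exact Submodule.smul_mem _ _ ha
    | mem t ht =>
      obtain ⟨r, a, f, hf, m, hm, rfl, rfl⟩ := ht
      rw [TensorProduct.smul_tmul']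
      have := tmul_mem_tensorGr (fun (p : A × ℤ) (a : A) => (p.1 + a, p.2))
        ((omegaE k w).smul_mem hf hy) hm
      have hpq : ((r + q).1 + a, (r + q).2) = (r.1 + a, r.2) + q := by
        rw [Prod.ext_iff]
        simp [add_right_comm]
      rwa [hpq] at this
  del := RRdel M
  del_mem {a j x} hx := by
    induction hx using Submodule.span_induction with
    | zero => simp
    | add a b _ _ ha hb => rw [map_add]; exact add_mem ha hb
    | smul r a _ ha => rw [LinearMap.map_smul_of_tower]; exact Submodule.smul_mem _ _ ha
    | mem t ht =>
      obtain ⟨r, b, f, hf, m, hm, hr, rfl⟩ := ht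
      rw [RRdel_tmul]
      refine Submodule.sum_mem _ fun i _ => ?_
      have := tmul_mem_tensorGr (fun (p : A × ℤ) (a : A) => (p.1 + a, p.2))
        ((omegaE k w).lmul_mem i hf) (M.smul_mem (X_mem i) hm)
      simp only [Prod.mk.injEq] at hr
      have hpq : (r.1 - w i + (w i + b), r.2 - 1) = (a, j - 1) := by
        rw [← hr.1, ← hr.2, ← add_assoc, sub_add_cancel]
      simp only [hpq] at this
      exact this
  del_del x := by
    induction x using TensorProduct.induction_on with
    | zero => simp
    | add x y hx hy => rw [map_add, map_add, hx, hy, add_zero]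
    | tmul f m =>
      rw [RRdel_tmul, map_sum, Finset.sum_congr rfl fun i _ => RRdel_tmul M _ _]
      refine sum_antisymm (fun i j => (omegaE k w).lmul j ((omegaE k w).lmul i f) ⊗ₜ[k]
        ((MvPolynomial.X j : PolyS k n) • (MvPolynomial.X i : PolyS k n) • m)) ?_ ?_
      · intro i
        rw [EMod.lmul_lmul_self, TensorProduct.zero_tmul]
      · intro i j
        rw [smul_comm (MvPolynomial.X j : PolyS k n), ← TensorProduct.add_tmul,
          EMod.lmul_lmul_add, TensorProduct.zero_tmul]

/-- The summand `Mₐ ⊗ ω_E(-a; 0)` of `R(M)`. -/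
noncomputable def RRsummand (M : GrMod.{v} k w) (a : A) :
    Submodule (Ext k n)ᵐᵒᵖ (RR M).carrier :=
  LinearMap.range (TensorProduct.AlgebraTensorModule.map
    (LinearMap.id : omegaE k w →ₗ[(Ext k n)ᵐᵒᵖ] omegaE k w) (M.gr a).subtype)

theorem DM.del_proj (D : DM.{v} k w) (a : A) (j : ℤ) (x : D.carrier) :
    D.del (D.isGrading.proj (a, j) x) = D.isGrading.proj (a, j - 1) (D.del x) := by
  refine D.isGrading.induction_on (P := fun x => D.del (D.isGrading.proj (a, j) x) =
    D.isGrading.proj (a, j - 1) (D.del x)) x ?_ (by simp) ?_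
  · rintro ⟨b, l⟩ x hx
    by_cases h : (b, l) = (a, j)
    · obtain ⟨rfl, rfl⟩ := Prod.mk.injEq .. ▸ h
      rw [D.isGrading.proj_of_mem hx, D.isGrading.proj_of_mem (D.del_mem hx)]
    · rw [D.isGrading.proj_of_mem_of_ne h hx, map_zero,
        D.isGrading.proj_of_mem_of_ne _ (D.del_mem hx)]
      intro h'
      apply h
      simp only [Prod.mk.injEq, sub_left_inj] at h' ⊢
      exact h'
  · intro x y hx hy
    simp only [map_add, hx, hy]

/-- A homogeneous differential `E`-submodule of a differential `E`-module. -/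
@[reducible] def DM.sub (D : DM.{v} k w) (N : Submodule (Ext k n)ᵐᵒᵖ D.carrier)
    (hN : IsHomogeneous D.gr (N.restrictScalars k)) (hdel : ∀ x ∈ N, D.del x ∈ N) :
    DM.{v} k w where
  carrier := N
  tower := ⟨fun r s x => Subtype.ext (smul_assoc r s x.1)⟩
  gr p := (D.gr p).comap (N.restrictScalars k).subtype
  isGrading := D.isGrading.restrict hN
  smul_mem hm hy := D.smul_mem hm hy
  del := D.del.restrict hdel
  del_mem hx := D.del_mem hx
  del_del x := Subtype.ext (D.del_del x.1)

/-- The kernel of the differential of `R(M)` on the summand `Mₐ ⊗ ω_E(-a; 0)`. -/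
noncomputable def Ksub (M : GrMod.{v} k w) (a : A) : Submodule (Ext k n)ᵐᵒᵖ (RR M).carrier :=
  RRsummand M a ⊓ LinearMap.ker (RR M).del

theorem RRsummand_homogeneous (M : GrMod.{v} k w) (a : A) :
    IsHomogeneous (RR M).gr ((RRsummand M a).restrictScalars k) := by
  rintro x ⟨y, rfl⟩
  induction y using TensorProduct.induction_on with
  | zero => rw [map_zero]; exact zero_mem _
  | add x y hx hy => rw [map_add]; exact add_mem hx hy
  | tmul f m =>
    refine (omegaE k w).isGrading.induction_on (P := fun f =>
      TensorProduct.AlgebraTensorModule.map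
        (LinearMap.id : omegaE k w →ₗ[(Ext k n)ᵐᵒᵖ] omegaE k w) (M.gr a).subtype (f ⊗ₜ[k] m) ∈
        ⨆ i, (RRsummand M a).restrictScalars k ⊓ (RR M).gr i) f ?_ ?_ ?_
    · intro p f hf
      refine Submodule.mem_iSup_of_mem (p.1 + a, p.2) ⟨⟨f ⊗ₜ m, rfl⟩, ?_⟩
      exact tmul_mem_tensorGr (fun (p : A × ℤ) (a : A) => (p.1 + a, p.2)) hf m.2
    · rw [TensorProduct.zero_tmul, map_zero]; exact zero_mem _
    · intro x y hx hy
      rw [TensorProduct.add_tmul, map_add]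
      exact add_mem hx hy

theorem Ksub_homogeneous (M : GrMod.{v} k w) (a : A) :
    IsHomogeneous (RR M).gr ((Ksub M a).restrictScalars k) := by
  intro x hx
  refine (RR M).isGrading.mem_iSup_of_proj_mem fun p => ⟨?_, ?_⟩
  · exact (RRsummand_homogeneous M a).proj_mem (RR M).isGrading p hx.1
  · obtain ⟨b, j⟩ := p
    have h : (RR M).del x = 0 := hx.2
    change (RR M).del _ = 0
    rw [DM.del_proj, h, map_zero]

/-- The differential `E`-module `K_a(M) = ker (Mₐ ⊗ ω_E(-a; 0) → R(M))`; its differential, induced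
by that of `R(M)`, is zero. -/
@[reducible] noncomputable def KK (M : GrMod.{v} k w) (a : A) : DM k w :=
  (RR M).sub (Ksub M a) (Ksub_homogeneous M a) fun x hx => by
    rw [show (RR M).del x = 0 from hx.2]
    exact zero_mem _

theorem KK_del (M : GrMod.{v} k w) (a : A) : (KK M a).del = 0 :=
  LinearMap.ext fun x => Subtype.ext x.2.2

variable (k w) in
theorem poly_isGrading : IsGrading (MvPolynomial.weightedHomogeneousSubmodule k w) := by
  classical
  let _ := MvPolynomial.weightedGradedAlgebra k w
  have := DirectSum.Decomposition.isInternal (MvPolynomial.weightedHomogeneousSubmodule k w)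
  exact ⟨this.submodule_iSupIndep, this.submodule_iSup_eq_top⟩

namespace DM

variable (D : DM.{v} k w)

/-- The part `⨁ₐ D_{(a; j)}` of auxiliary degree `j`. -/
def aux (j : ℤ) : Submodule k D.carrier := ⨆ a, D.gr (a, j)

/-- The subspace `D_{(a; j)}` of `D.aux j`. -/
def auxGr (j : ℤ) (a : A) : Submodule k (D.aux j) := (D.gr (a, j)).comap (D.aux j).subtype

theorem auxGr_isGrading (j : ℤ) : IsGrading (D.auxGr j) :=
  isGrading_comap (D.isGrading.indep.comp fun _ _ h => (Prod.mk.injEq .. ▸ h).1) rfl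

theorem lmul_mem_aux (i : Fin (n + 1)) {j l : ℤ} (h : l + 1 = j) :
    ∀ x ∈ D.aux j, D.lmul i x ∈ D.aux l := by
  intro x hx
  refine Submodule.iSup_induction _ (motive := fun x => D.lmul i x ∈ D.aux l) hx ?_ (by simp)
    (fun x y hx hy => by rw [map_add]; exact add_mem hx hy)
  intro a x hx
  have := D.lmul_mem i hx
  rw [show j - 1 = l by omega] at this
  exact Submodule.mem_iSup_of_mem _ this

theorem del_mem_aux {j l : ℤ} (h : l + 1 = j) : ∀ x ∈ D.aux j, D.del x ∈ D.aux l := by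
  intro x hx
  refine Submodule.iSup_induction _ (motive := fun x => D.del x ∈ D.aux l) hx ?_ (by simp)
    (fun x y hx hy => by rw [map_add]; exact add_mem hx hy)
  intro a x hx
  have := D.del_mem hx
  rw [show j - 1 = l by omega] at this
  exact Submodule.mem_iSup_of_mem _ this

/-- Left multiplication by `eᵢ` from auxiliary degree `j` to auxiliary degree `j - 1`. -/
noncomputable def lmulAux (i : Fin (n + 1)) {j l : ℤ} (h : l + 1 = j) : D.aux j →ₗ[k] D.aux l :=
  (D.lmul i).restrict (D.lmul_mem_aux i h)

/-- The differential from auxiliary degree `j` to auxiliary degree `j - 1`. -/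
noncomputable def delAux {j l : ℤ} (h : l + 1 = j) : D.aux j →ₗ[k] D.aux l :=
  (D.del.restrictScalars k).restrict (D.del_mem_aux h)

theorem lmul_del (i : Fin (n + 1)) (x : D.carrier) :
    D.lmul i (D.del x) + D.del (D.lmul i x) = 0 := by
  refine D.isGrading.induction_on (P := fun x => D.lmul i (D.del x) + D.del (D.lmul i x) = 0)
    x ?_ (by simp) ?_
  · rintro ⟨a, j⟩ x hx
    rw [D.lmul_apply_of_mem i hx, D.lmul_apply_of_mem i (D.del_mem hx), map_zsmul, map_smul,
      Int.negOnePow_sub, Int.negOnePow_one]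
    simp
  · intro x y hx hy
    simp only [map_add]
    rw [add_add_add_comm, hx, hy, add_zero]

/-- The differential `s ⊗ x ↦ ∑ᵢ xᵢ s ⊗ eᵢ x - s ⊗ ∂x` of `L(D)`. -/
noncomputable def LLd {j l : ℤ} (h : l + 1 = j) :
    PolyS k n ⊗[k] D.aux j →ₗ[PolyS k n] PolyS k n ⊗[k] D.aux l :=
  (∑ i, TensorProduct.AlgebraTensorModule.map
    (LinearMap.mulLeft (PolyS k n) (MvPolynomial.X i)) (D.lmulAux i h)) -
  TensorProduct.AlgebraTensorModule.map LinearMap.id (D.delAux h)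

theorem LLd_tmul {j l : ℤ} (h : l + 1 = j) (s : PolyS k n) (x : D.aux j) :
    D.LLd h (s ⊗ₜ x) = ∑ i, (MvPolynomial.X i * s) ⊗ₜ[k] D.lmulAux i h x -
      s ⊗ₜ[k] D.delAux h x := by
  simp [LLd]

theorem LLd_LLd {j l m : ℤ} (h : l + 1 = j) (h' : m + 1 = l) (x : PolyS k n ⊗[k] D.aux j) :
    D.LLd h' (D.LLd h x) = 0 := by
  induction x using TensorProduct.induction_on with
  | zero => simp
  | add x y hx hy => rw [map_add, map_add, hx, hy, add_zero]
  | tmul s x =>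
    have h0 : D.delAux h' (D.delAux h x) = 0 := Subtype.ext (D.del_del _)
    have h1 : ∀ i, D.delAux h' (D.lmulAux i h x) = -D.lmulAux i h' (D.delAux h x) := fun i =>
      Subtype.ext (eq_neg_of_add_eq_zero_right (D.lmul_del i x))
    rw [LLd_tmul, map_sub, map_sum]
    simp only [LLd_tmul, h0, h1, Finset.sum_add_distrib, TensorProduct.tmul_zero, sub_zero,
      TensorProduct.tmul_neg, sub_neg_eq_add, add_sub_cancel_right]
    refine sum_antisymm (fun i i' => (MvPolynomial.X i' * (MvPolynomial.X i * s)) ⊗ₜ[k]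
      D.lmulAux i' h' (D.lmulAux i h x)) ?_ ?_
    · intro i
      rw [show D.lmulAux i h' (D.lmulAux i h x) = 0 from Subtype.ext (D.lmul_lmul_self i x),
        TensorProduct.tmul_zero]
    · intro i i'
      rw [mul_left_comm, ← TensorProduct.tmul_add,
        show D.lmulAux i' h' (D.lmulAux i h x) + D.lmulAux i h' (D.lmulAux i' h x) = 0 from
          Subtype.ext (D.lmul_lmul_add i' i x), TensorProduct.tmul_zero]

/-- The grading of `⨁ₐ S(-a) ⊗ D_{(a; j)}`, written as `S ⊗ (⨁ₐ D_{(a; j)})`: the element `s ⊗ x`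
has degree `deg s + a` for `x` in `D_{(a; j)}`. -/
noncomputable def LLgr (j : ℤ) : A → Submodule k (PolyS k n ⊗[k] D.aux j) :=
  tensorGr (MvPolynomial.weightedHomogeneousSubmodule k w) (D.auxGr j) fun b a => b + a

theorem LLgr_smul_mem {j : ℤ} {a b : A} {s : PolyS k n} {m : PolyS k n ⊗[k] D.aux j}
    (hs : s ∈ MvPolynomial.weightedHomogeneousSubmodule k w a) (hm : m ∈ D.LLgr j b) :
    s • m ∈ D.LLgr j (a + b) := by
  induction hm using Submodule.span_induction with
  | zero => rw [smul_zero]; exact zero_mem _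
  | add a b _ _ ha hb => rw [smul_add]; exact add_mem ha hb
  | smul r a _ ha => rw [smul_comm]; exact Submodule.smul_mem _ _ ha
  | mem t ht =>
    obtain ⟨c, c', s', hs', x, hx, rfl, rfl⟩ := ht
    have hss : s * s' ∈ MvPolynomial.weightedHomogeneousSubmodule k w (a + c) :=
      MvPolynomial.IsWeightedHomogeneous.mul hs hs'
    have := tmul_mem_tensorGr (fun b a : A => b + a) hss hx
    rw [TensorProduct.smul_tmul', ← add_assoc]
    exact this

theorem LLd_mem {i j : ℤ} (h : j + 1 = i) {a : A} {x : PolyS k n ⊗[k] D.aux i}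
    (hx : x ∈ D.LLgr i a) : D.LLd h x ∈ D.LLgr j a := by
  induction hx using Submodule.span_induction with
  | zero => rw [map_zero]; exact zero_mem _
  | add a b _ _ ha hb => rw [map_add]; exact add_mem ha hb
  | smul r a _ ha => rw [LinearMap.map_smul_of_tower]; exact Submodule.smul_mem _ _ ha
  | mem t ht =>
    obtain ⟨c, c', s, hs, x, hx, rfl, rfl⟩ := ht
    rw [LLd_tmul]
    have hij : i - 1 = j := by omega
    refine sub_mem (Submodule.sum_mem _ fun l _ => ?_) ?_
    · have hx' : D.lmulAux l h x ∈ D.auxGr j (c' - w l) := by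
        have := D.lmul_mem l hx
        rw [hij] at this
        exact this
      have hss : MvPolynomial.X l * s ∈ MvPolynomial.weightedHomogeneousSubmodule k w (w l + c) :=
        MvPolynomial.IsWeightedHomogeneous.mul (X_mem l) hs
      have := tmul_mem_tensorGr (fun b a : A => b + a) hss hx'
      rwa [show w l + c + (c' - w l) = c + c' by abel] at this
    · have hx' : D.delAux h x ∈ D.auxGr j c' := by
        have := D.del_mem hx
        rw [hij] at this
        exact this
      exact tmul_mem_tensorGr (fun b a : A => b + a) hs hx'

/-- The complex `L(D)` of graded `S`-modules, with terms `L(D)_j = ⨁ₐ S(-a) ⊗ D_{(a; j)}` and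
differential `s ⊗ x ↦ ∑ᵢ xᵢ s ⊗ eᵢ x - s ⊗ ∂x`. -/
@[reducible] noncomputable def LL : GrComplex k w where
  X j :=
    { carrier := PolyS k n ⊗[k] D.aux j
      gr := D.LLgr j
      isGrading := (poly_isGrading k w).tensor (D.auxGr_isGrading j) _
      smul_mem := D.LLgr_smul_mem }
  d _ _ h := D.LLd h
  d_mem _ _ h _ _ hx := D.LLd_mem h hx
  d_d _ _ _ h h' x := D.LLd_LLd h h' x

end DM

end BGG

end MultigradedBGG

open MultigradedBGG

/-!
A graded left `E`-module `V` gives a complex `S ⊗ V` with differential `s ⊗ v ↦ ∑ₚ xₚ s ⊗ eₚ v`, and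
every strongly linear complex `L` has this form: the matrices of the differentials of `L` define
the operators `eₚ`, and `∂² = 0` says that they square to zero and anticommute.

Let `L = S ⊗ V` be a quasi-split subcomplex of `F`. Sending `v` to the form `z ↦ ε (z v)` on `E`
maps `V` into `K_d(M)`, because `ε ∘ ∂ = 0`. By minimality and exactness of `F`, an element of
positive degree killed by all `eₚ` would be a cycle of `F` outside `(x₀, …, xₙ) F`, so the map is
injective. In the other direction, the inclusion of `K_d(M)_0` in `M` lifts degree by degree to a
map `L(K_d(M)) → F`, which may be prescribed on `L`. As `E` carries each nonzero element of
`K_d(M)` to a nonzero element in degree `0`, the map is injective modulo `(x₀, …, xₙ)`, and by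
Nakayama's lemma it is a split injection.
-/

namespace MultigradedBGG

section GradedMaps

variable {k : Type*} [Field k] {ι κ V W Z : Type*} [AddCommGroup V] [Module k V]
  [AddCommGroup W] [Module k W] [AddCommGroup Z] [Module k Z]
  {grV : ι → Submodule k V} {grW : ι → Submodule k W} {grZ : ι → Submodule k Z}

/-- A map of graded vector spaces of degree zero. Linearity is not part of the notion, so that it
applies to `k`-linear and to `S`-linear maps alike. -/
def IsGradedMap (grV : ι → Submodule k V) (grW : ι → Submodule k W) (f : V → W) : Prop :=
  ∀ i, ∀ x ∈ grV i, f x ∈ grW i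

theorem IsGradedMap.comp {g : W → Z} {f : V → W} (hg : IsGradedMap grW grZ g)
    (hf : IsGradedMap grV grW f) : IsGradedMap grV grZ fun x => g (f x) :=
  fun i x hx => hg i _ (hf i x hx)

namespace IsGrading

theorem map_proj {grW : κ → Submodule k W} (hV : IsGrading grV) (hW : IsGrading grW)
    {f : V →ₗ[k] W} {σ : ι → κ} (hσ : Function.Injective σ)
    (hf : IsGradedMap grV (fun i => grW (σ i)) f) (i : ι) (x : V) :
    f (hV.proj i x) = hW.proj (σ i) (f x) := by
  refine hV.induction_on (P := fun x => f (hV.proj i x) = hW.proj (σ i) (f x)) x ?_ (by simp)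
    (fun x y hx hy => by simp only [map_add, hx, hy])
  intro j x hx
  by_cases hj : j = i
  · subst hj
    rw [hV.proj_of_mem hx, hW.proj_of_mem (hf j x hx)]
  · rw [hV.proj_of_mem_of_ne hj hx, map_zero,
      hW.proj_of_mem_of_ne (fun h => hj (hσ h)) (hf j x hx)]

theorem mem_span_range_proj (hV : IsGrading grV) (x : V) :
    x ∈ Submodule.span k (Set.range fun i => hV.proj i x) :=
  (iSup_le fun _ => inf_le_left :
    ⨆ i, Submodule.span k (Set.range fun i => hV.proj i x) ⊓ grV i ≤ _)
    (hV.mem_iSup_of_proj_mem fun i => Submodule.subset_span ⟨i, rfl⟩)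

theorem mem_of_proj_eq_zero (hV : IsGrading grV) {i : ι} {x : V}
    (hx : ∀ j, j ≠ i → hV.proj j x = 0) : x ∈ grV i := by
  refine Submodule.span_le.mpr ?_ (hV.mem_span_range_proj x)
  rintro _ ⟨j, rfl⟩
  by_cases hj : j = i
  · subst hj
    exact hV.proj_mem j x
  · simp [hx j hj]

theorem mem_iff_map_mem (hV : IsGrading grV) (hW : IsGrading grW) {f : V →ₗ[k] W}
    (hinj : Function.Injective f) (hf : IsGradedMap grV grW f) (i : ι) (x : V) :
    x ∈ grV i ↔ f x ∈ grW i := by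
  refine ⟨hf i x, fun hx => hV.mem_of_proj_eq_zero fun j hj => hinj ?_⟩
  rw [hV.map_proj hW Function.injective_id hf, map_zero]
  exact hW.proj_of_mem_of_ne (Ne.symm hj) hx

/-- The part of degree zero of a linear map between graded vector spaces. -/
noncomputable def homogenize (hV : IsGrading grV) (hW : IsGrading grW) (f : V →ₗ[k] W) :
    V →ₗ[k] W :=
  Finsupp.lsum k (fun i => hW.proj i ∘ₗ f) ∘ₗ hV.components

theorem homogenize_of_mem (hV : IsGrading grV) (hW : IsGrading grW) (f : V →ₗ[k] W) {i : ι}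
    {x : V} (hx : x ∈ grV i) : hV.homogenize hW f x = hW.proj i (f x) := by
  rw [homogenize, LinearMap.comp_apply, hV.components_of_mem hx, Finsupp.lsum_single]
  rfl

theorem isGradedMap_homogenize (hV : IsGrading grV) (hW : IsGrading grW) (f : V →ₗ[k] W) :
    IsGradedMap grV grW (hV.homogenize hW f) := by
  intro i x hx
  rw [hV.homogenize_of_mem hW f hx]
  exact hW.proj_mem i _

theorem homogenize_eq_self (hV : IsGrading grV) (hW : IsGrading grW) {f : V →ₗ[k] W}
    (hf : IsGradedMap grV grW f) : hV.homogenize hW f = f :=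
  hV.linearMap_ext fun i x hx => by
    rw [hV.homogenize_of_mem hW f hx, hW.proj_of_mem (hf i x hx)]

theorem comp_homogenize (hV : IsGrading grV) (hW : IsGrading grW) (hZ : IsGrading grZ)
    {g : W →ₗ[k] Z} (hg : IsGradedMap grW grZ g) (f : V →ₗ[k] W) :
    g ∘ₗ hV.homogenize hW f = hV.homogenize hZ (g ∘ₗ f) :=
  hV.linearMap_ext fun i x hx => by
    rw [hV.homogenize_of_mem hZ _ hx, LinearMap.comp_apply, hV.homogenize_of_mem hW f hx,
      hW.map_proj hZ Function.injective_id hg]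
    rfl

theorem homogenize_comp (hV : IsGrading grV) (hW : IsGrading grW) (hZ : IsGrading grZ)
    {f : V →ₗ[k] W} (hf : IsGradedMap grV grW f) (g : W →ₗ[k] Z) :
    hW.homogenize hZ g ∘ₗ f = hV.homogenize hZ (g ∘ₗ f) :=
  hV.linearMap_ext fun i x hx => by
    rw [hV.homogenize_of_mem hZ _ hx, LinearMap.comp_apply, hW.homogenize_of_mem hZ g (hf i x hx),
      LinearMap.comp_apply]

theorem exists_graded_lift (hV : IsGrading grV) (hW : IsGrading grW) (hZ : IsGrading grZ)
    {g : W →ₗ[k] Z} (hg : IsGradedMap grW grZ g) {f : V →ₗ[k] Z} (hf : IsGradedMap grV grZ f)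
    (hfg : ∀ v, f v ∈ LinearMap.range g) :
    ∃ f' : V →ₗ[k] W, IsGradedMap grV grW f' ∧ ∀ v, g (f' v) = f v := by
  obtain ⟨h, hh⟩ := Module.projective_lifting_property g.rangeRestrict
    (f.codRestrict (LinearMap.range g) hfg) g.surjective_rangeRestrict
  have hgh : g ∘ₗ h = f := LinearMap.ext fun v => congrArg Subtype.val (LinearMap.congr_fun hh v)
  refine ⟨hV.homogenize hW h, hV.isGradedMap_homogenize hW h, fun v => ?_⟩
  rw [← LinearMap.comp_apply, hV.comp_homogenize hW hZ hg, hgh, hV.homogenize_eq_self hZ hf]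

theorem exists_graded_retraction (hV : IsGrading grV) (hW : IsGrading grW) {f : V →ₗ[k] W}
    (hf : IsGradedMap grV grW f) (hinj : Function.Injective f) :
    ∃ r : W →ₗ[k] V, IsGradedMap grW grV r ∧ ∀ v, r (f v) = v := by
  obtain ⟨r, hr⟩ := f.exists_leftInverse_of_injective (LinearMap.ker_eq_bot.mpr hinj)
  refine ⟨hW.homogenize hV r, hW.isGradedMap_homogenize hV r, fun v => ?_⟩
  rw [← LinearMap.comp_apply, hV.homogenize_comp hW hV hf, hr,
    hV.homogenize_eq_self hV fun i x hx => hx, LinearMap.id_apply]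

theorem exists_homogeneous_basis (hV : IsGrading grV) :
    ∃ (s : Set V) (b : Module.Basis s k V), ∀ i, ∃ a, b i ∈ grV a := by
  classical
  have hi : DirectSum.IsInternal grV :=
    DirectSum.isInternal_submodule_of_iSupIndep_of_iSup_eq_top hV.indep hV.iSup_eq_top
  let b := hi.collectedBasis fun i => Module.Basis.ofVectorSpace k (grV i)
  refine ⟨Set.range b, b.reindexRange, ?_⟩
  rintro ⟨_, i, rfl⟩
  exact ⟨i.1, by rw [Module.Basis.reindexRange_apply]; exact hi.collectedBasis_mem _ i⟩

theorem isHomogeneous_range (hV : IsGrading grV) (hW : IsGrading grW) {f : V →ₗ[k] W}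
    (hf : IsGradedMap grV grW f) : IsHomogeneous grW (LinearMap.range f) := by
  rintro _ ⟨x, rfl⟩
  exact hW.mem_iSup_of_proj_mem fun i =>
    ⟨hV.proj i x, hV.map_proj hW Function.injective_id hf i x⟩

theorem isHomogeneous_ker (hV : IsGrading grV) (hW : IsGrading grW) {f : V →ₗ[k] W}
    (hf : IsGradedMap grV grW f) : IsHomogeneous grV (LinearMap.ker f) := by
  refine fun x hx => hV.mem_iSup_of_proj_mem fun i => ?_
  rw [LinearMap.mem_ker, hV.map_proj hW Function.injective_id hf, LinearMap.mem_ker.mp hx,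
    map_zero]

end IsGrading

end GradedMaps

section IrrelevantIdeal

variable {k : Type*} [Field k] {n : ℕ}

variable (k n) in
/-- The ideal `(x₀, …, xₙ)` of `S`. -/
noncomputable abbrev varsIdeal : Ideal (PolyS k n) :=
  Ideal.span (Set.range (MvPolynomial.X : Fin (n + 1) → PolyS k n))

theorem sub_C_coeff_zero_mem_varsIdeal (s : PolyS k n) :
    s - MvPolynomial.C (s.coeff 0) ∈ varsIdeal k n := by
  rw [varsIdeal, ← Set.image_univ, MvPolynomial.mem_ideal_span_X_image]
  intro m hm
  by_contra! hm'
  obtain rfl : m = 0 := Finsupp.ext fun i => hm' i trivial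
  simp [MvPolynomial.mem_support_iff] at hm

variable {X Y : Type*} [AddCommGroup X] [Module (PolyS k n) X] [AddCommGroup Y]
  [Module (PolyS k n) Y]

variable (k n X) in
/-- The submodule `(x₀, …, xₙ) X` of an `S`-module `X`. The argument compares graded
modules modulo the variables, that is, through their quotients by these submodules. -/
noncomputable abbrev varsSMulTop : Submodule (PolyS k n) X := varsIdeal k n • ⊤

theorem mem_varsSMulTop {x : X} :
    x ∈ varsSMulTop k n X ↔
      ∃ y : Fin (n + 1) → X, x = ∑ i, (MvPolynomial.X i : PolyS k n) • y i := by
  classical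
  constructor
  · intro hx
    refine Submodule.smul_induction_on hx ?_ ?_
    · intro r hr m _
      obtain ⟨c, rfl⟩ := Ideal.mem_span_range_iff_exists_fun.mp hr
      refine ⟨fun i => c i • m, ?_⟩
      rw [Finset.sum_smul]
      exact Finset.sum_congr rfl fun i _ => by rw [mul_comm, mul_smul]
    · rintro _ _ ⟨y, rfl⟩ ⟨y', rfl⟩
      exact ⟨y + y', by simp [smul_add, Finset.sum_add_distrib]⟩
  · rintro ⟨y, rfl⟩
    exact Submodule.sum_mem _ fun i _ =>
      Submodule.smul_mem_smul (Ideal.subset_span ⟨i, rfl⟩) trivial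

theorem map_mem_varsSMulTop (f : X →ₗ[PolyS k n] Y) {x : X} (hx : x ∈ varsSMulTop k n X) :
    f x ∈ varsSMulTop k n Y := by
  have h := Submodule.mem_map_of_mem (f := f) hx
  rw [Submodule.map_smul''] at h
  exact Submodule.smul_mono le_rfl le_top h

end IrrelevantIdeal

section Frames

universe v v'

variable {k : Type*} [Field k] {n : ℕ} {A : Type*} [AddCommGroup A] {w : Fin (n + 1) → A}

/-- `u : V → X` exhibits the graded module `X` as the free graded module `S ⊗ V` on the graded
vector space `V`. This replaces homogeneous bases by their coordinate-free counterpart: `u`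
identifies `V` with `X` modulo the variables. -/
structure GrMod.IsFrame (X : GrMod.{v} k w) {V : Type*} [AddCommGroup V] [Module k V]
    (gr : A → Submodule k V) (u : V →ₗ[k] X) : Prop where
  isGrading : IsGrading gr
  isGradedMap : IsGradedMap gr X.gr u
  bijective : Function.Bijective (u.liftBaseChange (PolyS k n))

theorem GrMod.isGradedMap_liftBaseChange (X : GrMod.{v} k w) {V : Type*} [AddCommGroup V]
    [Module k V] {gr : A → Submodule k V} {u : V →ₗ[k] X} (hu : IsGradedMap gr X.gr u) :
    IsGradedMap (tensorGr (MvPolynomial.weightedHomogeneousSubmodule k w) gr fun b a => b + a) X.gr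
      (u.liftBaseChange (PolyS k n)) := by
  intro a t ht
  induction ht using Submodule.span_induction with
  | zero => rw [map_zero]; exact zero_mem _
  | add a b _ _ ha hb => rw [map_add]; exact add_mem ha hb
  | smul r a _ ha => rw [LinearMap.map_smul_of_tower]; exact Submodule.smul_mem _ _ ha
  | mem t ht =>
    obtain ⟨b, c, s, hs, x, hx, rfl, rfl⟩ := ht
    rw [LinearMap.liftBaseChange_tmul]
    exact X.smul_mem hs (hu _ _ hx)

namespace GrMod.IsFrame

variable {X : GrMod.{v} k w} {Y : GrMod.{v'} k w} {V : Type*} [AddCommGroup V] [Module k V]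
  {gr : A → Submodule k V} {u : V →ₗ[k] X}

/-- The isomorphism `S ⊗ V ≅ X` given by a frame. -/
noncomputable def equiv (h : X.IsFrame gr u) : (PolyS k n ⊗[k] V) ≃ₗ[PolyS k n] X :=
  LinearEquiv.ofBijective _ h.bijective

theorem equiv_tmul (h : X.IsFrame gr u) (s : PolyS k n) (x : V) : h.equiv (s ⊗ₜ x) = s • u x :=
  LinearMap.liftBaseChange_tmul _ _ _ _

theorem equiv_symm_smul (h : X.IsFrame gr u) (s : PolyS k n) (x : V) :
    h.equiv.symm (s • u x) = s ⊗ₜ x := by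
  rw [← h.equiv_tmul, LinearEquiv.symm_apply_apply]

theorem mem_tensorGr_iff (h : X.IsFrame gr u) (a : A) (t : PolyS k n ⊗[k] V) :
    t ∈ tensorGr (MvPolynomial.weightedHomogeneousSubmodule k w) gr (fun b a => b + a) a ↔
      h.equiv t ∈ X.gr a :=
  ((poly_isGrading k w).tensor h.isGrading _).mem_iff_map_mem X.isGrading
    (f := (h.equiv.toLinearMap.restrictScalars k)) h.equiv.injective
    (X.isGradedMap_liftBaseChange h.isGradedMap) a t

theorem induction_on (h : X.IsFrame gr u) {P : X → Prop} (x : X)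
    (smul : ∀ (s : PolyS k n) (v : V), P (s • u v)) (add : ∀ x y, P x → P y → P (x + y)) : P x := by
  rw [← h.equiv.apply_symm_apply x]
  induction h.equiv.symm x using TensorProduct.induction_on with
  | zero => rw [map_zero]; simpa using smul 0 0
  | add x y hx hy => rw [map_add]; exact add _ _ hx hy
  | tmul s v => rw [h.equiv_tmul]; exact smul s v

theorem linearMap_ext (h : X.IsFrame gr u) {Z : Type*} [AddCommGroup Z] [Module (PolyS k n) Z]
    {f g : X →ₗ[PolyS k n] Z} (hfg : ∀ v, f (u v) = g (u v)) : f = g := by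
  ext x
  refine h.induction_on (P := fun x => f x = g x) x (fun s v => ?_)
    (fun x y hx hy => by rw [map_add, map_add, hx, hy])
  rw [map_smul, map_smul, hfg]

/-- The map of graded modules extending a map on a frame. -/
noncomputable def lift (h : X.IsFrame gr u) (g : V →ₗ[k] Y) : X →ₗ[PolyS k n] Y :=
  g.liftBaseChange (PolyS k n) ∘ₗ h.equiv.symm.toLinearMap

theorem lift_apply (h : X.IsFrame gr u) (g : V →ₗ[k] Y) (x : V) : h.lift g (u x) = g x := by
  have := h.equiv_symm_smul 1 x
  rw [one_smul] at this
  simp [lift, this]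

theorem isGradedMap_lift (h : X.IsFrame gr u) {g : V →ₗ[k] Y} (hg : IsGradedMap gr Y.gr g) :
    IsGradedMap X.gr Y.gr (h.lift g) := by
  refine fun a x hx => Y.isGradedMap_liftBaseChange hg a _ ?_
  rw [h.mem_tensorGr_iff]
  simpa using hx

/-- The coefficient in `V` of the monomial with exponent `m`. -/
noncomputable def coeff (h : X.IsFrame gr u) (m : Fin (n + 1) →₀ ℕ) : X →ₗ[k] V :=
  (TensorProduct.lid k V).toLinearMap ∘ₗ LinearMap.rTensor V (MvPolynomial.lcoeff k m) ∘ₗ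
    h.equiv.symm.toLinearMap.restrictScalars k

theorem coeff_smul (h : X.IsFrame gr u) (m : Fin (n + 1) →₀ ℕ) (s : PolyS k n) (x : V) :
    h.coeff m (s • u x) = s.coeff m • x := by
  simp [coeff, h.equiv_symm_smul]

theorem coeff_zero_frame (h : X.IsFrame gr u) (x : V) : h.coeff 0 (u x) = x := by
  simpa using h.coeff_smul 0 1 x

theorem injective (h : X.IsFrame gr u) : Function.Injective u :=
  Function.LeftInverse.injective h.coeff_zero_frame

theorem coeff_X_smul [DecidableEq (Fin (n + 1))] (h : X.IsFrame gr u) (m : Fin (n + 1) →₀ ℕ)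
    (i : Fin (n + 1)) (x : X) :
    h.coeff m ((MvPolynomial.X i : PolyS k n) • x) =
      if i ∈ m.support then h.coeff (m - Finsupp.single i 1) x else 0 := by
  refine h.induction_on (P := fun x => h.coeff m ((MvPolynomial.X i : PolyS k n) • x) =
      if i ∈ m.support then h.coeff (m - Finsupp.single i 1) x else 0) x (fun s v => ?_)
    (fun x y hx hy => by rw [smul_add, map_add, hx, hy]; split_ifs <;> simp)
  rw [smul_smul, h.coeff_smul, h.coeff_smul, MvPolynomial.coeff_X_mul', ite_smul, zero_smul]

theorem coeff_zero_X_smul (h : X.IsFrame gr u) (i : Fin (n + 1)) (x : X) :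
    h.coeff 0 ((MvPolynomial.X i : PolyS k n) • x) = 0 := by
  rw [h.coeff_X_smul]; simp

theorem coeff_single_X_smul (h : X.IsFrame gr u) (i l : Fin (n + 1)) (x : X) :
    h.coeff (Finsupp.single i 1) ((MvPolynomial.X l : PolyS k n) • x) =
      if l = i then h.coeff 0 x else 0 := by
  rw [h.coeff_X_smul]
  by_cases hl : l = i
  · subst hl; simp
  · simp [hl]

theorem coeff_single_sum (h : X.IsFrame gr u) (i : Fin (n + 1)) (y : Fin (n + 1) → X) :
    h.coeff (Finsupp.single i 1) (∑ l, (MvPolynomial.X l : PolyS k n) • y l) =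
      h.coeff 0 (y i) := by
  simp [map_sum, h.coeff_single_X_smul]

theorem coeff_zero_of_mem (h : X.IsFrame gr u) {x : X} (hx : x ∈ varsSMulTop k n X) :
    h.coeff 0 x = 0 := by
  obtain ⟨y, rfl⟩ := mem_varsSMulTop.mp hx
  simp [map_sum, h.coeff_zero_X_smul]

theorem sub_coeff_zero_mem (h : X.IsFrame gr u) (x : X) :
    x - u (h.coeff 0 x) ∈ varsSMulTop k n X := by
  refine h.induction_on (P := fun x => x - u (h.coeff 0 x) ∈ varsSMulTop k n X) x
    (fun s v => ?_) (fun x y hx hy => ?_)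
  · have hC : u (h.coeff 0 (s • u v)) = (MvPolynomial.C (s.coeff 0) : PolyS k n) • u v := by
      rw [h.coeff_smul, map_smul, ← MvPolynomial.algebraMap_eq, algebraMap_smul]
    rw [hC, ← sub_smul]
    exact Submodule.smul_mem_smul (sub_C_coeff_zero_mem_varsIdeal s) trivial
  · rw [map_add, map_add, add_sub_add_comm]
    exact add_mem hx hy

theorem mem_varsSMulTop_of_coeff_zero (h : X.IsFrame gr u) {x : X} (hx : h.coeff 0 x = 0) :
    x ∈ varsSMulTop k n X := by
  simpa [hx] using h.sub_coeff_zero_mem x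

theorem coeff_mem (h : X.IsFrame gr u) (m : Fin (n + 1) →₀ ℕ) (a : A) (x : X) (hx : x ∈ X.gr a) :
    h.coeff m x ∈ gr (a - Finsupp.weight w m) := by
  obtain ⟨t, rfl⟩ := h.equiv.surjective x
  rw [← h.mem_tensorGr_iff] at hx
  induction hx using Submodule.span_induction with
  | zero => simp
  | add a b _ _ ha hb => rw [map_add, map_add]; exact add_mem ha hb
  | smul r a _ ha =>
    rw [← LinearEquiv.coe_coe, LinearMap.map_smul_of_tower, map_smul]
    exact Submodule.smul_mem _ _ ha
  | mem t ht =>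
    obtain ⟨b, c, s, hs, x, hx, rfl, rfl⟩ := ht
    rw [h.equiv_tmul, h.coeff_smul]
    by_cases hm : s.coeff m = 0
    · rw [hm, zero_smul]; exact zero_mem _
    · have : Finsupp.weight w m = b := hs hm
      rw [this, add_sub_cancel_left]
      exact Submodule.smul_mem _ _ hx

theorem isGradedMap_coeff_zero (h : X.IsFrame gr u) : IsGradedMap X.gr gr (h.coeff 0) :=
  fun a x hx => by simpa using h.coeff_mem 0 a x hx

theorem coeff_single_mem (h : X.IsFrame gr u) (i : Fin (n + 1)) (a : A) (x : X)
    (hx : x ∈ X.gr a) : h.coeff (Finsupp.single i 1) x ∈ gr (a - w i) := by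
  simpa [Finsupp.weight_single] using h.coeff_mem (Finsupp.single i 1) a x hx

end GrMod.IsFrame

theorem isGrading_supported {ι κ : Type*} (deg : ι → κ) :
    IsGrading fun a => Finsupp.supported k k {i | deg i = a} := by
  classical
  refine ⟨?_, eq_top_iff.mpr fun x _ => ?_⟩
  · refine iSupIndep_of_proj _
      (fun a => (Finsupp.supported k k {i | deg i = a}).subtype ∘ₗ
        Finsupp.restrictDom k k {i | deg i = a}) ?_ ?_
    · intro a x hx
      ext i
      simp only [LinearMap.comp_apply, Submodule.subtype_apply, Finsupp.restrictDom_apply,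
        Finsupp.filter_apply]
      split_ifs with hi
      · rfl
      · exact ((Finsupp.mem_supported' k x).mp hx i hi).symm
    · intro a b hab x hx
      ext i
      simp only [LinearMap.comp_apply, Submodule.subtype_apply, Finsupp.restrictDom_apply,
        Finsupp.filter_apply]
      split_ifs with hi
      · exact (Finsupp.mem_supported' k x).mp hx i fun h => hab (h.symm.trans hi)
      · rfl
  · induction x using Finsupp.induction_linear with
    | zero => exact zero_mem _
    | add f g hf hg => exact add_mem (hf trivial) (hg trivial)
    | single i r =>
      exact Submodule.mem_iSup_of_mem (deg i) (Finsupp.single_mem_supported k r rfl)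

theorem bijective_liftBaseChange_linearCombination {R X ι : Type*} [CommRing R] [Algebra k R]
    [AddCommGroup X] [Module k X] [Module R X] [IsScalarTower k R X] (b : Module.Basis ι R X) :
    Function.Bijective ((Finsupp.linearCombination k b).liftBaseChange R) := by
  let e := Algebra.TensorProduct.basis R (Finsupp.basisSingleOne (R := k) (ι := ι))
  have h : (Finsupp.linearCombination k b).liftBaseChange R =
      (e.equiv b (Equiv.refl ι)).toLinearMap := by
    refine e.ext fun i => ?_
    rw [LinearEquiv.coe_coe, Module.Basis.equiv_apply]
    simp [e, Algebra.TensorProduct.basis_apply, LinearMap.liftBaseChange_tmul]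
  rw [h]
  exact LinearEquiv.bijective _

theorem GrMod.isFrame_of_basis {X : GrMod.{v} k w} {ι : Type*}
    (b : Module.Basis ι (PolyS k n) X) {deg : ι → A} (hb : ∀ i, b i ∈ X.gr (deg i)) :
    X.IsFrame (fun a => Finsupp.supported k k {i | deg i = a})
      (Finsupp.linearCombination k b) where
  isGrading := isGrading_supported deg
  isGradedMap a x hx := by
    rw [Finsupp.linearCombination_apply]
    refine Submodule.sum_mem _ fun i hi => Submodule.smul_mem _ _ ?_
    obtain rfl : deg i = a := hx hi
    exact hb i
  bijective := bijective_liftBaseChange_linearCombination b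

theorem GrMod.IsFree.exists_isFrame {X : GrMod.{v} k w} (h : X.IsFree) :
    ∃ (ι : Type v) (gr : A → Submodule k (ι →₀ k)) (u : (ι →₀ k) →ₗ[k] X), X.IsFrame gr u := by
  obtain ⟨ι, b, hb⟩ := h
  choose deg hdeg using hb
  exact ⟨ι, _, _, X.isFrame_of_basis b hdeg⟩

end Frames

section Nakayama

universe v v'

variable {k : Type*} [Field k] {n : ℕ} {A : Type*} [AddCommGroup A] {w : Fin (n + 1) → A}

theorem GrMod.proj_X_smul (X : GrMod.{v} k w) (i : Fin (n + 1)) (a : A) (y : X) :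
    X.isGrading.proj a ((MvPolynomial.X i : PolyS k n) • y) =
      (MvPolynomial.X i : PolyS k n) • X.isGrading.proj (a - w i) y := by
  have := X.isGrading.map_proj X.isGrading (f := X.xmul i) (σ := fun b => w i + b)
    (add_right_injective (w i)) (fun b x hx => X.smul_mem (X_mem i) hx) (a - w i) y
  rw [GrMod.xmul_apply, GrMod.xmul_apply, add_sub_cancel] at this
  exact this.symm

theorem GrMod.proj_mem_varsSMulTop (X : GrMod.{v} k w) (a : A) {x : X}
    (hx : x ∈ varsSMulTop k n X) : X.isGrading.proj a x ∈ varsSMulTop k n X := by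
  obtain ⟨y, rfl⟩ := mem_varsSMulTop.mp hx
  refine mem_varsSMulTop.mpr ⟨fun i => X.isGrading.proj (a - w i) (y i), ?_⟩
  rw [map_sum]
  exact Finset.sum_congr rfl fun i _ => X.proj_X_smul i a (y i)

theorem GrMod.IsBoundedBelow.eq_top_of_sub_mem {X : GrMod.{v} k w} (hX : X.IsBoundedBelow)
    {P : Submodule (PolyS k n) X} (hP : IsHomogeneous X.gr (P.restrictScalars k))
    (h : ∀ x, ∃ p ∈ P, x - p ∈ varsSMulTop k n X) : P = ⊤ := by
  obtain ⟨θ, hθ, B, hB⟩ := hX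
  have mem_of_lt : ∀ N : ℕ, ∀ a, θ a < B + N → ∀ x ∈ X.gr a, x ∈ P := by
    intro N
    induction N with
    | zero =>
      intro a ha x hx
      rw [hB a (by simpa using ha)] at hx
      rw [(Submodule.mem_bot k).mp hx]
      exact zero_mem _
    | succ N ih =>
      intro a ha x hx
      obtain ⟨p, hp, hxp⟩ := h x
      obtain ⟨y, hy⟩ := mem_varsSMulTop.mp hxp
      rw [sub_eq_iff_eq_add] at hy
      rw [← X.isGrading.proj_of_mem hx, hy, map_add, map_sum]
      refine add_mem (Submodule.sum_mem _ fun i _ => ?_) (hP.proj_mem X.isGrading a hp)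
      rw [X.proj_X_smul]
      refine P.smul_mem _ (ih (a - w i) ?_ _ (X.isGrading.proj_mem _ _))
      have := hθ i
      rw [map_sub]
      push_cast at ha
      omega
  refine eq_top_iff.mpr fun x _ => X.isGrading.induction_on (P := fun x => x ∈ P) x
    (fun a x hx => mem_of_lt (θ a - B + 1).toNat a ?_ x hx) (zero_mem _)
    (fun x y hx hy => add_mem hx hy)
  have := Int.self_le_toNat (θ a - B + 1)
  omega

theorem GrMod.IsBoundedBelow.subsingleton {X : GrMod.{v} k w} (hX : X.IsBoundedBelow)
    (h : ∀ x : X, x ∈ varsSMulTop k n X) : Subsingleton X := by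
  have : (⊥ : Submodule (PolyS k n) X) = ⊤ := hX.eq_top_of_sub_mem
    (fun x hx => by rw [(Submodule.mem_bot _).mp hx]; exact zero_mem _)
    fun x => ⟨0, zero_mem _, by simpa using h x⟩
  exact (Submodule.subsingleton_iff (PolyS k n)).mp (subsingleton_of_bot_eq_top this)

theorem GrMod.IsBoundedBelow.sub {X : GrMod.{v} k w} (hX : X.IsBoundedBelow)
    {P : Submodule (PolyS k n) X} (hP : IsHomogeneous X.gr (P.restrictScalars k)) :
    (X.sub P hP).IsBoundedBelow := by
  obtain ⟨θ, hθ, B, hB⟩ := hX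
  refine ⟨θ, hθ, B, fun a ha => eq_bot_iff.mpr fun x hx => Subtype.ext ?_⟩
  have hx' : (x : X) ∈ X.gr a := hx
  rwa [hB a ha] at hx'

theorem map_weight_nonneg {θ : A →+ ℤ} (hθ : ∀ i, 0 < θ (w i)) (m : Fin (n + 1) →₀ ℕ) :
    0 ≤ θ (Finsupp.weight w m) := by
  rw [Finsupp.weight_apply, Finsupp.sum, map_sum]
  refine Finset.sum_nonneg fun i _ => ?_
  rw [map_nsmul]
  exact nsmul_nonneg (hθ i).le _

theorem GrMod.IsFrame.isBoundedBelow {X : GrMod.{v} k w} {V : Type*} [AddCommGroup V] [Module k V]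
    {gr : A → Submodule k V} {u : V →ₗ[k] X} (h : X.IsFrame gr u) {θ : A →+ ℤ}
    (hθ : ∀ i, 0 < θ (w i)) {B : ℤ} (hB : ∀ a, θ a < B → gr a = ⊥) : X.IsBoundedBelow := by
  refine ⟨θ, hθ, B, fun a ha => eq_bot_iff.mpr fun x hx => ?_⟩
  obtain ⟨t, rfl⟩ := h.equiv.surjective x
  rw [← h.mem_tensorGr_iff] at hx
  have : tensorGr (MvPolynomial.weightedHomogeneousSubmodule k w) gr (fun b a => b + a) a ≤ ⊥ := by
    refine Submodule.span_le.mpr ?_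
    rintro _ ⟨b, c, s, hs, y, hy, rfl, rfl⟩
    rw [SetLike.mem_coe, Submodule.mem_bot]
    by_cases hs0 : s = 0
    · rw [hs0, TensorProduct.zero_tmul]
    · obtain ⟨m, hm⟩ := MvPolynomial.ne_zero_iff.mp hs0
      obtain rfl : Finsupp.weight w m = b := hs hm
      have := map_weight_nonneg hθ m
      rw [map_add] at ha
      rw [hB c (by omega)] at hy
      rw [(Submodule.mem_bot k).mp hy, TensorProduct.tmul_zero]
  rw [(Submodule.mem_bot k).mp (this hx), map_zero]
  exact zero_mem _

namespace GrMod.IsGeneratedInDegree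

variable {X : GrMod.{v} k w} {d : A}

theorem exists_sub_mem_varsSMulTop (hX : X.IsGeneratedInDegree d) (x : X) :
    ∃ v ∈ X.gr d, x - v ∈ varsSMulTop k n X := by
  have hx : x ∈ Submodule.span (PolyS k n) (X.gr d : Set X) := hX ▸ Submodule.mem_top
  induction hx using Submodule.span_induction with
  | mem v hv => exact ⟨v, hv, by simp⟩
  | zero => exact ⟨0, zero_mem _, by simp⟩
  | add x y _ _ hx hy =>
    obtain ⟨v, hv, hxv⟩ := hx
    obtain ⟨v', hv', hyv⟩ := hy
    exact ⟨v + v', add_mem hv hv', by rw [add_sub_add_comm]; exact add_mem hxv hyv⟩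
  | smul s x _ hx =>
    obtain ⟨v, hv, hxv⟩ := hx
    refine ⟨s.coeff 0 • v, Submodule.smul_mem _ _ hv, ?_⟩
    have hs := Submodule.smul_mem_smul (sub_C_coeff_zero_mem_varsIdeal s)
      (Submodule.mem_top (x := v))
    rw [sub_smul, ← MvPolynomial.algebraMap_eq, algebraMap_smul] at hs
    simpa [smul_sub] using add_mem (Submodule.smul_mem _ s hxv) hs

theorem mem_varsSMulTop_of_ne (hX : X.IsGeneratedInDegree d) {a : A} (ha : a ≠ d) {x : X}
    (hx : x ∈ X.gr a) : x ∈ varsSMulTop k n X := by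
  obtain ⟨v, hv, hxv⟩ := hX.exists_sub_mem_varsSMulTop x
  have := X.proj_mem_varsSMulTop a hxv
  rwa [map_sub, X.isGrading.proj_of_mem hx, X.isGrading.proj_of_mem_of_ne ha.symm hv,
    sub_zero] at this

theorem proj_eq_zero_of_lt (hX : X.IsGeneratedInDegree d) {θ : A →+ ℤ} (hθ : ∀ i, 0 < θ (w i))
    {b : A} (hb : θ b < θ d) (x : X) : X.isGrading.proj b x = 0 := by
  have hx : x ∈ Submodule.span (PolyS k n) (X.gr d : Set X) := hX ▸ Submodule.mem_top
  induction hx using Submodule.span_induction generalizing b with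
  | mem v hv => exact X.isGrading.proj_of_mem_of_ne (by rintro rfl; exact lt_irrefl _ hb) hv
  | zero => exact map_zero _
  | add x y _ _ hx hy => rw [map_add, hx hb, hy hb, add_zero]
  | smul s x _ hx =>
    induction s using MvPolynomial.induction_on generalizing b with
    | C r => rw [← MvPolynomial.algebraMap_eq, algebraMap_smul, map_smul, hx hb, smul_zero]
    | add p q hp hq => rw [add_smul, map_add, hp hb, hq hb, add_zero]
    | mul_X p i hp =>
      have := hθ i
      rw [mul_comm, mul_smul, X.proj_X_smul, hp (by rw [map_sub]; omega), smul_zero]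

theorem eq_zero_of_mem_varsSMulTop (hX : X.IsGeneratedInDegree d) {θ : A →+ ℤ}
    (hθ : ∀ i, 0 < θ (w i)) {x : X} (hx : x ∈ X.gr d) (hx' : x ∈ varsSMulTop k n X) : x = 0 := by
  obtain ⟨y, hy⟩ := mem_varsSMulTop.mp hx'
  rw [← X.isGrading.proj_of_mem hx, hy, map_sum]
  refine Finset.sum_eq_zero fun i _ => ?_
  rw [X.proj_X_smul, hX.proj_eq_zero_of_lt hθ (by simpa using hθ i), smul_zero]

end GrMod.IsGeneratedInDegree

theorem GrMod.IsBoundedBelow.surjective_of_sub_mem {X : GrMod.{v} k w} (hX : X.IsBoundedBelow)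
    {g : X →ₗ[PolyS k n] X} (hg : IsGradedMap X.gr X.gr g)
    (h : ∀ x, x - g x ∈ varsSMulTop k n X) : Function.Surjective g :=
  LinearMap.range_eq_top.mp (hX.eq_top_of_sub_mem
    (X.isGrading.isHomogeneous_range X.isGrading (f := g.restrictScalars k) hg)
    fun x => ⟨g x, ⟨x, rfl⟩, h x⟩)

namespace GrMod.IsFrame

variable {X : GrMod.{v} k w} {Y : GrMod.{v'} k w} {V V' : Type*} [AddCommGroup V] [Module k V]
  [AddCommGroup V'] [Module k V'] {gr : A → Submodule k V} {gr' : A → Submodule k V'}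
  {u : V →ₗ[k] X} {u' : V' →ₗ[k] Y}

theorem sub_mem_varsSMulTop (hu : X.IsFrame gr u) {g : X →ₗ[PolyS k n] X}
    (h : ∀ v, u v - g (u v) ∈ varsSMulTop k n X) (x : X) : x - g x ∈ varsSMulTop k n X := by
  refine hu.induction_on (P := fun x => x - g x ∈ varsSMulTop k n X) x (fun s v => ?_)
    (fun x y hx hy => ?_)
  · rw [map_smul, ← smul_sub]
    exact Submodule.smul_mem _ _ (h v)
  · rw [map_add, add_sub_add_comm]
    exact add_mem hx hy

/-- A lift of the frame along `g` is again the identity modulo the variables, so that it is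
surjective as well; it is a section of `g`. -/
theorem bijective_of_sub_mem (hu : X.IsFrame gr u) (hX : X.IsBoundedBelow)
    {g : X →ₗ[PolyS k n] X} (hg : IsGradedMap X.gr X.gr g)
    (h : ∀ x, x - g x ∈ varsSMulTop k n X) : Function.Bijective g := by
  have hs := hX.surjective_of_sub_mem hg h
  obtain ⟨f, hf, hfu⟩ := hu.isGrading.exists_graded_lift X.isGrading X.isGrading
    (g := g.restrictScalars k) hg hu.isGradedMap fun v => hs _
  have hgf : Function.RightInverse (hu.lift f) g := LinearMap.congr_fun <|
    (hu.linearMap_ext fun v => by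
      rw [LinearMap.comp_apply, hu.lift_apply]
      exact hfu v : g ∘ₗ hu.lift f = LinearMap.id)
  have hs' : Function.Surjective (hu.lift f) :=
    hX.surjective_of_sub_mem (hu.isGradedMap_lift hf) fun x => by
      have := h (hu.lift f x)
      rw [hgf] at this
      rw [← neg_sub]
      exact neg_mem this
  exact ⟨(hgf.leftInverse_of_surjective hs').injective, hs⟩

theorem isBoundedBelow_of_injective (hu : X.IsFrame gr u) (hY : Y.IsBoundedBelow)
    {f : X →ₗ[PolyS k n] Y} (hf : IsGradedMap X.gr Y.gr f) (hinj : ∀ v, f (u v) = 0 → v = 0) :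
    X.IsBoundedBelow := by
  obtain ⟨θ, hθ, B, hB⟩ := hY
  refine hu.isBoundedBelow hθ (B := B) fun a ha => eq_bot_iff.mpr fun v hv => hinj v ?_
  simpa [hB a ha] using hf a _ (hu.isGradedMap a v hv)

theorem exists_bijective_comp (hu : X.IsFrame gr u) (hu' : Y.IsFrame gr' u')
    (hY : Y.IsBoundedBelow) {f : X →ₗ[PolyS k n] Y} (hf : IsGradedMap X.gr Y.gr f)
    (hinj : ∀ v, f (u v) ∈ varsSMulTop k n Y → v = 0) :
    ∃ r : Y →ₗ[PolyS k n] X, IsGradedMap Y.gr X.gr r ∧ Function.Bijective (r ∘ₗ f) := by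
  let g : V →ₗ[k] V' := hu'.coeff 0 ∘ₗ f.restrictScalars k ∘ₗ u
  have hg : IsGradedMap gr gr' g :=
    fun a x hx => hu'.isGradedMap_coeff_zero a _ (hf a _ (hu.isGradedMap a x hx))
  have hginj : Function.Injective g := (injective_iff_map_eq_zero g).mpr
    fun v hv => hinj v (hu'.mem_varsSMulTop_of_coeff_zero hv)
  have hX : X.IsBoundedBelow :=
    hu.isBoundedBelow_of_injective hY hf fun v hv => hinj v (hv ▸ zero_mem _)
  obtain ⟨r, hr, hrg⟩ := hu.isGrading.exists_graded_retraction hu'.isGrading hg hginj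
  have hlift : IsGradedMap Y.gr X.gr (hu'.lift (u ∘ₗ r)) :=
    hu'.isGradedMap_lift (hu.isGradedMap.comp hr)
  refine ⟨_, hlift, hu.bijective_of_sub_mem hX (hlift.comp hf)
    (hu.sub_mem_varsSMulTop fun v => ?_)⟩
  have h := map_mem_varsSMulTop (hu'.lift (u ∘ₗ r)) (hu'.sub_coeff_zero_mem (f (u v)))
  rw [map_sub, hu'.lift_apply, LinearMap.comp_apply, show hu'.coeff 0 (f (u v)) = g v from rfl,
    hrg] at h
  rw [← neg_sub]
  exact neg_mem h

end GrMod.IsFrame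

theorem isCompl_range_ker {R X Y : Type*} [Ring R] [AddCommGroup X] [Module R X] [AddCommGroup Y]
    [Module R Y] {f : X →ₗ[R] Y} {r : Y →ₗ[R] X} (h : Function.Bijective (r ∘ₗ f)) :
    IsCompl (LinearMap.range f) (LinearMap.ker r) := by
  refine ⟨?_, ?_⟩
  · rw [Submodule.disjoint_def]
    rintro _ ⟨x, rfl⟩ hx
    rw [(injective_iff_map_eq_zero (r ∘ₗ f)).mp h.1 x hx, map_zero]
  · rw [codisjoint_iff, eq_top_iff]
    rintro y -
    obtain ⟨x, hx⟩ := h.2 (r y)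
    rw [← add_sub_cancel (f x) y]
    refine Submodule.add_mem_sup ⟨x, rfl⟩ ?_
    rw [LinearMap.mem_ker, map_sub, ← hx, LinearMap.comp_apply, sub_self]

end Nakayama

section LinearComplexes

universe v v'

variable {k : Type*} [Field k] {n : ℕ} {A : Type*} [AddCommGroup A] {w : Fin (n + 1) → A}

namespace GrMod

variable {X : GrMod.{v} k w} {V : Type*} [AddCommGroup V] [Module k V] {gr : A → Submodule k V}

theorem smul_mem_span_X_smul (u : V →ₗ[k] X) {s : PolyS k n}
    (hs : s ∈ Submodule.span k (Set.range (MvPolynomial.X : Fin (n + 1) → PolyS k n))) (x : V) :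
    s • u x ∈ Submodule.span k
      (Set.range fun t : Fin (n + 1) × V => (MvPolynomial.X t.1 : PolyS k n) • u t.2) := by
  induction hs using Submodule.span_induction with
  | zero => rw [zero_smul]; exact zero_mem _
  | add s t _ _ hs ht => rw [add_smul]; exact add_mem hs ht
  | smul r s _ hs => rw [smul_assoc]; exact Submodule.smul_mem _ r hs
  | mem s hs =>
    obtain ⟨p, rfl⟩ := hs
    exact Submodule.subset_span ⟨(p, x), rfl⟩

namespace IsFrame

variable {u : V →ₗ[k] X}

theorem eq_sum_X_smul_of_mem_span (h : X.IsFrame gr u) {x : X}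
    (hx : x ∈ Submodule.span k
      (Set.range fun t : Fin (n + 1) × V => (MvPolynomial.X t.1 : PolyS k n) • u t.2)) :
    x = ∑ p, (MvPolynomial.X p : PolyS k n) • u (h.coeff (Finsupp.single p 1) x) := by
  induction hx using Submodule.span_induction with
  | zero => simp
  | add x y _ _ hx hy =>
    simp only [map_add, smul_add, Finset.sum_add_distrib]
    rw [← hx, ← hy]
  | smul r x _ hx =>
    simp only [map_smul, smul_comm _ r]
    rw [← Finset.smul_sum, ← hx]
  | mem x hx =>
    obtain ⟨⟨q, v⟩, rfl⟩ := hx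
    simp [h.coeff_single_X_smul, h.coeff_zero_frame, apply_ite u]

/-- The basis of `X` over `S` obtained from a basis of the frame over `k`. -/
noncomputable def basis (h : X.IsFrame gr u) {ι : Type*} (b : Module.Basis ι k V) :
    Module.Basis ι (PolyS k n) X :=
  (Algebra.TensorProduct.basis (PolyS k n) b).map h.equiv

theorem basis_apply (h : X.IsFrame gr u) {ι : Type*} (b : Module.Basis ι k V) (i : ι) :
    h.basis b i = u (b i) := by
  simp [basis, Algebra.TensorProduct.basis_apply, h.equiv_tmul]

theorem basis_repr_frame (h : X.IsFrame gr u) {ι : Type*} (b : Module.Basis ι k V) (x : V)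
    (i : ι) : (h.basis b).repr (u x) i = MvPolynomial.C (b.repr x i) := by
  have : h.equiv.symm (u x) = 1 ⊗ₜ[k] x := by simpa using h.equiv_symm_smul 1 x
  simp [basis, this, Algebra.TensorProduct.basis_repr_tmul, MvPolynomial.algebraMap_eq]

end IsFrame

end GrMod

section ExtAction

variable {V V' : ℤ → Type*} [∀ j, AddCommGroup (V j)] [∀ j, Module k (V j)]
  [∀ j, AddCommGroup (V' j)] [∀ j, Module k (V' j)]

variable (k n) in
/-- Families of maps `V_j → V_{j-1}` by which `e_0, …, e_n` may act on `⨁ⱼ Vⱼ`; the target is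
a separate index `l` with `l + 1 = j` in order to avoid transports along equalities. -/
abbrev ExtOperators (V : ℤ → Type*) [∀ j, AddCommGroup (V j)] [∀ j, Module k (V j)] : Type _ :=
  Fin (n + 1) → ∀ {j l : ℤ}, l + 1 = j → (V j →ₗ[k] V l)

variable (w) in
/-- The operators `T` make `⨁ⱼ Vⱼ` a left graded `E`-module. -/
structure IsExtAction (gr : ∀ j, A → Submodule k (V j)) (T : ExtOperators k n V) : Prop where
  isGrading : ∀ j, IsGrading (gr j)
  apply_mem : ∀ p {j l : ℤ} (h : l + 1 = j) {a x}, x ∈ gr j a → T p h x ∈ gr l (a - w p)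
  apply_apply_self : ∀ p {j l m : ℤ} (h : l + 1 = j) (h' : m + 1 = l) x, T p h' (T p h x) = 0
  apply_apply_add : ∀ p q {j l m : ℤ} (h : l + 1 = j) (h' : m + 1 = l) x,
    T p h' (T q h x) + T q h' (T p h x) = 0

/-- The maps `β j` form a homomorphism of left graded `E`-modules. -/
structure IsExtHom (gr : ∀ j, A → Submodule k (V j)) (T : ExtOperators k n V)
    (gr' : ∀ j, A → Submodule k (V' j)) (T' : ExtOperators k n V')
    (β : ∀ j, V j →ₗ[k] V' j) : Prop where
  isGradedMap : ∀ j, IsGradedMap (gr j) (gr' j) (β j)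
  map_apply : ∀ p {j l : ℤ} (h : l + 1 = j) x, β l (T p h x) = T' p h (β j x)

theorem DM.isExtAction (D : DM.{v} k w) : IsExtAction w D.auxGr fun p => D.lmulAux p where
  isGrading := D.auxGr_isGrading
  apply_mem p j l h a x hx := by
    have := D.lmul_mem p hx
    rwa [show j - 1 = l by omega] at this
  apply_apply_self p _ _ _ _ _ x := Subtype.ext (D.lmul_lmul_self p _)
  apply_apply_add p q _ _ _ _ _ x := Subtype.ext (D.lmul_lmul_add p q _)

end ExtAction

namespace GrComplex

theorem IsIso.symm {C : GrComplex.{v} k w} {C' : GrComplex.{v'} k w} (h : C.IsIso C') :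
    C'.IsIso C := by
  obtain ⟨f, hf, hd⟩ := h
  refine ⟨fun j => (f j).symm, fun j a x => ?_, fun i j h x => ?_⟩
  · rw [hf, LinearEquiv.apply_symm_apply]
  · rw [LinearEquiv.symm_apply_eq, hd, LinearEquiv.apply_symm_apply]

theorem IsStronglyLinear.of_basis {C : GrComplex.{v} k w} {ι : ℤ → Type*}
    (b : ∀ j, Module.Basis (ι j) (PolyS k n) (C.X j)) (hb : ∀ j s, ∃ a, b j s ∈ (C.X j).gr a)
    (hd : ∀ i j h (s : ι i) (t : ι j), (b j).repr (C.d i j h (b i s)) t ∈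
      Submodule.span k (Set.range (MvPolynomial.X : Fin (n + 1) → PolyS k n))) :
    C.IsStronglyLinear := by
  refine ⟨_, fun j => (b j).reindexRange, ?_, ?_⟩
  · rintro j ⟨_, s, rfl⟩
    simpa only [Module.Basis.reindexRange_apply] using hb j s
  · rintro i j h ⟨_, s, rfl⟩ ⟨_, t, rfl⟩
    rw [Module.Basis.reindexRange_repr, Module.Basis.reindexRange_apply]
    exact hd i j h s t

theorem IsIso.isStronglyLinear {C : GrComplex.{v} k w} {C' : GrComplex.{v'} k w}
    (h : C.IsIso C') (hC : C.IsStronglyLinear) : C'.IsStronglyLinear := by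
  obtain ⟨f, hf, hd⟩ := h
  obtain ⟨ι, b, hb, hbd⟩ := hC
  refine .of_basis (fun j => (b j).map (f j)) (fun j s => (hb j s).imp fun a => ?_)
    fun i j h s t => ?_
  · rw [Module.Basis.map_apply]
    exact (hf j a _).mp
  · rw [Module.Basis.map_apply, ← hd, Module.Basis.map_repr, LinearEquiv.trans_apply,
      LinearEquiv.symm_apply_apply]
    exact hbd i j h s t

/-- A map of complexes of graded modules. -/
structure Hom (C : GrComplex.{v} k w) (C' : GrComplex.{v'} k w) where
  f : ∀ j, C.X j →ₗ[PolyS k n] C'.X j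
  isGradedMap : ∀ j, IsGradedMap (C.X j).gr (C'.X j).gr (f j)
  comm : ∀ i j h x, f j (C.d i j h x) = C'.d i j h (f i x)

namespace Hom

variable {C : GrComplex.{v} k w} {C' : GrComplex.{v'} k w}

/-- The image of a map of complexes. -/
@[reducible] noncomputable def range (φ : Hom C C') : C'.Subcomplex where
  P j := LinearMap.range (φ.f j)
  homogeneous j := (C.X j).isGrading.isHomogeneous_range (C'.X j).isGrading
    (f := (φ.f j).restrictScalars k) (φ.isGradedMap j)
  d_mem i j h := by
    rintro _ ⟨x, rfl⟩
    exact ⟨C.d i j h x, φ.comm i j h x⟩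

/-- A map of complexes with values in a subcomplex, seen as a map to that subcomplex. -/
@[reducible] noncomputable def codRestrict (φ : Hom C C') (L : C'.Subcomplex)
    (hL : ∀ j x, φ.f j x ∈ L.P j) : Hom C L.toComplex where
  f j := (φ.f j).codRestrict (L.P j) (hL j)
  isGradedMap j := φ.isGradedMap j
  comm i j h x := Subtype.ext (φ.comm i j h x)

theorem isIso_of_range_eq (φ : Hom C C') (hinj : ∀ j, Function.Injective (φ.f j))
    {L : C'.Subcomplex} (hL : ∀ j, L.P j = LinearMap.range (φ.f j)) : C.IsIso L.toComplex := by
  let ψ := φ.codRestrict L fun j x => by rw [hL]; exact ⟨x, rfl⟩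
  have hψ : ∀ j, Function.Injective (ψ.f j) := fun j x y hxy => hinj j (congrArg Subtype.val hxy)
  refine ⟨fun j => LinearEquiv.ofBijective (ψ.f j) ⟨hψ j, fun ⟨y, hy⟩ => ?_⟩, fun j a x => ?_,
    ψ.comm⟩
  · obtain ⟨x, rfl⟩ := (hL j).le hy
    exact ⟨x, rfl⟩
  · exact (C.X j).isGrading.mem_iff_map_mem (L.toComplex.X j).isGrading
      (f := (ψ.f j).restrictScalars k) (hψ j) (ψ.isGradedMap j) a x

/-- Each component of the map is a split injection of graded modules; the retraction is only given
up to an automorphism. -/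
def IsSplit (φ : Hom C C') : Prop :=
  ∀ j, ∃ r : C'.X j →ₗ[PolyS k n] C.X j, IsGradedMap (C'.X j).gr (C.X j).gr r ∧
    Function.Bijective (r ∘ₗ φ.f j)

theorem IsSplit.injective {φ : Hom C C'} (hφ : φ.IsSplit) (j : ℤ) : Function.Injective (φ.f j) := by
  obtain ⟨r, -, hr⟩ := hφ j
  exact Function.Injective.of_comp (f := r) hr.injective

theorem IsSplit.isIso_range {φ : Hom C C'} (hφ : φ.IsSplit) : C.IsIso φ.range.toComplex :=
  φ.isIso_of_range_eq hφ.injective fun _ => rfl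

theorem IsSplit.isQuasiSplit_range {φ : Hom C C'} (hφ : φ.IsSplit) : φ.range.IsQuasiSplit := by
  intro j
  obtain ⟨r, hr, hb⟩ := hφ j
  exact ⟨LinearMap.ker r, (C'.X j).isGrading.isHomogeneous_ker (C.X j).isGrading
    (f := r.restrictScalars k) hr, isCompl_range_ker hb⟩

end Hom

variable {V V' : ℤ → Type*} [∀ j, AddCommGroup (V j)] [∀ j, Module k (V j)]
  [∀ j, AddCommGroup (V' j)] [∀ j, Module k (V' j)]

/-- The maps `f j` satisfy the condition under which `s ⊗ v ↦ s • f v` is a map of complexes from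
`S ⊗ V`, with the differential `s ⊗ v ↦ ∑ₚ xₚ s ⊗ Tₚ v`, to `C`. -/
structure IsTwistedMap (C : GrComplex.{v} k w) (gr : ∀ j, A → Submodule k (V j))
    (T : ExtOperators k n V) (f : ∀ j, V j →ₗ[k] C.X j) : Prop where
  isGradedMap : ∀ j, IsGradedMap (gr j) (C.X j).gr (f j)
  d_apply : ∀ {j l : ℤ} (h : l + 1 = j) x,
    C.d j l h (f j x) = ∑ p, (MvPolynomial.X p : PolyS k n) • f l (T p h x)

/-- Compatible frames of the terms of a complex, with respect to which it is `S ⊗ V` with the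
differential `s ⊗ v ↦ ∑ₚ xₚ s ⊗ Tₚ v`. -/
structure IsLinearFrame (C : GrComplex.{v} k w) (gr : ∀ j, A → Submodule k (V j))
    (T : ExtOperators k n V) (u : ∀ j, V j →ₗ[k] C.X j) : Prop where
  frame : ∀ j, (C.X j).IsFrame (gr j) (u j)
  d_apply : ∀ {j l : ℤ} (h : l + 1 = j) x,
    C.d j l h (u j x) = ∑ p, (MvPolynomial.X p : PolyS k n) • u l (T p h x)

namespace IsTwistedMap

variable {C : GrComplex.{v} k w} {gr : ∀ j, A → Submodule k (V j)} {T : ExtOperators k n V}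
  {f : ∀ j, V j →ₗ[k] C.X j}

theorem comp_isExtHom (hf : C.IsTwistedMap gr T f) {gr' : ∀ j, A → Submodule k (V' j)}
    {T' : ExtOperators k n V'} {β : ∀ j, V' j →ₗ[k] V j} (hβ : IsExtHom gr' T' gr T β) :
    C.IsTwistedMap gr' T' fun j => f j ∘ₗ β j where
  isGradedMap j := (hf.isGradedMap j).comp (hβ.isGradedMap j)
  d_apply h x := by simp only [LinearMap.comp_apply, hf.d_apply, hβ.map_apply]

theorem map_hom (hf : C.IsTwistedMap gr T f) {C' : GrComplex.{v'} k w} (φ : Hom C C') :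
    C'.IsTwistedMap gr T fun j => (φ.f j).restrictScalars k ∘ₗ f j where
  isGradedMap j := (φ.isGradedMap j).comp (hf.isGradedMap j)
  d_apply h x := by
    simp only [LinearMap.comp_apply, LinearMap.restrictScalars_apply, ← φ.comm, hf.d_apply,
      map_sum, map_smul]

end IsTwistedMap

namespace IsLinearFrame

variable {C : GrComplex.{v} k w} {C' : GrComplex.{v'} k w} {gr : ∀ j, A → Submodule k (V j)}
  {T : ExtOperators k n V} {u : ∀ j, V j →ₗ[k] C.X j} {gr' : ∀ j, A → Submodule k (V' j)}
  {T' : ExtOperators k n V'}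

theorem isTwistedMap (hC : C.IsLinearFrame gr T u) : C.IsTwistedMap gr T u where
  isGradedMap j := (hC.frame j).isGradedMap
  d_apply := hC.d_apply

theorem apply_coeff_zero (hC : C.IsLinearFrame gr T u) (p : Fin (n + 1)) {j l : ℤ} (h : l + 1 = j)
    (y : C.X j) : T p h ((hC.frame j).coeff 0 y) =
      (hC.frame l).coeff (Finsupp.single p 1) (C.d j l h y) := by
  refine (hC.frame j).induction_on (P := fun y => T p h ((hC.frame j).coeff 0 y) =
      (hC.frame l).coeff (Finsupp.single p 1) (C.d j l h y)) y (fun s x => ?_)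
    (fun x y hx hy => by simp only [map_add, hx, hy])
  rw [map_smul (C.d j l h), hC.d_apply, (hC.frame j).coeff_smul, map_smul, Finset.smul_sum]
  simp only [smul_comm s]
  rw [(hC.frame l).coeff_single_sum, (hC.frame l).coeff_smul]

theorem eq_coeff (hC : C.IsLinearFrame gr T u) (p : Fin (n + 1)) {j l : ℤ} (h : l + 1 = j)
    (x : V j) : T p h x = (hC.frame l).coeff (Finsupp.single p 1) (C.d j l h (u j x)) := by
  rw [← hC.apply_coeff_zero, (hC.frame j).coeff_zero_frame]

theorem apply_mem (hC : C.IsLinearFrame gr T u) (p : Fin (n + 1)) {j l : ℤ} (h : l + 1 = j)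
    {a : A} {x : V j} (hx : x ∈ gr j a) : T p h x ∈ gr l (a - w p) := by
  rw [hC.eq_coeff]
  exact (hC.frame l).coeff_single_mem p a _ (C.d_mem j l h a _ ((hC.frame j).isGradedMap a x hx))

theorem sum_sum_eq_zero (hC : C.IsLinearFrame gr T u) {j l m : ℤ} (h : l + 1 = j) (h' : m + 1 = l)
    (x : V j) : ∑ q, (MvPolynomial.X q : PolyS k n) •
      ∑ p, (MvPolynomial.X p : PolyS k n) • u m (T p h' (T q h x)) = 0 := by
  have := C.d_d j l m h h' (u j x)
  rw [hC.d_apply, map_sum] at this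
  simpa only [map_smul, hC.d_apply] using this

theorem apply_apply_self (hC : C.IsLinearFrame gr T u) {j l m : ℤ} (h : l + 1 = j)
    (h' : m + 1 = l) (p : Fin (n + 1)) (x : V j) : T p h' (T p h x) = 0 := by
  classical
  have := congrArg ((hC.frame m).coeff (Finsupp.single p 1 + Finsupp.single p 1))
    (hC.sum_sum_eq_zero h h' x)
  rw [map_sum, map_zero, Finset.sum_eq_single p] at this
  · rw [(hC.frame m).coeff_X_smul, if_pos (by simp), add_tsub_cancel_right,
      (hC.frame m).coeff_single_sum, (hC.frame m).coeff_zero_frame] at this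
    exact this
  · intro q _ hq
    rw [(hC.frame m).coeff_X_smul, if_neg]
    simp [hq.symm]
  · simp

theorem apply_apply_add (hC : C.IsLinearFrame gr T u) {j l m : ℤ} (h : l + 1 = j)
    (h' : m + 1 = l) (p q : Fin (n + 1)) (x : V j) :
    T p h' (T q h x) + T q h' (T p h x) = 0 := by
  classical
  by_cases hpq : p = q
  · subst hpq
    rw [hC.apply_apply_self, add_zero]
  have := congrArg ((hC.frame m).coeff (Finsupp.single p 1 + Finsupp.single q 1))
    (hC.sum_sum_eq_zero h h' x)
  rw [map_sum, map_zero, Finset.sum_eq_add q p (Ne.symm hpq)] at this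
  · rw [(hC.frame m).coeff_X_smul, (hC.frame m).coeff_X_smul,
      if_pos (by simp), if_pos (by simp), add_tsub_cancel_right, add_tsub_cancel_left,
      (hC.frame m).coeff_single_sum, (hC.frame m).coeff_zero_frame,
      (hC.frame m).coeff_single_sum, (hC.frame m).coeff_zero_frame] at this
    exact this
  · rintro r _ ⟨hq, hp⟩
    rw [(hC.frame m).coeff_X_smul, if_neg]
    simp [hp.symm, hq.symm]
  · simp
  · simp

theorem isExtAction (hC : C.IsLinearFrame gr T u) : IsExtAction w gr T where
  isGrading j := (hC.frame j).isGrading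
  apply_mem p _ _ h _ _ hx := hC.apply_mem p h hx
  apply_apply_self p _ _ _ h h' x := hC.apply_apply_self h h' p x
  apply_apply_add p q _ _ _ h h' x := hC.apply_apply_add h h' p q x

theorem isExtHom_coeff_zero (hC : C.IsLinearFrame gr T u) {g : ∀ j, V' j →ₗ[k] C.X j}
    (hg : C.IsTwistedMap gr' T' g) :
    IsExtHom gr' T' gr T fun j => (hC.frame j).coeff 0 ∘ₗ g j where
  isGradedMap j := (hC.frame j).isGradedMap_coeff_zero.comp (hg.isGradedMap j)
  map_apply p j l h x := by
    simp only [LinearMap.comp_apply]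
    rw [hC.apply_coeff_zero, hg.d_apply, (hC.frame l).coeff_single_sum p fun q => g l (T' q h x)]

/-- The map of complexes which extends a twisted map on the frame. -/
noncomputable def hom (hC : C.IsLinearFrame gr T u) {f : ∀ j, V j →ₗ[k] C'.X j}
    (hf : C'.IsTwistedMap gr T f) : Hom C C' where
  f j := (hC.frame j).lift (f j)
  isGradedMap j := (hC.frame j).isGradedMap_lift (hf.isGradedMap j)
  comm i j h x := by
    refine LinearMap.congr_fun (f := (hC.frame j).lift (f j) ∘ₗ C.d i j h)
      (g := C'.d i j h ∘ₗ (hC.frame i).lift (f i)) ((hC.frame i).linearMap_ext fun x => ?_) x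
    simp only [LinearMap.comp_apply, hC.d_apply, map_sum, map_smul, GrMod.IsFrame.lift_apply,
      hf.d_apply]

theorem hom_frame (hC : C.IsLinearFrame gr T u) {f : ∀ j, V j →ₗ[k] C'.X j}
    (hf : C'.IsTwistedMap gr T f) (j : ℤ) (x : V j) : (hC.hom hf).f j (u j x) = f j x :=
  (hC.frame j).lift_apply (f j) x

theorem hom_isSplit_of_mem_varsSMulTop (hC : C.IsLinearFrame gr T u)
    {f : ∀ j, V j →ₗ[k] C'.X j} (hf : C'.IsTwistedMap gr T f) (hfree : ∀ j, (C'.X j).IsFree)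
    (hbdd : ∀ j, (C'.X j).IsBoundedBelow)
    (hinj : ∀ j x, f j x ∈ varsSMulTop k n (C'.X j) → x = 0) : (hC.hom hf).IsSplit := by
  intro j
  obtain ⟨ι, gr', u', hu'⟩ := (hfree j).exists_isFrame
  refine (hC.frame j).exists_bijective_comp hu' (hbdd j) ((hC.hom hf).isGradedMap j) fun x hx => ?_
  rw [hC.hom_frame] at hx
  exact hinj j x hx

theorem hom_isSplit_of_injective (hC : C.IsLinearFrame gr T u) {u' : ∀ j, V' j →ₗ[k] C'.X j}
    (hC' : C'.IsLinearFrame gr' T' u') {β : ∀ j, V j →ₗ[k] V' j} (hβ : IsExtHom gr T gr' T' β)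
    (hinj : ∀ j, Function.Injective (β j)) :
    (hC.hom (hC'.isTwistedMap.comp_isExtHom hβ)).IsSplit := by
  intro j
  obtain ⟨r, hr, hrβ⟩ := (hC.frame j).isGrading.exists_graded_retraction (hC'.frame j).isGrading
    (hβ.isGradedMap j) (hinj j)
  refine ⟨(hC'.frame j).lift (u j ∘ₗ r),
    (hC'.frame j).isGradedMap_lift ((hC.frame j).isGradedMap.comp hr), ?_⟩
  convert Function.bijective_id
  refine congrArg DFunLike.coe (a₂ := LinearMap.id) ((hC.frame j).linearMap_ext fun x => ?_)
  simp only [LinearMap.comp_apply, hC.hom_frame, GrMod.IsFrame.lift_apply, hrβ, LinearMap.id_apply]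

theorem isStronglyLinear (hC : C.IsLinearFrame gr T u) : C.IsStronglyLinear := by
  choose s b hb using fun j => (hC.frame j).isGrading.exists_homogeneous_basis
  refine .of_basis (fun j => (hC.frame j).basis (b j)) (fun j s => (hb j s).imp fun a ha => ?_)
    fun i j h s t => ?_
  · rw [GrMod.IsFrame.basis_apply]
    exact (hC.frame j).isGradedMap a _ ha
  · rw [GrMod.IsFrame.basis_apply, hC.d_apply, map_sum, Finsupp.finsetSum_apply]
    refine Submodule.sum_mem _ fun p _ => ?_
    rw [map_smul, Finsupp.smul_apply, (hC.frame j).basis_repr_frame, smul_eq_mul, mul_comm,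
      ← MvPolynomial.smul_eq_C_mul]
    exact Submodule.smul_mem _ _ (Submodule.subset_span ⟨p, rfl⟩)

end IsLinearFrame

theorem IsStronglyLinear.exists_isLinearFrame {C : GrComplex.{v} k w} (hC : C.IsStronglyLinear) :
    ∃ (ι : ℤ → Type v) (gr : ∀ j, A → Submodule k (ι j →₀ k))
      (T : ExtOperators k n fun j => ι j →₀ k) (u : ∀ j, (ι j →₀ k) →ₗ[k] C.X j),
      C.IsLinearFrame gr T u := by
  obtain ⟨ι, b, hb, hd⟩ := hC
  choose deg hdeg using hb
  have hfr := fun j => GrMod.isFrame_of_basis (b j) (hdeg j)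
  refine ⟨ι, _, fun p {j l} h => (hfr l).coeff (Finsupp.single p 1) ∘ₗ
    (C.d j l h).restrictScalars k ∘ₗ Finsupp.linearCombination k (b j), _, hfr, fun {i j} h x => ?_⟩
  refine (hfr j).eq_sum_X_smul_of_mem_span ?_
  rw [Finsupp.linearCombination_apply, Finsupp.sum, map_sum]
  refine Submodule.sum_mem _ fun s _ => ?_
  rw [LinearMap.map_smul_of_tower]
  refine Submodule.smul_mem _ _ ?_
  rw [← (b j).linearCombination_repr (C.d i j h (b i s)), Finsupp.linearCombination_apply]
  refine Submodule.sum_mem _ fun t _ => ?_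
  simpa using GrMod.smul_mem_span_X_smul (Finsupp.linearCombination k (b j)) (hd i j h s t)
    (Finsupp.single t 1)

end GrComplex

theorem DM.LL_isLinearFrame (D : DM.{v} k w) (hD : D.del = 0) :
    D.LL.IsLinearFrame D.auxGr (fun p => D.lmulAux p)
      (fun j => TensorProduct.mk k (PolyS k n) (D.aux j) 1) := by
  refine ⟨fun j => ⟨D.auxGr_isGrading j, fun a x hx => ?_, ?_⟩, fun h x => ?_⟩
  · have h1 : (1 : PolyS k n) ∈ MvPolynomial.weightedHomogeneousSubmodule k w 0 :=
      MvPolynomial.isWeightedHomogeneous_one k w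
    have := tmul_mem_tensorGr (fun b a : A => b + a) h1 hx
    rwa [zero_add] at this
  · have : (TensorProduct.mk k (PolyS k n) (D.aux j) 1).liftBaseChange (PolyS k n) =
        LinearMap.id := by
      refine TensorProduct.AlgebraTensorModule.ext fun s x => ?_
      simp [TensorProduct.smul_tmul']
    exact this ▸ Function.bijective_id
  · have h0 : D.delAux h x = 0 := Subtype.ext (by
      change D.del _ = 0
      rw [hD]; rfl)
    change D.LLd h (1 ⊗ₜ x) = _
    rw [D.LLd_tmul, h0, TensorProduct.tmul_zero, sub_zero]
    exact Finset.sum_congr rfl fun p _ => by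
      rw [TensorProduct.mk_apply, TensorProduct.smul_tmul']
      rfl

end LinearComplexes

section Kernel

universe v v'

variable {k : Type*} [Field k] {n : ℕ} {A : Type*} [AddCommGroup A] {w : Fin (n + 1) → A}

variable (k) in
/-- The monomial in `e₀, …, eₙ` given by a list of indices. -/
noncomputable def extMonomial (l : List (Fin (n + 1))) : Ext k n := (l.map (e k)).prod

variable (w) in
/-- The degree of a monomial in `e₀, …, eₙ`. -/
def extMonomialDeg (l : List (Fin (n + 1))) : A × ℤ := (l.map fun i => ((-w i, -1) : A × ℤ)).sum

theorem extMonomial_nil : extMonomial k ([] : List (Fin (n + 1))) = 1 := rfl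

theorem extMonomial_cons (i : Fin (n + 1)) (l : List (Fin (n + 1))) :
    extMonomial k (i :: l) = e k i * extMonomial k l := rfl

theorem extMonomialDeg_nil : extMonomialDeg w [] = 0 := rfl

theorem extMonomialDeg_cons (i : Fin (n + 1)) (l : List (Fin (n + 1))) :
    extMonomialDeg w (i :: l) = (-w i, -1) + extMonomialDeg w l := by
  simp [extMonomialDeg]

theorem extMonomialDeg_snd_nonpos (l : List (Fin (n + 1))) : (extMonomialDeg w l).2 ≤ 0 := by
  induction l with
  | nil => exact le_rfl
  | cons i l ih =>
    rw [extMonomialDeg_cons, Prod.snd_add]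
    dsimp only
    omega

theorem extMonomial_mem_extGr (l : List (Fin (n + 1))) :
    extMonomial k l ∈ extGr k w (extMonomialDeg w l) :=
  Submodule.subset_span ⟨l, rfl, rfl⟩

theorem one_mem_extGr : (1 : Ext k n) ∈ extGr k w 0 := extMonomial_mem_extGr []

theorem extGr_le {q : A × ℤ} {P : Submodule k (Ext k n)}
    (h : ∀ l, extMonomialDeg w l = q → extMonomial k l ∈ P) : extGr k w q ≤ P := by
  refine Submodule.span_le.mpr ?_
  rintro _ ⟨l, hl, rfl⟩
  exact h l hl

theorem extMonomial_linearMap_ext {N : Type*} [AddCommGroup N] [Module k N]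
    {f g : Ext k n →ₗ[k] N} (h : ∀ l, f (extMonomial k l) = g (extMonomial k l)) : f = g :=
  (extGr_isGrading k fun _ : Fin (n + 1) => (0 : ℤ)).linearMap_ext fun _ _ hx =>
    extGr_le (P := LinearMap.eqLocus f g) (fun l _ => h l) hx

/-- The natural isomorphism `ω_E ⊗ N ≅ Hom_k(E, N)`. -/
noncomputable def omegaHom (N : Type*) [AddCommGroup N] [Module k N] :
    (Omega k n ⊗[k] N) ≃ₗ[k] (Ext k n →ₗ[k] N) :=
  (TensorProduct.congr (Omega.toDual k) (LinearEquiv.refl k N)).trans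
    (dualTensorHomEquiv k (Ext k n) N)

theorem omegaHom_tmul {N : Type*} [AddCommGroup N] [Module k N] (f : Omega k n) (m : N)
    (z : Ext k n) : omegaHom N (f ⊗ₜ m) z = Omega.toDual k f z • m := by
  simp [omegaHom, dualTensorHomEquiv, dualTensorHom_apply]

theorem omegaHom_lTensor {N N' : Type*} [AddCommGroup N] [Module k N] [AddCommGroup N']
    [Module k N'] (g : N →ₗ[k] N') (t : Omega k n ⊗[k] N) (z : Ext k n) :
    omegaHom N' (LinearMap.lTensor (Omega k n) g t) z = g (omegaHom N t z) := by
  induction t using TensorProduct.induction_on with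
  | zero => simp
  | add x y hx hy => simp only [map_add, LinearMap.add_apply, hx, hy]
  | tmul f m => simp [omegaHom_tmul]

section RR

variable (M : GrMod.{v} k w)

/-- The elements of degree `p` of `Hom_k(E, M)`, where `f` has degree `(a; j)` if it maps
`E_{(b; -j)}` to `M_{a + b}` for all `b` and vanishes in the other auxiliary degrees. -/
def homExtGr (p : A × ℤ) : Submodule k (Ext k n →ₗ[k] M) where
  carrier := {φ | ∀ q, ∀ z ∈ extGr k w q, φ z ∈ M.gr (p.1 + q.1) ∧ (q.2 ≠ -p.2 → φ z = 0)}
  zero_mem' q z _ := ⟨zero_mem _, fun _ => rfl⟩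
  add_mem' hφ hψ q z hz := ⟨add_mem (hφ q z hz).1 (hψ q z hz).1, fun hq => by
    rw [LinearMap.add_apply, (hφ q z hz).2 hq, (hψ q z hz).2 hq, add_zero]⟩
  smul_mem' c φ hφ q z hz := ⟨Submodule.smul_mem _ c (hφ q z hz).1, fun hq => by
    rw [LinearMap.smul_apply, (hφ q z hz).2 hq, smul_zero]⟩

theorem mem_homExtGr_of_extMonomial {p : A × ℤ} {φ : Ext k n →ₗ[k] M}
    (h : ∀ l, φ (extMonomial k l) ∈ M.gr (p.1 + (extMonomialDeg w l).1) ∧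
      ((extMonomialDeg w l).2 ≠ -p.2 → φ (extMonomial k l) = 0)) : φ ∈ homExtGr M p := by
  intro q z hz
  refine ⟨extGr_le (P := (M.gr (p.1 + q.1)).comap φ) ?_ hz,
    fun hq => extGr_le (P := LinearMap.ker φ) ?_ hz⟩
  · rintro l rfl
    exact (h l).1
  · rintro l rfl
    exact (h l).2 hq

/-- The identification of `R(M)` with `Hom_k(E, M)`. -/
noncomputable def RRhom : (RR M).carrier ≃ₗ[k] (Ext k n →ₗ[k] M) := omegaHom M.carrier

theorem RRhom_tmul (f : Omega k n) (m : M) (z : Ext k n) :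
    RRhom M (f ⊗ₜ m) z = Omega.toDual k f z • m :=
  omegaHom_tmul f m z

theorem RRhom_op_smul (y : Ext k n) (t : (RR M).carrier) (z : Ext k n) :
    RRhom M (MulOpposite.op y • t) z = RRhom M t (y * z) := by
  induction t using TensorProduct.induction_on with
  | zero => simp
  | add x y hx hy => simp only [smul_add, map_add, LinearMap.add_apply, hx, hy]
  | tmul f m =>
    rw [TensorProduct.smul_tmul', RRhom_tmul, RRhom_tmul, Omega.toDual_smul]
    rfl

theorem RR_lmul_tmul (i : Fin (n + 1)) (f : omegaE k w) (m : M) :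
    (RR M).lmul i (f ⊗ₜ[k] m) = (omegaE k w).lmul i f ⊗ₜ[k] m := by
  refine (omegaE k w).isGrading.induction_on (P := fun f =>
    (RR M).lmul i (f ⊗ₜ[k] m) = (omegaE k w).lmul i f ⊗ₜ[k] m) f (fun p f hf => ?_) (by simp)
    fun x y hx hy => by simp only [TensorProduct.add_tmul, map_add, hx, hy]
  refine M.isGrading.induction_on (P := fun m =>
    (RR M).lmul i (f ⊗ₜ[k] m) = (omegaE k w).lmul i f ⊗ₜ[k] m) m (fun a m hm => ?_) (by simp)
    fun x y hx hy => by simp only [TensorProduct.tmul_add, map_add, hx, hy]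
  have hfm := tmul_mem_tensorGr (fun (p : A × ℤ) (a : A) => (p.1 + a, p.2)) hf hm
  rw [(RR M).lmul_apply_of_mem i hfm, (omegaE k w).lmul_apply_of_mem i hf,
    TensorProduct.smul_tmul']
  exact TensorProduct.smul_tmul' _ _ _

theorem RRhom_RRdel (t : (RR M).carrier) (z : Ext k n) :
    RRhom M (RRdel M t) z =
      ∑ i, (MvPolynomial.X i : PolyS k n) • RRhom M ((RR M).lmul i t) z := by
  induction t using TensorProduct.induction_on with
  | zero => simp
  | add x y hx hy =>
    simp only [map_add, LinearMap.add_apply, hx, hy, smul_add, Finset.sum_add_distrib]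
  | tmul f m =>
    rw [RRdel_tmul, map_sum, LinearMap.sum_apply]
    refine Finset.sum_congr rfl fun i _ => ?_
    rw [RR_lmul_tmul, RRhom_tmul, RRhom_tmul, smul_comm]

theorem RRhom_lmul {p : A × ℤ} {t : (RR M).carrier} (ht : t ∈ (RR M).gr p)
    (i : Fin (n + 1)) (z : Ext k n) :
    RRhom M ((RR M).lmul i t) z = (p.2.negOnePow : ℤ) • RRhom M t (e k i * z) := by
  rw [(RR M).lmul_apply_of_mem i ht, map_zsmul, LinearMap.smul_apply, RRhom_op_smul]

theorem RRhom_mem_homExtGr {p : A × ℤ} {t : (RR M).carrier} (ht : t ∈ (RR M).gr p) :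
    RRhom M t ∈ homExtGr M p := by
  have h : (RR M).gr p ≤ (homExtGr M p).comap (RRhom M).toLinearMap := by
    refine Submodule.span_le.mpr ?_
    rintro _ ⟨p, b, f, hf, m, hm, rfl, rfl⟩ q z hz
    change RRhom M (f ⊗ₜ m) z ∈ _ ∧ (_ → RRhom M (f ⊗ₜ m) z = 0)
    rw [RRhom_tmul]
    by_cases hq : q = -p
    · subst hq
      exact ⟨Submodule.smul_mem _ _ (by simpa using hm), fun h => absurd rfl h⟩
    · rw [hf q hq z hz, zero_smul]
      exact ⟨zero_mem _, fun _ => rfl⟩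
  exact h ht

variable {M} in
theorem proj_apply_eq_zero_of_mem_homExtGr {p p' : A × ℤ} (hp : p ≠ p') {φ : Ext k n →ₗ[k] M}
    (hφ : φ ∈ homExtGr M p) {q : A × ℤ} (hq : q.2 = -p'.2) {z : Ext k n}
    (hz : z ∈ extGr k w q) : M.isGrading.proj (p'.1 + q.1) (φ z) = 0 := by
  by_cases h : p.2 = p'.2
  · exact M.isGrading.proj_of_mem_of_ne
      (fun h' => hp (Prod.ext (add_right_cancel h') h)) (hφ q z hz).1
  · rw [(hφ q z hz).2 (hq ▸ fun h' => h (neg_injective h').symm), map_zero]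

theorem RRhom_proj (t : (RR M).carrier) (p : A × ℤ) {q : A × ℤ} {z : Ext k n}
    (hz : z ∈ extGr k w q) :
    RRhom M ((RR M).isGrading.proj p t) z =
      if q.2 = -p.2 then M.isGrading.proj (p.1 + q.1) (RRhom M t z) else 0 := by
  refine (RR M).isGrading.induction_on (P := fun t =>
    RRhom M ((RR M).isGrading.proj p t) z =
      if q.2 = -p.2 then M.isGrading.proj (p.1 + q.1) (RRhom M t z) else 0) t
    (fun p' t ht => ?_) (by simp) fun x y hx hy => ?_
  · have hmem := RRhom_mem_homExtGr M ht
    by_cases hp : p' = p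
    · subst hp
      rw [(RR M).isGrading.proj_of_mem ht]
      split_ifs with hq
      · rw [M.isGrading.proj_of_mem (hmem q z hz).1]
      · exact (hmem q z hz).2 hq
    · rw [(RR M).isGrading.proj_of_mem_of_ne hp ht, map_zero, LinearMap.zero_apply]
      split_ifs with hq
      · exact (proj_apply_eq_zero_of_mem_homExtGr hp hmem hq hz).symm
      · rfl
  · simp only [map_add, LinearMap.add_apply, hx, hy]
    split_ifs <;> simp

theorem mem_RR_gr {p : A × ℤ} {t : (RR M).carrier} (ht : RRhom M t ∈ homExtGr M p) :
    t ∈ (RR M).gr p := by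
  refine (RR M).isGrading.mem_of_proj_eq_zero fun p' hp => ?_
  refine (RRhom M).injective ((extGr_isGrading k w).linearMap_ext fun q z hz => ?_)
  rw [RRhom_proj M t p' hz, map_zero, LinearMap.zero_apply]
  split_ifs with hq
  · exact proj_apply_eq_zero_of_mem_homExtGr (Ne.symm hp) ht hq hz
  · rfl

end RR

section KK

variable (M : GrMod.{v} k w) (d : A)

/- Since `KK` is reducible, Lean unfolds it when it looks for `∀ j, Module k ((KK M d).aux j)` and
misses the instance for submodules. -/
noncomputable instance (j : ℤ) : Module k ((KK M d).aux j) := inferInstance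

/-- The embedding of `K_d(M)` in auxiliary degree `j` into `Hom_k(E, M)`. -/
noncomputable def KKhom (j : ℤ) : (KK M d).aux j →ₗ[k] (Ext k n →ₗ[k] M) :=
  (RRhom M).toLinearMap ∘ₗ
    ((Ksub M d).subtype.restrictScalars k : Ksub M d →ₗ[k] (RR M).carrier) ∘ₗ
      ((KK M d).aux j).subtype

theorem KKhom_apply {j : ℤ} (x : (KK M d).aux j) : KKhom M d j x = RRhom M x.1.1 := rfl

theorem KKhom_injective (j : ℤ) : Function.Injective (KKhom M d j) := fun _ _ hxy =>
  Subtype.ext (Subtype.ext ((RRhom M).injective hxy))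

theorem KKhom_mem_homExtGr {j : ℤ} {a : A} {x : (KK M d).aux j} (hx : x ∈ (KK M d).auxGr j a) :
    KKhom M d j x ∈ homExtGr M (a, j) :=
  RRhom_mem_homExtGr M (p := (a, j)) hx

theorem KKhom_eq_zero {j : ℤ} (x : (KK M d).aux j) {q : A × ℤ} {z : Ext k n}
    (hz : z ∈ extGr k w q) (hq : q.2 ≠ -j) : KKhom M d j x z = 0 :=
  ((KK M d).auxGr_isGrading j).induction_on (P := fun x => KKhom M d j x z = 0) x
    (fun _ _ hx => (KKhom_mem_homExtGr M d hx q z hz).2 hq) (by simp)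
    fun x y hx hy => by rw [map_add, LinearMap.add_apply, hx, hy, add_zero]

theorem KKhom_mem {j : ℤ} (x : (KK M d).aux j) (z : Ext k n) : KKhom M d j x z ∈ M.gr d := by
  obtain ⟨t, ht⟩ := x.1.2.1
  have h : KKhom M d j x z = omegaHom (M.gr d) t z := by
    rw [KKhom_apply, ← ht]
    exact omegaHom_lTensor (M.gr d).subtype t z
  exact h ▸ (omegaHom (M.gr d) t z).2

theorem KKhom_lmulAux (i : Fin (n + 1)) {j l : ℤ} (h : l + 1 = j) (x : (KK M d).aux j)
    (z : Ext k n) :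
    KKhom M d l ((KK M d).lmulAux i h x) z = (j.negOnePow : ℤ) • KKhom M d j x (e k i * z) := by
  refine ((KK M d).auxGr_isGrading j).induction_on (P := fun x =>
    KKhom M d l ((KK M d).lmulAux i h x) z = (j.negOnePow : ℤ) • KKhom M d j x (e k i * z)) x
    (fun a x hx => ?_) (by simp)
    (fun x y hx hy => by simp only [map_add, LinearMap.add_apply, hx, hy, smul_add])
  have hmul : ((KK M d).lmulAux i h x).1.1 = (j.negOnePow : ℤ) • MulOpposite.op (e k i) • x.1.1 :=
    congrArg Subtype.val ((KK M d).lmul_apply_of_mem i (p := (a, j)) hx)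
  rw [KKhom_apply, hmul, map_zsmul, LinearMap.smul_apply, RRhom_op_smul]
  rfl

theorem KKhom_e_mul (i : Fin (n + 1)) {j l : ℤ} (h : l + 1 = j) (x : (KK M d).aux j)
    (z : Ext k n) :
    KKhom M d j x (e k i * z) = (j.negOnePow : ℤ) • KKhom M d l ((KK M d).lmulAux i h x) z := by
  rw [KKhom_lmulAux, smul_smul, ← Units.val_mul, Int.units_mul_self, Units.val_one, one_smul]

theorem sum_X_smul_KKhom {j l : ℤ} (h : l + 1 = j) (x : (KK M d).aux j) (z : Ext k n) :
    ∑ i, (MvPolynomial.X i : PolyS k n) • KKhom M d l ((KK M d).lmulAux i h x) z = 0 := by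
  refine ((KK M d).auxGr_isGrading j).induction_on (P := fun x =>
    ∑ i, (MvPolynomial.X i : PolyS k n) • KKhom M d l ((KK M d).lmulAux i h x) z = 0) x
    (fun a x hx => ?_) (by simp)
    (fun x y hx hy => by
      simp only [map_add, LinearMap.add_apply, smul_add, Finset.sum_add_distrib, hx, hy, add_zero])
  have hdel : RRdel M x.1.1 = 0 := x.1.2.2
  have hsum := RRhom_RRdel M x.1.1 z
  rw [hdel, map_zero, LinearMap.zero_apply] at hsum
  refine Eq.trans (Finset.sum_congr rfl fun i _ => ?_) hsum.symm
  rw [KKhom_lmulAux]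
  exact congrArg _ (RRhom_lmul M (p := (a, j)) hx i z).symm

theorem KK_aux_eq_zero_of_neg {j : ℤ} (hj : j < 0) (x : (KK M d).aux j) : x = 0 := by
  refine KKhom_injective M d j (extMonomial_linearMap_ext fun l => ?_)
  have := extMonomialDeg_snd_nonpos (w := w) l
  rw [KKhom_eq_zero M d x (extMonomial_mem_extGr l) (by omega), map_zero, LinearMap.zero_apply]

theorem exists_KKhom_eq {j : ℤ} {a : A} {φ : Ext k n →ₗ[k] M} (hφ : φ ∈ homExtGr M (a, j))
    (hd : ∀ z, φ z ∈ M.gr d)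
    (hsum : ∀ z, ∑ i, (MvPolynomial.X i : PolyS k n) • φ (e k i * z) = 0) :
    ∃ x ∈ (KK M d).auxGr j a, KKhom M d j x = φ := by
  let s : Omega k n ⊗[k] M.gr d := (omegaHom (M.gr d)).symm (φ.codRestrict (M.gr d) hd)
  let t : (RR M).carrier := TensorProduct.AlgebraTensorModule.map
    (LinearMap.id : omegaE k w →ₗ[(Ext k n)ᵐᵒᵖ] omegaE k w) (M.gr d).subtype s
  have ht : RRhom M t = φ := LinearMap.ext fun z =>
    (omegaHom_lTensor (M.gr d).subtype s z).trans (by simp [s])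
  have htg : t ∈ (RR M).gr (a, j) := mem_RR_gr M (by rwa [ht])
  have htK : t ∈ Ksub M d := by
    refine ⟨⟨s, rfl⟩, (RRhom M).injective (LinearMap.ext fun z => ?_)⟩
    refine (RRhom_RRdel M t z).trans ?_
    simp only [RRhom_lmul M htg, ht, smul_comm (_ : PolyS k n) (_ : ℤ)]
    rw [← Finset.smul_sum, hsum, smul_zero, map_zero, LinearMap.zero_apply]
  have htK' : (⟨t, htK⟩ : Ksub M d) ∈ (KK M d).gr (a, j) := htg
  exact ⟨⟨⟨t, htK⟩, Submodule.mem_iSup_of_mem a htK'⟩, htK', ht⟩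

/-- The evaluation at `1 ∈ E`, which identifies the part of `K_d(M)` of auxiliary degree `0` with
`M_d`. -/
noncomputable def KKeval : (KK M d).aux 0 →ₗ[k] M := LinearMap.applyₗ 1 ∘ₗ KKhom M d 0

theorem KKeval_apply (x : (KK M d).aux 0) : KKeval M d x = KKhom M d 0 x 1 := rfl

theorem isGradedMap_KKeval : IsGradedMap ((KK M d).auxGr 0) M.gr (KKeval M d) := fun a x hx => by
  have h := (KKhom_mem_homExtGr M d hx 0 1 one_mem_extGr).1
  rwa [Prod.fst_zero, add_zero] at h

theorem KKeval_injective : Function.Injective (KKeval M d) := by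
  refine (injective_iff_map_eq_zero _).mpr fun x hx => ?_
  refine KKhom_injective M d 0 (extMonomial_linearMap_ext fun l => ?_)
  rw [map_zero, LinearMap.zero_apply]
  cases l with
  | nil => exact hx
  | cons i l =>
    refine KKhom_eq_zero M d x (extMonomial_mem_extGr (i :: l)) ?_
    have := extMonomialDeg_snd_nonpos (w := w) l
    rw [extMonomialDeg_cons, Prod.snd_add]
    dsimp only
    omega

theorem mem_KK_auxGr_zero (x : (KK M d).aux 0) : x ∈ (KK M d).auxGr 0 d :=
  (((KK M d).auxGr_isGrading 0).mem_iff_map_mem M.isGrading (KKeval_injective M d)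
    (isGradedMap_KKeval M d) d x).mpr (KKhom_mem M d x 1)

theorem KK_aux_eq_zero_of_invariant {P : ∀ j, (KK M d).aux j → Prop}
    (hmul : ∀ p {j l : ℤ} (h : l + 1 = j) x, P j x → P l ((KK M d).lmulAux p h x))
    (hzero : ∀ x, P 0 x → KKeval M d x = 0) {j : ℤ} {x : (KK M d).aux j} (hx : P j x) : x = 0 := by
  refine KKhom_injective M d j (extMonomial_linearMap_ext fun l => ?_)
  rw [map_zero, LinearMap.zero_apply]
  induction l generalizing j with
  | nil =>
    by_cases hj : j = 0
    · subst hj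
      exact hzero x hx
    · exact KKhom_eq_zero M d x one_mem_extGr (by simpa using hj)
  | cons i l ih =>
    rw [extMonomial_cons, KKhom_e_mul M d i (sub_add_cancel j 1), ih (hmul i _ x hx), smul_zero]

theorem IsExtHom.eq_of_KKeval_eq {V : ℤ → Type*} [∀ j, AddCommGroup (V j)]
    [∀ j, Module k (V j)] {gr : ∀ j, A → Submodule k (V j)} {T : ExtOperators k n V}
    {β β' : ∀ j, V j →ₗ[k] (KK M d).aux j}
    (hβ : IsExtHom gr T (KK M d).auxGr (fun p => (KK M d).lmulAux p) β)
    (hβ' : IsExtHom gr T (KK M d).auxGr (fun p => (KK M d).lmulAux p) β')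
    (h : ∀ x, KKeval M d (β 0 x) = KKeval M d (β' 0 x)) : β = β' := by
  refine funext fun j => LinearMap.ext fun x => sub_eq_zero.mp ?_
  refine KK_aux_eq_zero_of_invariant M d (P := fun j y => ∃ x, y = β j x - β' j x) ?_ ?_ ⟨x, rfl⟩
  · rintro p j l h _ ⟨x, rfl⟩
    exact ⟨T p h x, by rw [map_sub, hβ.map_apply, hβ'.map_apply]⟩
  · rintro _ ⟨x, rfl⟩
    rw [map_sub, h, sub_self]

end KK

end Kernel

section Comparison

universe v v'

variable {k : Type*} [Field k] {n : ℕ} {A : Type*} [AddCommGroup A] {w : Fin (n + 1) → A}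
  {V : ℤ → Type*} [∀ j, AddCommGroup (V j)] [∀ j, Module k (V j)]
  {gr : ∀ j, A → Submodule k (V j)} {T : ExtOperators k n V}

/-- The right multiplication by `eₚ` on `∏ⱼ Vⱼ` corresponding to the left multiplication `T p`. -/
def rightMul (T : ExtOperators k n V) (p : Fin (n + 1)) : Module.End k (∀ j, V j) :=
  LinearMap.pi fun l => ((l + 1).negOnePow : ℤ) • T p (rfl : l + 1 = l + 1) ∘ₗ
    LinearMap.proj (l + 1)

theorem rightMul_apply (p : Fin (n + 1)) (x : ∀ j, V j) (l : ℤ) :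
    rightMul T p x l = ((l + 1).negOnePow : ℤ) • T p rfl (x (l + 1)) := by
  simp [rightMul]

theorem rightMul_single (p : Fin (n + 1)) {j l : ℤ} (h : l + 1 = j) (x : V j) :
    rightMul T p (Pi.single j x) = Pi.single l ((j.negOnePow : ℤ) • T p h x) := by
  subst h
  funext m
  rw [rightMul_apply]
  by_cases hm : m = l
  · subst hm
    rw [Pi.single_eq_same, Pi.single_eq_same]
  · rw [Pi.single_eq_of_ne hm, Pi.single_eq_of_ne (fun h => hm (by omega)), map_zero, smul_zero]

namespace IsExtAction

theorem rightMul_rightMul_self (hT : IsExtAction w gr T) (p : Fin (n + 1)) :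
    rightMul T p * rightMul T p = 0 := by
  refine LinearMap.ext fun x => funext fun l => ?_
  rw [Module.End.mul_apply, rightMul_apply, rightMul_apply, map_zsmul, hT.apply_apply_self]
  simp only [smul_zero, LinearMap.zero_apply, Pi.zero_apply]

theorem rightMul_rightMul_add (hT : IsExtAction w gr T) (p q : Fin (n + 1)) :
    rightMul T p * rightMul T q + rightMul T q * rightMul T p = 0 := by
  refine LinearMap.ext fun x => funext fun l => ?_
  rw [LinearMap.add_apply, Pi.add_apply, Module.End.mul_apply, Module.End.mul_apply,
    rightMul_apply, rightMul_apply, rightMul_apply, rightMul_apply, map_zsmul, map_zsmul,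
    ← smul_add, ← smul_add, hT.apply_apply_add]
  simp only [smul_zero, LinearMap.zero_apply, Pi.zero_apply]

/-- The right `E`-module structure on `∏ⱼ Vⱼ` corresponding to the left action `T`. -/
noncomputable def rightAction (hT : IsExtAction w gr T) :
    Ext k n →ₐ[k] (Module.End k (∀ j, V j))ᵐᵒᵖ :=
  ExteriorAlgebra.lift k ⟨∑ i, (LinearMap.proj i : (Fin (n + 1) → k) →ₗ[k] k).smulRight
    (MulOpposite.op (rightMul T i)), fun v => by
      simp only [LinearMap.sum_apply, LinearMap.smulRight_apply, LinearMap.proj_apply]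
      refine sq_sum_eq_zero k _ (fun p => ?_) (fun p q => ?_) v _
      · rw [← MulOpposite.op_mul, hT.rightMul_rightMul_self, MulOpposite.op_zero]
      · rw [← MulOpposite.op_mul, ← MulOpposite.op_mul, ← MulOpposite.op_add,
          hT.rightMul_rightMul_add, MulOpposite.op_zero]⟩

theorem rightAction_e (hT : IsExtAction w gr T) (p : Fin (n + 1)) :
    hT.rightAction (e k p) = MulOpposite.op (rightMul T p) := by
  rw [rightAction, e, ExteriorAlgebra.lift_ι_apply]
  simp only [LinearMap.sum_apply, LinearMap.smulRight_apply, LinearMap.proj_apply]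
  rw [Finset.sum_eq_single p (fun q _ hq => by simp [hq]) (by simp)]
  simp

/-- The map `x ↦ (z ↦ ε (x z))`, by which a map `ε` from the part of auxiliary degree `0` of a right
`E`-module to `N` corresponds to a homomorphism of right `E`-modules to `Hom_k(E, N)`. -/
noncomputable def coextend (hT : IsExtAction w gr T) {N : Type*} [AddCommGroup N] [Module k N]
    (ε : V 0 →ₗ[k] N) : (∀ j, V j) →ₗ[k] Ext k n →ₗ[k] N :=
  LinearMap.mk₂ k (fun x z => ε ((hT.rightAction z).unop x 0)) (fun _ _ _ => by simp)
    (fun _ _ _ => by simp) (fun _ _ _ => by simp) fun _ _ _ => by simp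

section Coextend

variable {N : Type*} [AddCommGroup N] [Module k N] (ε : V 0 →ₗ[k] N)

theorem coextend_apply (hT : IsExtAction w gr T) (x : ∀ j, V j) (z : Ext k n) :
    hT.coextend ε x z = ε ((hT.rightAction z).unop x 0) := rfl

theorem coextend_one (hT : IsExtAction w gr T) (x : ∀ j, V j) :
    hT.coextend ε x 1 = ε (x 0) := by
  rw [coextend_apply, map_one]
  rfl

theorem coextend_e_mul (hT : IsExtAction w gr T) (x : ∀ j, V j) (p : Fin (n + 1)) (z : Ext k n) :
    hT.coextend ε x (e k p * z) = hT.coextend ε (rightMul T p x) z := by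
  rw [coextend_apply, map_mul, hT.rightAction_e]
  rfl

end Coextend

variable {M : GrMod.{v} k w} {d : A} {ε : V 0 →ₗ[k] M}

theorem sum_X_smul_coextend (hT : IsExtAction w gr T)
    (hrel : ∀ j (h : 0 + 1 = j) (x : V j),
      ∑ p, (MvPolynomial.X p : PolyS k n) • ε (T p h x) = 0) (x : ∀ j, V j) (z : Ext k n) :
    ∑ p, (MvPolynomial.X p : PolyS k n) • hT.coextend ε x (e k p * z) = 0 := by
  let g (x : ∀ j, V j) : Ext k n →ₗ[k] M :=
    ∑ p, M.xmul p ∘ₗ hT.coextend ε x ∘ₗ LinearMap.mulLeft k (e k p)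
  have hg_apply : ∀ x z, g x z =
      ∑ p, (MvPolynomial.X p : PolyS k n) • hT.coextend ε x (e k p * z) := fun x z => by
    simp [g, GrMod.xmul_apply]
  have hg : ∀ l x, g x (extMonomial k l) = 0 := by
    intro l
    induction l with
    | nil =>
      intro x
      simp only [hg_apply, extMonomial_nil, coextend_e_mul, coextend_one, rightMul_apply,
        map_zsmul, smul_comm (_ : PolyS k n) (_ : ℤ)]
      rw [← Finset.smul_sum, hrel, smul_zero]
    | cons q l ih =>
      intro x
      rw [← neg_eq_zero, ← ih (rightMul T q x), hg_apply, hg_apply, ← Finset.sum_neg_distrib]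
      refine Finset.sum_congr rfl fun p _ => ?_
      rw [← coextend_e_mul, ← smul_neg, ← map_neg, extMonomial_cons, ← mul_assoc, ← mul_assoc,
        ← neg_mul, eq_neg_of_add_eq_zero_right (e_mul_add k p q)]
  rw [← hg_apply, extMonomial_linearMap_ext (f := g x) (g := 0) fun l => hg l x,
    LinearMap.zero_apply]

theorem coextend_single_mem_homExtGr (hT : IsExtAction w gr T) (hε : IsGradedMap (gr 0) M.gr ε)
    {j : ℤ} {a : A} {x : V j} (hx : x ∈ gr j a) :
    hT.coextend ε (Pi.single j x) ∈ homExtGr M (a, j) := by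
  refine mem_homExtGr_of_extMonomial M fun l => ?_
  induction l generalizing j a with
  | nil =>
    rw [extMonomial_nil, coextend_one, extMonomialDeg_nil]
    by_cases hj : j = 0
    · subst hj
      simpa using hε a x hx
    · simp [Pi.single_eq_of_ne (Ne.symm hj)]
  | cons p l ih =>
    have h := ih (zsmul_mem (hT.apply_mem p (sub_add_cancel j 1) hx) j.negOnePow)
    rw [← rightMul_single, ← coextend_e_mul, ← extMonomial_cons] at h
    rw [extMonomialDeg_cons, Prod.fst_add, Prod.snd_add, ← add_assoc, ← sub_eq_add_neg]
    exact ⟨h.1, fun hne => h.2 fun h' => hne (by dsimp only at h' ⊢; omega)⟩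

theorem exists_isExtHom_KK (hT : IsExtAction w gr T) (hd : ∀ x, ε x ∈ M.gr d)
    (hε : IsGradedMap (gr 0) M.gr ε)
    (hrel : ∀ j (h : 0 + 1 = j) (x : V j),
      ∑ p, (MvPolynomial.X p : PolyS k n) • ε (T p h x) = 0) :
    ∃ β : ∀ j, V j →ₗ[k] (KK M d).aux j,
      IsExtHom gr T (KK M d).auxGr (fun p => (KK M d).lmulAux p) β ∧
        ∀ x, KKeval M d (β 0 x) = ε x := by
  have hgr : ∀ j a, ∀ x ∈ gr j a, ∃ y ∈ (KK M d).auxGr j a,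
      KKhom M d j y = hT.coextend ε (Pi.single j x) := fun j a x hx =>
    exists_KKhom_eq M d (hT.coextend_single_mem_homExtGr hε hx) (fun z => hd _)
      (hT.sum_X_smul_coextend hrel _)
  have hrange : ∀ j x, (hT.coextend ε ∘ₗ LinearMap.single k V j) x ∈
      LinearMap.range (KKhom M d j) := fun j x =>
    (hT.isGrading j).induction_on (P := fun x => _ ∈ LinearMap.range (KKhom M d j)) x
      (fun a x hx => let ⟨y, _, hy⟩ := hgr j a x hx; ⟨y, hy⟩) (by simp)
      fun x y hx hy => by rw [map_add]; exact add_mem hx hy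
  let β (j : ℤ) : V j →ₗ[k] (KK M d).aux j :=
    (LinearEquiv.ofInjective (KKhom M d j) (KKhom_injective M d j)).symm.toLinearMap ∘ₗ
      LinearMap.codRestrict _ (hT.coextend ε ∘ₗ LinearMap.single k V j) (hrange j)
  have hβ : ∀ j x, KKhom M d j (β j x) = hT.coextend ε (Pi.single j x) := fun j x =>
    congrArg Subtype.val (LinearEquiv.apply_symm_apply
      (LinearEquiv.ofInjective (KKhom M d j) (KKhom_injective M d j)) _)
  refine ⟨β, ⟨fun j a x hx => ?_, fun p j l h x => ?_⟩, fun x => ?_⟩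
  · obtain ⟨y, hy, hxy⟩ := hgr j a x hx
    rwa [KKhom_injective M d j ((hβ j x).trans hxy.symm)]
  · refine KKhom_injective M d l (LinearMap.ext fun z => ?_)
    rw [KKhom_lmulAux, hβ, hβ, coextend_e_mul, rightMul_single p h, ← LinearMap.smul_apply,
      ← map_zsmul, ← Pi.single_smul, smul_smul, ← Units.val_mul, Int.units_mul_self,
      Units.val_one, one_smul]
  · rw [KKeval_apply, hβ, coextend_one, Pi.single_eq_same]

end IsExtAction

end Comparison

section Resolution

universe v v'

variable {k : Type*} [Field k] {n : ℕ} {A : Type*} [AddCommGroup A] {w : Fin (n + 1) → A}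

namespace GrComplex

theorem IsIso.trans {C C' C'' : GrComplex k w} (h : C.IsIso C') (h' : C'.IsIso C'') :
    C.IsIso C'' := by
  obtain ⟨f, hf, hd⟩ := h
  obtain ⟨g, hg, hd'⟩ := h'
  exact ⟨fun j => (f j).trans (g j), fun j a x => (hf j a x).trans (hg j a _),
    fun i j h x => (congrArg (g j) (hd i j h x)).trans (hd' i j h _)⟩

namespace Subcomplex

variable {C : GrComplex.{v} k w}

/-- The inclusion of a subcomplex. -/
@[reducible] noncomputable def subtype (L : C.Subcomplex) : Hom L.toComplex C where
  f j := (L.P j).subtype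
  isGradedMap _ _ _ hx := hx
  comm _ _ _ _ := rfl

theorem IsQuasiSplit.mem_varsSMulTop {L : C.Subcomplex} (hL : L.IsQuasiSplit) {j : ℤ}
    {x : L.toComplex.X j} (hx : (x : C.X j) ∈ varsSMulTop k n (C.X j)) :
    x ∈ varsSMulTop k n (L.toComplex.X j) := by
  obtain ⟨Q, -, hQ⟩ := hL j
  simpa using map_mem_varsSMulTop (Submodule.projectionOnto (L.P j) Q hQ) hx

end Subcomplex

/-- A complex, seen as a subcomplex of itself. -/
@[reducible] noncomputable def topSubcomplex (C : GrComplex.{v} k w) : C.Subcomplex where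
  P _ := ⊤
  homogeneous j _ _ := (C.X j).isGrading.mem_iSup_of_proj_mem fun _ => trivial
  d_mem _ _ _ _ _ := trivial

theorem isIso_topSubcomplex (C : GrComplex.{v} k w) : C.IsIso C.topSubcomplex.toComplex :=
  Hom.isIso_of_range_eq (C := C) (C' := C)
    ⟨fun _ => LinearMap.id, fun _ _ _ hx => hx, fun _ _ _ _ => rfl⟩
    (fun _ => Function.injective_id) fun _ => LinearMap.range_id.symm

namespace IsMinimalFreeResolution

variable {F : GrComplex.{v} k w} {M : GrMod.{v'} k w} {ε : F.X 0 →ₗ[PolyS k n] M}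

theorem subsingleton (hF : F.IsMinimalFreeResolution M ε) {j : ℤ} (hj : j < 0) :
    Subsingleton (F.X j) := by
  obtain ⟨N, hN⟩ := hF.bounded
  have hzero : ∀ m : ℕ, ∀ j < N + m, j < 0 → Subsingleton (F.X j) := by
    intro m
    induction m with
    | zero => exact fun j hj _ => hN j (by simpa using hj)
    | succ m ih =>
      intro j hj hj0
      have := ih (j - 1) (by push_cast at hj; omega) (by omega)
      refine (hF.boundedBelow j).subsingleton fun z => ?_
      obtain ⟨y, rfl⟩ := hF.acyclic j hj0.ne z (Subsingleton.elim _ _)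
      exact hF.minimal _ _ _ y
  exact hzero (j - N + 1).toNat j (by have := Int.self_le_toNat (j - N + 1); omega) hj

theorem surjective (hF : F.IsMinimalFreeResolution M ε) : Function.Surjective ε := fun m =>
  (hF.surjective_homology m).imp fun _ => And.right

theorem exists_d_eq_of_map_eq_zero (hF : F.IsMinimalFreeResolution M ε) {z : F.X 0} (hz : ε z = 0)
    {j : ℤ} (h : 0 + 1 = j) : ∃ y : F.X j, F.d j 0 h y = z := by
  obtain rfl : j = 1 := by omega
  have := hF.subsingleton (show (-1 : ℤ) < 0 by norm_num)
  exact hF.injective_homology z (Subsingleton.elim _ _) hz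

theorem exists_d_eq (hF : F.IsMinimalFreeResolution M ε) {i j l : ℤ} (hj : j ≠ 0)
    (h : l + 1 = j) (h' : j + 1 = i) {z : F.X j} (hz : F.d j l h z = 0) :
    ∃ y : F.X i, F.d i j h' y = z := by
  obtain rfl : l = j - 1 := by omega
  subst h'
  exact hF.acyclic j hj z hz

theorem mem_varsSMulTop_of_map_eq_zero (hF : F.IsMinimalFreeResolution M ε) {z : F.X 0}
    (hz : ε z = 0) : z ∈ varsSMulTop k n (F.X 0) := by
  obtain ⟨y, rfl⟩ := hF.exists_d_eq_of_map_eq_zero hz rfl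
  exact hF.minimal _ _ _ y

theorem mem_varsSMulTop_of_d_eq_zero (hF : F.IsMinimalFreeResolution M ε) {j l : ℤ} (hj : j ≠ 0)
    (h : l + 1 = j) {z : F.X j} (hz : F.d j l h z = 0) : z ∈ varsSMulTop k n (F.X j) := by
  obtain ⟨y, rfl⟩ := hF.exists_d_eq hj h rfl hz
  exact hF.minimal _ _ _ y

theorem mem_varsSMulTop_of_map_mem (hF : F.IsMinimalFreeResolution M ε) {x : F.X 0}
    (hx : ε x ∈ varsSMulTop k n M) : x ∈ varsSMulTop k n (F.X 0) := by
  obtain ⟨y, hy⟩ := mem_varsSMulTop.mp hx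
  choose z hz using fun i => hF.surjective (y i)
  have hsub : x - ∑ i, (MvPolynomial.X i : PolyS k n) • z i ∈ varsSMulTop k n (F.X 0) :=
    hF.mem_varsSMulTop_of_map_eq_zero (by simp [hy, hz])
  simpa using add_mem hsub (mem_varsSMulTop.mpr ⟨z, rfl⟩)

theorem isGeneratedInDegree (hF : F.IsMinimalFreeResolution M ε) {d : A}
    (hM : M.IsGeneratedInDegree d) : (F.X 0).IsGeneratedInDegree d := by
  obtain ⟨ι, gr, u, hu⟩ := (hF.free 0).exists_isFrame
  have hzero : ∀ a, a ≠ d → ∀ x ∈ gr a, x = 0 := by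
    intro a ha x hx
    have hmem : u x ∈ varsSMulTop k n (F.X 0) := hF.mem_varsSMulTop_of_map_mem
      (hM.mem_varsSMulTop_of_ne ha (hF.map_mem a _ (hu.isGradedMap a x hx)))
    rw [← hu.coeff_zero_frame x, hu.coeff_zero_of_mem hmem]
  have hmem : ∀ x, x ∈ gr d := fun x => hu.isGrading.mem_of_proj_eq_zero fun a ha =>
    hzero a ha _ (hu.isGrading.proj_mem a x)
  rw [GrMod.IsGeneratedInDegree, eq_top_iff]
  rintro x -
  refine hu.induction_on (P := fun x => x ∈ Submodule.span (PolyS k n) ((F.X 0).gr d : Set (F.X 0)))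
    x (fun s x => ?_) fun x y hx hy => add_mem hx hy
  exact Submodule.smul_mem _ _ (Submodule.subset_span (hu.isGradedMap d x (hmem x)))

end IsMinimalFreeResolution

end GrComplex

theorem IsGrading.exists_lift_extending {ι U V W Z : Type*} [AddCommGroup U] [Module k U]
    [AddCommGroup V] [Module k V] [AddCommGroup W] [Module k W] [AddCommGroup Z] [Module k Z]
    {grU : ι → Submodule k U} {grV : ι → Submodule k V} {grW : ι → Submodule k W}
    {grZ : ι → Submodule k Z} (hU : IsGrading grU) (hV : IsGrading grV) (hW : IsGrading grW)
    (hZ : IsGrading grZ) {g : W →ₗ[k] Z} (hg : IsGradedMap grW grZ g) {z : V →ₗ[k] Z}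
    (hz : IsGradedMap grV grZ z) (hr : ∀ v, z v ∈ LinearMap.range g) {β : U →ₗ[k] V}
    (hβ : IsGradedMap grU grV β) (hinj : Function.Injective β) {f : U →ₗ[k] W}
    (hf : IsGradedMap grU grW f) (hgf : ∀ x, g (f x) = z (β x)) :
    ∃ h : V →ₗ[k] W, IsGradedMap grV grW h ∧ (∀ v, g (h v) = z v) ∧ ∀ x, h (β x) = f x := by
  obtain ⟨h, hh, hgh⟩ := hV.exists_graded_lift hW hZ hg hz hr
  obtain ⟨r, hr, hrβ⟩ := hU.exists_graded_retraction hV hβ hinj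
  refine ⟨h - (h ∘ₗ β - f) ∘ₗ r, fun i x hx => ?_, fun v => ?_, fun x => ?_⟩
  · exact sub_mem (hh i x hx) (sub_mem (hh i _ (hβ i _ (hr i x hx))) (hf i _ (hr i x hx)))
  · simp [hgh, hgf]
  · simp [hrβ]

section Twist

variable {V : ℤ → Type*} [∀ j, AddCommGroup (V j)] [∀ j, Module k (V j)]
  {gr : ∀ j, A → Submodule k (V j)} {X : GrMod.{v} k w} {Y : GrMod.{v'} k w}

/-- The map `v ↦ ∑ₚ xₚ φ(Tₚ v)`, which is the differential `v ↦ ∑ₚ xₚ ⊗ Tₚ v` of `S ⊗ V` followed by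
the extension of `φ` to an `S`-linear map. -/
noncomputable def twist (T : ExtOperators k n V) {j l : ℤ} (h : l + 1 = j) (φ : V l →ₗ[k] X) :
    V j →ₗ[k] X :=
  ∑ p, X.xmul p ∘ₗ φ ∘ₗ T p h

variable {T : ExtOperators k n V} {j l m : ℤ}

theorem twist_apply (h : l + 1 = j) (φ : V l →ₗ[k] X) (x : V j) :
    twist T h φ x = ∑ p, (MvPolynomial.X p : PolyS k n) • φ (T p h x) := by
  simp [twist, LinearMap.sum_apply, GrMod.xmul_apply]

theorem map_twist (g : X →ₗ[PolyS k n] Y) (h : l + 1 = j) (φ : V l →ₗ[k] X) (x : V j) :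
    g (twist T h φ x) = twist T h (g.restrictScalars k ∘ₗ φ) x := by
  simp [twist_apply]

theorem IsExtAction.isGradedMap_twist (hT : IsExtAction w gr T) (h : l + 1 = j) {φ : V l →ₗ[k] X}
    (hφ : IsGradedMap (gr l) X.gr φ) : IsGradedMap (gr j) X.gr (twist T h φ) := by
  intro a x hx
  rw [twist_apply]
  refine Submodule.sum_mem _ fun p _ => ?_
  simpa using X.smul_mem (X_mem p) (hφ _ _ (hT.apply_mem p h hx))

theorem IsExtAction.twist_twist (hT : IsExtAction w gr T) (h : l + 1 = j) (h' : m + 1 = l)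
    (φ : V m →ₗ[k] X) (x : V j) : twist T h (twist T h' φ) x = 0 := by
  simp only [twist_apply, Finset.smul_sum]
  refine sum_antisymm (fun p q => (MvPolynomial.X p : PolyS k n) •
    (MvPolynomial.X q : PolyS k n) • φ (T q h' (T p h x))) (fun p => ?_) fun p q => ?_
  · rw [hT.apply_apply_self, map_zero, smul_zero, smul_zero]
  · rw [smul_comm (MvPolynomial.X q : PolyS k n), ← smul_add, ← smul_add, ← map_add,
      hT.apply_apply_add, map_zero, smul_zero, smul_zero]

end Twist

theorem exists_dependent_seq {α : ℕ → Type*} {P : ∀ m, α m → Prop}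
    {R : ∀ m, α m → α (m + 1) → Prop} {a₀ : α 0} (h₀ : P 0 a₀)
    (step : ∀ m a, P m a → ∃ b, P (m + 1) b ∧ R m a b) :
    ∃ s : ∀ m, α m, s 0 = a₀ ∧ ∀ m, P m (s m) ∧ R m (s m) (s (m + 1)) := by
  choose next hP hR using step
  let s : ∀ m, { a : α m // P m a } :=
    fun m => Nat.rec ⟨a₀, h₀⟩ (fun m a => ⟨next m a.1 a.2, hP m a.1 a.2⟩) m
  exact ⟨fun m => (s m).1, rfl, fun m => ⟨(s m).2, hR m _ (s m).2⟩⟩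

namespace GrComplex

variable {V V' : ℤ → Type*} [∀ j, AddCommGroup (V j)] [∀ j, Module k (V j)]
  [∀ j, AddCommGroup (V' j)] [∀ j, Module k (V' j)]

/-- A graded map `φ : V j → F.X j` which extends `f j` along `β j` and from which a twisted map can
be continued to the next degree. -/
structure IsPartialLift (F : GrComplex.{v} k w) (gr : ∀ j, A → Submodule k (V j))
    (T : ExtOperators k n V) (β : ∀ j, V' j →ₗ[k] V j) (f : ∀ j, V' j →ₗ[k] F.X j) (j : ℤ)
    (φ : V j →ₗ[k] F.X j) : Prop where
  isGradedMap : IsGradedMap (gr j) (F.X j).gr φ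
  map_apply : ∀ x, φ (β j x) = f j x
  twist_mem : ∀ {i : ℤ} (h : j + 1 = i) x, ∃ y, F.d i j h y = twist T h φ x

namespace IsMinimalFreeResolution

variable {F : GrComplex.{v} k w} {M : GrMod.{v'} k w} {ε : F.X 0 →ₗ[PolyS k n] M}
  {gr : ∀ j, A → Submodule k (V j)} {T : ExtOperators k n V}
  {gr' : ∀ j, A → Submodule k (V' j)} {T' : ExtOperators k n V'}

theorem sum_X_smul_map (hF : F.IsMinimalFreeResolution M ε) {f : ∀ j, V j →ₗ[k] F.X j}
    (hf : F.IsTwistedMap gr T f) {j : ℤ} (h : 0 + 1 = j) (x : V j) :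
    ∑ p, (MvPolynomial.X p : PolyS k n) • ε (f 0 (T p h x)) = 0 := by
  obtain rfl : j = 1 := by omega
  simpa only [hf.d_apply, map_sum, map_smul] using hF.map_d (f 1 x)

theorem injective_of_isExtHom (hF : F.IsMinimalFreeResolution M ε) {f : ∀ j, V j →ₗ[k] F.X j}
    (hf : F.IsTwistedMap gr T f) (hinj : ∀ j x, f j x ∈ varsSMulTop k n (F.X j) → x = 0)
    {β : ∀ j, V j →ₗ[k] V' j} (hβ : IsExtHom gr T gr' T' β)
    (hε : ∀ x, β 0 x = 0 → ε (f 0 x) = 0) (j : ℤ) : Function.Injective (β j) := by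
  rw [injective_iff_map_eq_zero]
  rcases lt_or_ge j 0 with hj | hj
  · have := hF.subsingleton hj
    exact fun x _ => hinj j x (Subsingleton.elim (f j x) 0 ▸ zero_mem _)
  induction j, hj using Int.leInduction with
  | base => exact fun x hx => hinj 0 x (hF.mem_varsSMulTop_of_map_eq_zero (hε x hx))
  | succ j hj ih =>
    intro x hx
    refine hinj _ x (hF.mem_varsSMulTop_of_d_eq_zero (by omega) rfl ?_)
    rw [hf.d_apply]
    refine Finset.sum_eq_zero fun p _ => ?_
    rw [ih (T p rfl x) (by rw [hβ.map_apply, hx, map_zero]), map_zero, smul_zero]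

theorem exists_isExtHom_KK (hF : F.IsMinimalFreeResolution M ε) {d : A}
    (hM : M.IsGeneratedInDegree d) (hT : IsExtAction w gr T) {f : ∀ j, V j →ₗ[k] F.X j}
    (hf : F.IsTwistedMap gr T f) (hinj : ∀ j x, f j x ∈ varsSMulTop k n (F.X j) → x = 0) :
    ∃ β : ∀ j, V j →ₗ[k] (KK M d).aux j,
      IsExtHom gr T (KK M d).auxGr (fun p => (KK M d).lmulAux p) β ∧
      (∀ x, KKeval M d (β 0 x) = ε (f 0 x)) ∧ ∀ j, Function.Injective (β j) := by
  have hdeg : ∀ x, x ∈ gr 0 d := fun x => (hT.isGrading 0).mem_of_proj_eq_zero fun a ha =>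
    hinj 0 _ ((hF.isGeneratedInDegree hM).mem_varsSMulTop_of_ne ha
      (hf.isGradedMap 0 a _ ((hT.isGrading 0).proj_mem a x)))
  have hε : IsGradedMap (gr 0) M.gr (ε.restrictScalars k ∘ₗ f 0) :=
    fun a x hx => hF.map_mem a _ (hf.isGradedMap 0 a x hx)
  obtain ⟨β, hβ, hβε⟩ := hT.exists_isExtHom_KK (fun x => hε d x (hdeg x)) hε
    fun j h x => hF.sum_X_smul_map hf h x
  refine ⟨β, hβ, hβε, hF.injective_of_isExtHom hf hinj hβ fun x hx => ?_⟩
  simpa [hx] using (hβε x).symm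

section Lift

variable {β : ∀ j, V' j →ₗ[k] V j} {f : ∀ j, V' j →ₗ[k] F.X j}

theorem exists_isPartialLift_zero (hF : F.IsMinimalFreeResolution M ε) (hT : IsExtAction w gr T)
    (hT' : ∀ j, IsGrading (gr' j)) {ε₀ : V 0 →ₗ[k] M} (hε₀ : IsGradedMap (gr 0) M.gr ε₀)
    (hrel : ∀ j (h : 0 + 1 = j) x, twist T h ε₀ x = 0) (hβ : IsExtHom gr' T' gr T β)
    (hinj : ∀ j, Function.Injective (β j)) (hf : F.IsTwistedMap gr' T' f)
    (hfε : ∀ x, ε (f 0 x) = ε₀ (β 0 x)) :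
    ∃ φ : V 0 →ₗ[k] F.X 0, F.IsPartialLift gr T β f 0 φ ∧ ∀ x, ε (φ x) = ε₀ x := by
  obtain ⟨φ, hφ, hφε, hφβ⟩ := (hT' 0).exists_lift_extending (hT.isGrading 0) (F.X 0).isGrading
    M.isGrading (g := ε.restrictScalars k) hF.map_mem hε₀ (fun v => hF.surjective _)
    (hβ.isGradedMap 0) (hinj 0) (hf.isGradedMap 0) hfε
  refine ⟨φ, ⟨hφ, hφβ, fun h x => hF.exists_d_eq_of_map_eq_zero ?_ h⟩, hφε⟩
  have hcomp : ε.restrictScalars k ∘ₗ φ = ε₀ := LinearMap.ext hφε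
  rw [map_twist, hcomp, hrel]

theorem exists_isPartialLift_succ (hF : F.IsMinimalFreeResolution M ε) (hT : IsExtAction w gr T)
    (hT' : ∀ j, IsGrading (gr' j)) (hβ : IsExtHom gr' T' gr T β)
    (hinj : ∀ j, Function.Injective (β j)) (hf : F.IsTwistedMap gr' T' f) {i j : ℤ} (hi : i ≠ 0)
    (h : j + 1 = i) {φ : V j →ₗ[k] F.X j} (hφ : F.IsPartialLift gr T β f j φ) :
    ∃ φ' : V i →ₗ[k] F.X i, F.IsPartialLift gr T β f i φ' ∧
      ∀ x, F.d i j h (φ' x) = twist T h φ x := by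
  have hfβ : ∀ x, F.d i j h (f i x) = twist T h φ (β i x) := fun x => by
    simp only [hf.d_apply, twist_apply, ← hβ.map_apply, hφ.map_apply]
  obtain ⟨φ', hφ', hφ'd, hφ'β⟩ := (hT' i).exists_lift_extending (hT.isGrading i)
    (F.X i).isGrading (F.X j).isGrading (g := (F.d i j h).restrictScalars k) (F.d_mem _ _ h)
    (hT.isGradedMap_twist h hφ.isGradedMap) (hφ.twist_mem h) (hβ.isGradedMap i) (hinj i)
    (hf.isGradedMap i) hfβ
  refine ⟨φ', ⟨hφ', hφ'β, fun h' x => hF.exists_d_eq hi h h' ?_⟩, hφ'd⟩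
  have hcomp : (F.d i j h).restrictScalars k ∘ₗ φ' = twist T h φ := LinearMap.ext hφ'd
  rw [map_twist, hcomp, hT.twist_twist]

theorem exists_isTwistedMap_extending (hF : F.IsMinimalFreeResolution M ε)
    (hT : IsExtAction w gr T) (hneg : ∀ j < 0, ∀ x : V j, x = 0) (hT' : ∀ j, IsGrading (gr' j))
    {ε₀ : V 0 →ₗ[k] M} (hε₀ : IsGradedMap (gr 0) M.gr ε₀)
    (hrel : ∀ j (h : 0 + 1 = j) x, twist T h ε₀ x = 0) (hβ : IsExtHom gr' T' gr T β)
    (hinj : ∀ j, Function.Injective (β j)) (hf : F.IsTwistedMap gr' T' f)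
    (hfε : ∀ x, ε (f 0 x) = ε₀ (β 0 x)) :
    ∃ φ : ∀ j, V j →ₗ[k] F.X j,
      F.IsTwistedMap gr T φ ∧ (∀ x, ε (φ 0 x) = ε₀ x) ∧ ∀ j x, φ j (β j x) = f j x := by
  obtain ⟨φ₀, hφ₀, hφ₀ε⟩ := hF.exists_isPartialLift_zero hT hT' hε₀ hrel hβ hinj hf hfε
  obtain ⟨s, hs₀, hs⟩ := exists_dependent_seq (α := fun m : ℕ => V m →ₗ[k] F.X m)
    (P := fun m => F.IsPartialLift gr T β f m)
    (R := fun m φ φ' => ∀ x, F.d _ m (Nat.cast_succ m).symm (φ' x) = twist T _ φ x) hφ₀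
    fun m φ hφ => hF.exists_isPartialLift_succ hT hT' hβ hinj hf (by omega) _ hφ
  let φ : ∀ j : ℤ, V j →ₗ[k] F.X j := fun j => Int.rec s (fun _ => 0) j
  refine ⟨φ, ⟨fun j a x hx => ?_, fun {j l} h x => ?_⟩, fun x => ?_, fun j x => ?_⟩
  · rcases lt_or_ge j 0 with hj | hj
    · rw [hneg j hj x, map_zero]
      exact zero_mem _
    · lift j to ℕ using hj
      exact (hs j).1.isGradedMap a x hx
  · rcases lt_or_ge l 0 with hl | hl
    · have := hF.subsingleton hl
      exact Subsingleton.elim _ _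
    · lift l to ℕ using hl
      obtain rfl : j = ((l + 1 : ℕ) : ℤ) := by omega
      exact ((hs l).2 x).trans (twist_apply _ _ _)
  · exact (congrArg (fun ψ : V 0 →ₗ[k] F.X 0 => ε (ψ x)) hs₀).trans (hφ₀ε x)
  · rcases lt_or_ge j 0 with hj | hj
    · obtain rfl : x = 0 := hinj j ((hneg j hj _).trans (map_zero _).symm)
      simp only [map_zero]
    · lift j to ℕ using hj
      exact (hs j).1.map_apply x

end Lift

end IsMinimalFreeResolution

end GrComplex

end Resolution

section LinearStrand

universe v v'

section ExtHom

variable {k : Type*} [Field k] {n : ℕ} {A : Type*} {V V' V'' : ℤ → Type*}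
  [∀ j, AddCommGroup (V j)] [∀ j, Module k (V j)] [∀ j, AddCommGroup (V' j)]
  [∀ j, Module k (V' j)] [∀ j, AddCommGroup (V'' j)] [∀ j, Module k (V'' j)]
  {gr : ∀ j, A → Submodule k (V j)} {T : ExtOperators k n V}
  {gr' : ∀ j, A → Submodule k (V' j)} {T' : ExtOperators k n V'}
  {gr'' : ∀ j, A → Submodule k (V'' j)} {T'' : ExtOperators k n V''}

theorem IsExtHom.id : IsExtHom gr T gr T fun _ => LinearMap.id where
  isGradedMap _ _ _ hx := hx
  map_apply _ _ _ _ _ := rfl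

theorem IsExtHom.comp {β' : ∀ j, V' j →ₗ[k] V'' j} (hβ' : IsExtHom gr' T' gr'' T'' β')
    {β : ∀ j, V j →ₗ[k] V' j} (hβ : IsExtHom gr T gr' T' β) :
    IsExtHom gr T gr'' T'' fun j => β' j ∘ₗ β j where
  isGradedMap j := (hβ'.isGradedMap j).comp (hβ.isGradedMap j)
  map_apply p _ _ h x := by simp only [LinearMap.comp_apply, hβ.map_apply, hβ'.map_apply]

end ExtHom

variable {k : Type*} [Field k] {n : ℕ} {A : Type*} [AddCommGroup A] {w : Fin (n + 1) → A}

theorem KK_LL_isLinearFrame (M : GrMod.{v} k w) (d : A) :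
    (KK M d).LL.IsLinearFrame (KK M d).auxGr (fun p => (KK M d).lmulAux p)
      (fun j => TensorProduct.mk k (PolyS k n) ((KK M d).aux j) 1) :=
  (KK M d).LL_isLinearFrame (KK_del M d)

theorem twist_KKeval (M : GrMod.{v} k w) (d : A) {j : ℤ} (h : 0 + 1 = j) (x : (KK M d).aux j) :
    twist (fun p => (KK M d).lmulAux p) h (KKeval M d) x = 0 := by
  rw [twist_apply]
  exact sum_X_smul_KKhom M d h x 1

namespace GrComplex

theorem IsLinearFrame.eq_zero_of_mem_varsSMulTop {C : GrComplex.{v} k w} {L : C.Subcomplex}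
    (hL : L.IsQuasiSplit) {V : ℤ → Type*} [∀ j, AddCommGroup (V j)] [∀ j, Module k (V j)]
    {gr : ∀ j, A → Submodule k (V j)} {T : ExtOperators k n V} {u : ∀ j, V j →ₗ[k] L.toComplex.X j}
    (hu : L.toComplex.IsLinearFrame gr T u) {j : ℤ} {x : V j}
    (hx : (u j x : C.X j) ∈ varsSMulTop k n (C.X j)) : x = 0 :=
  ((hu.frame j).coeff_zero_frame x).symm.trans
    ((hu.frame j).coeff_zero_of_mem (hL.mem_varsSMulTop hx))

namespace IsMinimalFreeResolution

variable {M : GrMod.{v'} k w} {d : A} {F : GrComplex.{v} k w} {ε : F.X 0 →ₗ[PolyS k n] M}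

theorem mem_varsSMulTop_of_isTwistedMap (hF : F.IsMinimalFreeResolution M ε) {V : ℤ → Type*}
    [∀ j, AddCommGroup (V j)] [∀ j, Module k (V j)] {gr : ∀ j, A → Submodule k (V j)}
    {T : ExtOperators k n V} {φ : ∀ j, V j →ₗ[k] F.X j} (hφ : F.IsTwistedMap gr T φ)
    (p : Fin (n + 1)) {j l : ℤ} (h : l + 1 = j) {x : V j}
    (hx : φ j x ∈ varsSMulTop k n (F.X j)) : φ l (T p h x) ∈ varsSMulTop k n (F.X l) := by
  obtain ⟨ι, gr', u, hu⟩ := (hF.free l).exists_isFrame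
  obtain ⟨y, hy⟩ := mem_varsSMulTop.mp hx
  refine hu.mem_varsSMulTop_of_coeff_zero ?_
  rw [← hu.coeff_single_sum p fun q => φ l (T q h x), ← hφ.d_apply, hy, map_sum]
  simp only [map_smul]
  rw [hu.coeff_single_sum]
  exact hu.coeff_zero_of_mem (hF.minimal _ _ _ _)

theorem eq_zero_of_mem_varsSMulTop (hF : F.IsMinimalFreeResolution M ε)
    (hM : M.IsGeneratedInDegree d) {θ : A →+ ℤ} (hθ : ∀ i, 0 < θ (w i))
    {φ : ∀ j, (KK M d).aux j →ₗ[k] F.X j}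
    (hφ : F.IsTwistedMap (KK M d).auxGr (fun p => (KK M d).lmulAux p) φ)
    (hφε : ∀ x, ε (φ 0 x) = KKeval M d x) {j : ℤ} {x : (KK M d).aux j}
    (hx : φ j x ∈ varsSMulTop k n (F.X j)) : x = 0 := by
  refine KK_aux_eq_zero_of_invariant M d (P := fun j x => φ j x ∈ varsSMulTop k n (F.X j))
    (fun p _ _ h _ => hF.mem_varsSMulTop_of_isTwistedMap hφ p h) (fun x hx => ?_) hx
  rw [← hφε, (hF.isGeneratedInDegree hM).eq_zero_of_mem_varsSMulTop hθ
    (hφ.isGradedMap 0 d x (mem_KK_auxGr_zero M d x)) hx, map_zero]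

theorem exists_isExtHom_of_isLinearFrame (hF : F.IsMinimalFreeResolution M ε)
    (hM : M.IsGeneratedInDegree d) {L : F.Subcomplex} (hL : L.IsQuasiSplit) {V : ℤ → Type*}
    [∀ j, AddCommGroup (V j)] [∀ j, Module k (V j)] {gr : ∀ j, A → Submodule k (V j)}
    {T : ExtOperators k n V} {u : ∀ j, V j →ₗ[k] L.toComplex.X j}
    (hu : L.toComplex.IsLinearFrame gr T u) :
    ∃ β : ∀ j, V j →ₗ[k] (KK M d).aux j,
      IsExtHom gr T (KK M d).auxGr (fun p => (KK M d).lmulAux p) β ∧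
      (∀ x, KKeval M d (β 0 x) = ε (u 0 x : L.P 0)) ∧ ∀ j, Function.Injective (β j) :=
  hF.exists_isExtHom_KK hM hu.isExtAction (hu.isTwistedMap.map_hom L.subtype)
    fun _ _ => hu.eq_zero_of_mem_varsSMulTop hL

theorem exists_hom_KK_LL_extending (hF : F.IsMinimalFreeResolution M ε)
    (hM : M.IsGeneratedInDegree d) {θ : A →+ ℤ} (hθ : ∀ i, 0 < θ (w i)) {V : ℤ → Type*}
    [∀ j, AddCommGroup (V j)] [∀ j, Module k (V j)] {gr : ∀ j, A → Submodule k (V j)}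
    (hgr : ∀ j, IsGrading (gr j)) {T : ExtOperators k n V} {β : ∀ j, V j →ₗ[k] (KK M d).aux j}
    (hβ : IsExtHom gr T (KK M d).auxGr (fun p => (KK M d).lmulAux p) β)
    (hinj : ∀ j, Function.Injective (β j)) {f : ∀ j, V j →ₗ[k] F.X j}
    (hf : F.IsTwistedMap gr T f) (hfε : ∀ x, ε (f 0 x) = KKeval M d (β 0 x)) :
    ∃ Φ : Hom (KK M d).LL F, (∀ x, ε (Φ.f 0 (1 ⊗ₜ x)) = KKeval M d x) ∧
      (∀ j x, Φ.f j (1 ⊗ₜ β j x) = f j x) ∧ Φ.IsSplit := by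
  obtain ⟨φ, hφ, hφε, hφβ⟩ := hF.exists_isTwistedMap_extending (KK M d).isExtAction
    (fun _ hj => KK_aux_eq_zero_of_neg M d hj) hgr (isGradedMap_KKeval M d)
    (fun _ => twist_KKeval M d) hβ hinj hf hfε
  have hΦ : ∀ j x, ((KK_LL_isLinearFrame M d).hom hφ).f j (1 ⊗ₜ x) = φ j x :=
    (KK_LL_isLinearFrame M d).hom_frame hφ
  exact ⟨(KK_LL_isLinearFrame M d).hom hφ, fun x => by rw [hΦ, hφε], fun j x => by rw [hΦ, hφβ],
    (KK_LL_isLinearFrame M d).hom_isSplit_of_mem_varsSMulTop hφ hF.free hF.boundedBelow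
      fun j x => hF.eq_zero_of_mem_varsSMulTop hM hθ hφ hφε⟩

theorem exists_hom_KK_LL (hF : F.IsMinimalFreeResolution M ε) (hM : M.IsGeneratedInDegree d)
    {θ : A →+ ℤ} (hθ : ∀ i, 0 < θ (w i)) :
    ∃ Φ : Hom (KK M d).LL F, (∀ x, ε (Φ.f 0 (1 ⊗ₜ x)) = KKeval M d x) ∧ Φ.IsSplit := by
  obtain ⟨Φ, hΦ, -, hs⟩ := hF.exists_hom_KK_LL_extending hM hθ (V := fun _ => PUnit.{1})
    (gr := fun _ _ => ⊥) (T := fun _ {_ _} _ => 0) (β := fun _ => 0) (f := fun _ => 0)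
    (fun _ => ⟨fun _ => disjoint_bot_left, Subsingleton.elim _ _⟩)
    ⟨fun _ _ _ _ => zero_mem _, fun _ {_ _} _ _ => (map_zero _).symm⟩
    (fun _ => Function.injective_of_subsingleton _)
    ⟨fun _ _ _ _ => zero_mem _, fun _ _ => by simp⟩ (fun _ => by simp)
  exact ⟨Φ, hΦ, hs⟩

theorem map_eq_KKeval (hF : F.IsMinimalFreeResolution M ε)
    (hM : M.IsGeneratedInDegree d) {θ : A →+ ℤ} (hθ : ∀ i, 0 < θ (w i))
    {Φ : Hom (KK M d).LL F} (hΦ : ∀ x, ε (Φ.f 0 (1 ⊗ₜ x)) = KKeval M d x) {L : F.Subcomplex}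
    (hle : ∀ j y, Φ.f j y ∈ L.P j) {V : ℤ → Type*} [∀ j, AddCommGroup (V j)]
    [∀ j, Module k (V j)] {gr : ∀ j, A → Submodule k (V j)} {T : ExtOperators k n V}
    {u : ∀ j, V j →ₗ[k] L.toComplex.X j} (hu : L.toComplex.IsLinearFrame gr T u)
    (x : (KK M d).aux 0) :
    ε (u 0 ((hu.frame 0).coeff 0 ((Φ.codRestrict L hle).f 0 (1 ⊗ₜ x))) : L.P 0) =
      KKeval M d x := by
  let y := (Φ.codRestrict L hle).f 0 (1 ⊗ₜ x)
  have hΦx : (y : F.X 0) ∈ (F.X 0).gr d := Φ.isGradedMap 0 d _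
    ((KK_LL_isLinearFrame M d).frame 0 |>.isGradedMap d x (mem_KK_auxGr_zero M d x))
  have hux : (u 0 ((hu.frame 0).coeff 0 y) : F.X 0) ∈ (F.X 0).gr d :=
    (hu.frame 0).isGradedMap d _ ((hu.frame 0).isGradedMap_coeff_zero d _ hΦx)
  have hzero : (y : F.X 0) - (u 0 ((hu.frame 0).coeff 0 y) : L.P 0) = 0 :=
    (hF.isGeneratedInDegree hM).eq_zero_of_mem_varsSMulTop hθ (sub_mem hΦx hux)
      (map_mem_varsSMulTop (L.P 0).subtype ((hu.frame 0).sub_coeff_zero_mem y))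
  rw [← hΦ, ← sub_eq_zero.mp hzero]
  rfl

theorem range_eq_top_of_le (hF : F.IsMinimalFreeResolution M ε)
    (hM : M.IsGeneratedInDegree d) {θ : A →+ ℤ} (hθ : ∀ i, 0 < θ (w i))
    {Φ : Hom (KK M d).LL F} (hΦ : ∀ x, ε (Φ.f 0 (1 ⊗ₜ x)) = KKeval M d x) {L : F.Subcomplex}
    (hL : L.toComplex.IsStronglyLinear) (hLs : L.IsQuasiSplit) (hle : ∀ j y, Φ.f j y ∈ L.P j)
    (j : ℤ) : LinearMap.range ((Φ.codRestrict L hle).f j) = ⊤ := by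
  obtain ⟨ι, gr, T, u, hu⟩ := hL.exists_isLinearFrame
  obtain ⟨β, hβ, hβε, hβinj⟩ := hF.exists_isExtHom_of_isLinearFrame hM hLs hu
  let Ψ := Φ.codRestrict L hle
  have hc := hu.isExtHom_coeff_zero ((KK_LL_isLinearFrame M d).isTwistedMap.map_hom Ψ)
  have hβc := (hβ.comp hc).eq_of_KKeval_eq M d IsExtHom.id fun x =>
    (hβε _).trans (hF.map_eq_KKeval hM hθ hΦ hle hu x)
  have hcβ : ∀ x, (hu.frame j).coeff 0 (Ψ.f j (1 ⊗ₜ β j x)) = x := fun x =>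
    hβinj j (LinearMap.congr_fun (congrFun hβc j) (β j x))
  refine ((hF.boundedBelow j).sub (L.homogeneous j)).eq_top_of_sub_mem
    (((KK M d).LL.X j).isGrading.isHomogeneous_range (L.toComplex.X j).isGrading
      (f := (Ψ.f j).restrictScalars k) (Ψ.isGradedMap j)) fun x => ?_
  refine ⟨Ψ.f j (1 ⊗ₜ β j ((hu.frame j).coeff 0 x)), ⟨_, rfl⟩,
    (hu.frame j).mem_varsSMulTop_of_coeff_zero ?_⟩
  rw [map_sub, hcβ, sub_self]

theorem range_isMaximalStronglyLinear (hF : F.IsMinimalFreeResolution M ε)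
    (hM : M.IsGeneratedInDegree d) {θ : A →+ ℤ} (hθ : ∀ i, 0 < θ (w i))
    {Φ : Hom (KK M d).LL F} (hΦ : ∀ x, ε (Φ.f 0 (1 ⊗ₜ x)) = KKeval M d x) (hs : Φ.IsSplit) :
    Φ.range.IsMaximalStronglyLinear := by
  refine ⟨hs.isIso_range.isStronglyLinear (KK_LL_isLinearFrame M d).isStronglyLinear,
    hs.isQuasiSplit_range, fun L hL hLs hle j => le_antisymm (fun x hx => ?_) (hle j)⟩
  have htop := hF.range_eq_top_of_le hM hθ hΦ hL hLs (fun j y => hle j ⟨y, rfl⟩) j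
  obtain ⟨y, hy⟩ := LinearMap.range_eq_top.mp htop ⟨x, hx⟩
  exact ⟨y, congrArg Subtype.val hy⟩

theorem exists_isSplit_of_isStronglyLinear (hF : F.IsMinimalFreeResolution M ε)
    (hM : M.IsGeneratedInDegree d) {L : F.Subcomplex} (hL : L.toComplex.IsStronglyLinear)
    (hLs : L.IsQuasiSplit) : ∃ Ψ : Hom L.toComplex (KK M d).LL, Ψ.IsSplit := by
  obtain ⟨ι, gr, T, u, hu⟩ := hL.exists_isLinearFrame
  obtain ⟨β, hβ, -, hβinj⟩ := hF.exists_isExtHom_of_isLinearFrame hM hLs hu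
  exact ⟨_, hu.hom_isSplit_of_injective (KK_LL_isLinearFrame M d) hβ hβinj⟩

theorem exists_isSplit_range_ge (hF : F.IsMinimalFreeResolution M ε)
    (hM : M.IsGeneratedInDegree d) {θ : A →+ ℤ} (hθ : ∀ i, 0 < θ (w i)) {L : F.Subcomplex}
    (hL : L.toComplex.IsStronglyLinear) (hLs : L.IsQuasiSplit) :
    ∃ Φ : Hom (KK M d).LL F, Φ.IsSplit ∧ ∀ j, L.P j ≤ Φ.range.P j := by
  obtain ⟨ι, gr, T, u, hu⟩ := hL.exists_isLinearFrame
  obtain ⟨β, hβ, hβε, hβinj⟩ := hF.exists_isExtHom_of_isLinearFrame hM hLs hu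
  obtain ⟨Φ, -, hΦβ, hs⟩ := hF.exists_hom_KK_LL_extending hM hθ hu.isExtAction.isGrading hβ hβinj
    (hu.isTwistedMap.map_hom L.subtype) fun x => (hβε x).symm
  refine ⟨Φ, hs, fun j x hx => ?_⟩
  refine (hu.frame j).induction_on (P := fun x => (x : F.X j) ∈ Φ.range.P j) ⟨x, hx⟩
    (fun s v => ?_) fun x y hx hy => Submodule.add_mem _ hx hy
  exact Submodule.smul_mem _ s ⟨_, hΦβ j v⟩

theorem isIso_of_isMaximalStronglyLinear (hF : F.IsMinimalFreeResolution M ε)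
    (hM : M.IsGeneratedInDegree d) {θ : A →+ ℤ} (hθ : ∀ i, 0 < θ (w i)) {L : F.Subcomplex}
    (hL : L.IsMaximalStronglyLinear) : L.toComplex.IsIso (KK M d).LL := by
  obtain ⟨hLl, hLs, hmax⟩ := hL
  obtain ⟨Φ, hs, hle⟩ := hF.exists_isSplit_range_ge hM hθ hLl hLs
  have hlin := hs.isIso_range.isStronglyLinear (KK_LL_isLinearFrame M d).isStronglyLinear
  exact (Φ.isIso_of_range_eq hs.injective
    fun j => (hmax Φ.range hlin hs.isQuasiSplit_range hle j).symm).symm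

end IsMinimalFreeResolution

theorem topSubcomplex_isMaximalStronglyLinear {C : GrComplex.{v} k w} (hC : C.IsStronglyLinear) :
    C.topSubcomplex.IsMaximalStronglyLinear := by
  refine ⟨C.isIso_topSubcomplex.isStronglyLinear hC, fun j => ⟨⊥, ?_, isCompl_top_bot⟩,
    fun L _ _ hle j => top_le_iff.mp (hle j)⟩
  intro x hx
  rw [(Submodule.mem_bot (PolyS k n)).mp hx]
  exact zero_mem _

end GrComplex

end LinearStrand

end MultigradedBGG

theorem theorem1p2 {k : Type*} [Field k] {n : ℕ} {A : Type*} [AddCommGroup A]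
    (w : Fin (n + 1) → A) (hw : IsPositive k w)
    (M : GrMod k w) (d : A) (hM : M.IsGeneratedInDegree d)
    (F : GrComplex k w) (ε : F.X 0 →ₗ[PolyS k n] M) (hF : F.IsMinimalFreeResolution M ε) :
    -- `L(K_d(M))` is a strongly linear, quasi-split subcomplex of `F`
    ((KK M d).LL.IsStronglyLinear ∧
      ∃ L : F.Subcomplex, L.IsQuasiSplit ∧ L.toComplex.IsIso (KK M d).LL) ∧
    -- every strongly linear, quasi-split subcomplex of `F` is isomorphic to a quasi-split
    -- subcomplex of `L(K_d(M))`
    (∀ L : F.Subcomplex, L.toComplex.IsStronglyLinear → L.IsQuasiSplit →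
      ∃ L' : (KK M d).LL.Subcomplex, L'.IsQuasiSplit ∧ L.toComplex.IsIso L'.toComplex) ∧
    -- `L(K_d(M))` is, up to isomorphism, the unique maximal strongly linear, quasi-split
    -- subcomplex of `F`
    ((∃ L : F.Subcomplex, L.IsMaximalStronglyLinear ∧ L.toComplex.IsIso (KK M d).LL) ∧
      ∀ L : F.Subcomplex, L.IsMaximalStronglyLinear → L.toComplex.IsIso (KK M d).LL) ∧
    -- if `F` is strongly linear, then it is isomorphic to `L(K_d(M))`
    (F.IsStronglyLinear → F.IsIso (KK M d).LL) := by
  obtain ⟨-, θ, hθ⟩ := hw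
  obtain ⟨Φ, hΦ, hs⟩ := hF.exists_hom_KK_LL hM hθ
  have hmax : Φ.range.IsMaximalStronglyLinear := hF.range_isMaximalStronglyLinear hM hθ hΦ hs
  have hiso : Φ.range.toComplex.IsIso (KK M d).LL := hs.isIso_range.symm
  have huniq : ∀ L : F.Subcomplex, L.IsMaximalStronglyLinear → L.toComplex.IsIso (KK M d).LL :=
    fun _ => hF.isIso_of_isMaximalStronglyLinear hM hθ
  refine ⟨⟨(KK_LL_isLinearFrame M d).isStronglyLinear, Φ.range, hmax.2.1, hiso⟩,
    fun L hL hLs => ?_, ⟨⟨Φ.range, hmax, hiso⟩, huniq⟩, fun hlin => ?_⟩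
  · obtain ⟨Ψ, hΨ⟩ := hF.exists_isSplit_of_isStronglyLinear hM hL hLs
    exact ⟨Ψ.range, hΨ.isQuasiSplit_range, hΨ.isIso_range⟩
  · exact F.isIso_topSubcomplex.trans
      (huniq _ (GrComplex.topSubcomplex_isMaximalStronglyLinear hlin))
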